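/- Let $M$ be a closed (compact, without boundary) smooth manifold of dimension $n$. Let $\mathcal S$ be the Fréchet space of smooth symmetric $(0,2)$-tensor fields on $M$ and $\mathcal M\subset\mathcal S$ the open cone of smooth Riemannian metrics. For $g\in\mathcal M$ let $\mu_g$ be its Riemannian measure and put $$(h,k)_g=\int_M \operatorname{tr}(g^{-1}hg^{-1}k)\,d\mu_g,\qquad \|h\|_g=\sqrt{(h,h)_g}.$$ The assignment $g\mapsto(\cdot,\cdot)_g$ is the (weak Riemannian) $L^2$ metric on $\mathcal M$; let $d(g_0,g_1)$ be the infimum of the lengths $\int\|g_t'\|_{g_t}\,dt$ over all piecewise $C^1$ paths $g_t$ in $\mathcal M$ from $g_0$ to $g_1$. Fix $g\in\mathcal M$ and a finite smooth atlas $\{(U_\alpha,\phi_\alpha)\}$ of $M$ such that for each $\alpha$ there are a compact set $K_\alpha$ and a smooth chart $(V_\alpha,\psi_\alpha)$ with $U_\alpha\subset K_\alpha\subset V_\alpha$ and $\phi_\alpha=\psi_\alpha|_{U_\alpha}$. A subset $\mathcal U\subset\mathcal M$ is called amenable if it is convex and there are constants $C,\delta>0$ such that, for all $\tilde g\in\mathcal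 U$, all eigenvalues of $g^{-1}\tilde g$ are at least $\delta$ at every $x\in M$, and $|\tilde g_{ij}(x)|\le C$ for all $\alpha$, all $x\in U_\alpha$ and all $i,j$, the coefficients being taken in the chart $\phi_\alpha$. Let $\mathcal S^0$ be the space of symmetric $(0,2)$-tensor fields with measurable coefficients and finite norm $\|\cdot\|_g$, modulo equality almost everywhere, let $\mathcal M^0\subset\mathcal S^0$ be the set of those that are positive definite at almost every point, and let $\mathcal U^0$ be the set of all elements of $\mathcal M^0$ that are limits, with respect to $\|\cdot\|_g$, of sequences in $\mathcal U$. **Theorem.** Let $\mathcal U\subset\mathcal M$ be amenable. Then $d$ is a metric on $\mathcal U$, and the topology that it induces on $\mathcal U$ coincides with the topology induced by $\|\cdot\|_g$. Moreover: 1. There is a constant $K$ such that $d(g_0,g_1)\le K\|g_1-g_0\|_g$ for all $g_0,g_1\in\mathcal U$. 2. For every $\varepsilon>0$ there is $\delta>0$ such that, for all $g_0,g_1\in\mathcal U$, $d(g_0,g_1)<\delta$ implies $\|g_0-g_1\|_g<\varepsilon$. 3. Let $\overline{\mathcal U}$ be the completion of $\mathcal U$ with respect to $d$. There is a homeomorphism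 $\Phi:\overline{\mathcal U}\to\mathcal U^0$, uniformly continuous together with its inverse when $\mathcal U^0$ carries the metric $\|p-q\|_g$, which extends the inclusion $\mathcal U\to\mathcal U^0$. For all $p,q\in\mathcal U^0$ the limit $d(p,q)=\lim_{k\to\infty}d(g^0_k,g^1_k)$ exists and is the same for all sequences $\{g^0_k\},\{g^1_k\}$ in $\mathcal U$ that converge in $\|\cdot\|_g$ to $p$ and $q$ respectively, and $\Phi$ is an isometry from $\overline{\mathcal U}$ onto $\mathcal U^0$ with the metric $d$ so defined. -/

import Mathlib

open Set Filter Topology MeasureTheory Bundle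
open scoped Manifold ContDiff

noncomputable section

namespace MetricManifold

/-! ### Tensor fields on a manifold -/

section Tensors

variable (n : ℕ) (M : Type*) [TopologicalSpace M] [ChartedSpace (EuclideanSpace ℝ (Fin n)) M]

/-- Bilinear forms on the tangent space at `x`. -/
abbrev BilinFibre (x : M) : Type :=
  TangentSpace (𝓡 n) x →L[ℝ] TangentSpace (𝓡 n) x →L[ℝ] ℝ

/-- Arbitrary (not necessarily continuous or measurable) `(0,2)`-tensor fields. -/
abbrev TensorField : Type _ := (x : M) → BilinFibre n M x

instance instIsTopologicalAddGroupCotangent (x : M) :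
    IsTopologicalAddGroup (TangentSpace (𝓡 n) x →L[ℝ] ℝ) :=
  inferInstanceAs (IsTopologicalAddGroup (EuclideanSpace ℝ (Fin n) →L[ℝ] ℝ))

instance instContinuousAddCotangent (x : M) :
    ContinuousAdd (TangentSpace (𝓡 n) x →L[ℝ] ℝ) :=
  (instIsTopologicalAddGroupCotangent n M x).toContinuousAdd

instance instContinuousConstSMulCotangent (x : M) :
    ContinuousConstSMul ℝ (TangentSpace (𝓡 n) x →L[ℝ] ℝ) :=
  inferInstanceAs (ContinuousConstSMul ℝ (EuclideanSpace ℝ (Fin n) →L[ℝ] ℝ))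

instance instAddCommGroupBilinFibre (x : M) : AddCommGroup (BilinFibre n M x) :=
  ContinuousLinearMap.addCommGroup

instance instModuleBilinFibre (x : M) : Module ℝ (BilinFibre n M x) :=
  ContinuousLinearMap.module

instance instAddCommGroupTensorField : AddCommGroup (TensorField n M) :=
  Pi.addCommGroup

instance instModuleTensorField : Module ℝ (TensorField n M) :=
  Pi.module _ _ _

variable [IsManifold (𝓡 n) ∞ M]

variable {n M} in
/-- Smoothness of a `(0,2)`-tensor field, as a section of the bundle of bilinear forms on `TM`. -/
def IsSmooth (h : TensorField n M) : Prop :=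
  ContMDiff (𝓡 n) ((𝓡 n).prod 𝓘(ℝ, EuclideanSpace ℝ (Fin n) →L[ℝ] EuclideanSpace ℝ (Fin n) →L[ℝ] ℝ))
    ∞ (fun x => TotalSpace.mk'
      (EuclideanSpace ℝ (Fin n) →L[ℝ] EuclideanSpace ℝ (Fin n) →L[ℝ] ℝ) (E := BilinFibre n M) x (h x))

/-- The subspace of smooth symmetric `(0,2)`-tensor fields. -/
def symTensorSubmodule : Submodule ℝ (TensorField n M) where
  carrier := {h | IsSmooth h ∧ ∀ (x : M) (u v : TangentSpace (𝓡 n) x), h x u v = h x v u}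
  add_mem' := by
    rintro a b ⟨ha, ha'⟩ ⟨hb, hb'⟩
    refine ⟨ContMDiff.add_section ha hb, fun x u v => ?_⟩
    simp [ha' x u v, hb' x u v]
  zero_mem' := by
    refine ⟨contMDiff_zeroSection _ _, fun x u v => by simp⟩
  smul_mem' := by
    rintro c a ⟨ha, ha'⟩
    refine ⟨ContMDiff.const_smul_section ha, fun x u v => ?_⟩
    simp [ha' x u v]

/-- The real vector space `𝒮` of smooth symmetric `(0,2)`-tensor fields. -/
def SymTensor : Type _ := symTensorSubmodule n M

instance : AddCommGroup (SymTensor n M) := inferInstanceAs (AddCommGroup (symTensorSubmodule n M))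

instance : Module ℝ (SymTensor n M) := inferInstanceAs (Module ℝ (symTensorSubmodule n M))

variable {n M} in
/-- The tensor field underlying an element of `𝒮`. -/
def field (h : SymTensor n M) : TensorField n M := h.1

/-- The space `𝓜` of smooth Riemannian metrics, as a subset of `𝒮`. -/
def riemMetrics : Set (SymTensor n M) :=
  {g | ∀ (x : M) (v : TangentSpace (𝓡 n) x), v ≠ 0 → 0 < field g x v v}

end Tensors

/-! ### Linear algebra on the tangent spaces -/

section Pointwise

variable {n : ℕ} {M : Type*} [TopologicalSpace M] [ChartedSpace (EuclideanSpace ℝ (Fin n)) M]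

/-- The matrix of a bilinear form on `T_x M` in the standard basis of `T_x M`. -/
def gram {x : M} (b : BilinFibre n M x) : Matrix (Fin n) (Fin n) ℝ :=
  Matrix.of fun i j =>
    b (EuclideanSpace.single i (1 : ℝ) : EuclideanSpace ℝ (Fin n))
      (EuclideanSpace.single j (1 : ℝ) : EuclideanSpace ℝ (Fin n))

/-- The endomorphism `H = g⁻¹ h` of `T_x M` obtained by raising an index of `h` with `g`, as a
matrix in the standard basis of `T_x M`. Its trace and its eigenvalues do not depend on the
basis. -/
def raise {x : M} (g h : BilinFibre n M x) : Matrix (Fin n) (Fin n) ℝ :=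
  (gram g)⁻¹ * gram h

/-- The scalar product `tr_g (h k) = tr (g⁻¹ h g⁻¹ k)` at a point. -/
def trPair {x : M} (g h k : BilinFibre n M x) : ℝ :=
  (raise g h * raise g k).trace

/-- The coordinate vector `∂_i` at the point with coordinates `y` in the chart `φ`. -/
def coordVec (φ : OpenPartialHomeomorph M (EuclideanSpace ℝ (Fin n)))
    (y : EuclideanSpace ℝ (Fin n)) (i : Fin n) : TangentSpace (𝓡 n) (φ.symm y) :=
  mfderiv (𝓡 n) (𝓡 n) φ.symm y (EuclideanSpace.single i (1 : ℝ) : EuclideanSpace ℝ (Fin n))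

/-- The coefficients `h_{ij} = h(∂_i, ∂_j)` in the chart `φ`, as functions of the coordinates. -/
def coeff (φ : OpenPartialHomeomorph M (EuclideanSpace ℝ (Fin n))) (h : TensorField n M)
    (y : EuclideanSpace ℝ (Fin n)) : Matrix (Fin n) (Fin n) ℝ :=
  Matrix.of fun i j => h (φ.symm y) (coordVec φ y i) (coordVec φ y j)

end Pointwise

/-! ### Amenable atlases -/

/-- A finite smooth atlas each of whose charts is the restriction of a smooth chart whose domain
contains a compact set containing the domain of the smaller chart. -/
structure AmenableAtlas (n : ℕ) (M : Type*) [TopologicalSpace M]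
    [ChartedSpace (EuclideanSpace ℝ (Fin n)) M] where
  /-- the number of charts -/
  size : ℕ
  /-- the charts -/
  chart : Fin size → OpenPartialHomeomorph M (EuclideanSpace ℝ (Fin n))
  chart_mem : ∀ a, chart a ∈ IsManifold.maximalAtlas (𝓡 n) ∞ M
  cover : ∀ x : M, ∃ a, x ∈ (chart a).source
  extends_chart : ∀ a, ∃ (K : Set M) (ψ : OpenPartialHomeomorph M (EuclideanSpace ℝ (Fin n))),
    ψ ∈ IsManifold.maximalAtlas (𝓡 n) ∞ M ∧ IsCompact K ∧
      (chart a).source ⊆ K ∧ K ⊆ ψ.source ∧ EqOn (chart a) ψ (chart a).source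

section

variable {n : ℕ} {M : Type*} [TopologicalSpace M] [ChartedSpace (EuclideanSpace ℝ (Fin n)) M]

/-! ### The Riemannian measure and the `L²` metric -/

/-- Disjoint pieces of `M`, the `a`-th one inside the `a`-th chart domain, that cover `M`. -/
def AmenableAtlas.piece (𝒜 : AmenableAtlas n M) (a : Fin 𝒜.size) : Set M :=
  (𝒜.chart a).source \ ⋃ b : Fin 𝒜.size, ⋃ _ : b < a, (𝒜.chart b).source

/-- The measure `μ_g` induced by `g`: on each piece of `M` it is `√(det g_{ij}) dx¹ ⋯ dxⁿ` in the
corresponding chart. -/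
def vol [MeasurableSpace M] (𝒜 : AmenableAtlas n M) (g : TensorField n M) : Measure M :=
  Measure.sum fun a : Fin 𝒜.size =>
    (((volume : Measure (EuclideanSpace ℝ (Fin n))).withDensity
        (fun y => ENNReal.ofReal (Real.sqrt (coeff (𝒜.chart a) g y).det))).restrict
      ((𝒜.chart a).target ∩ (𝒜.chart a).symm ⁻¹' 𝒜.piece a)).map (𝒜.chart a).symm

/-- The `L²` norm `‖h‖_g = (∫ tr_g (h h) dμ_g)^{1/2}`. -/
def l2Norm [MeasurableSpace M] (𝒜 : AmenableAtlas n M) (g h : TensorField n M) : ℝ :=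
  Real.sqrt (∫ x, trPair (g x) (h x) (h x) ∂(vol 𝒜 g))

/-! ### The space `𝒮⁰` of `L²` symmetric tensor fields -/

/-- Equality almost everywhere with respect to `μ_g`. -/
def aeSetoid [MeasurableSpace M] (𝒜 : AmenableAtlas n M) (g : TensorField n M) :
    Setoid (TensorField n M) where
  r h k := ∀ᵐ x ∂(vol 𝒜 g), h x = k x
  iseqv :=
    { refl := fun _ => Eventually.of_forall fun _ => rfl
      symm := fun h => h.mono fun _ hx => hx.symm
      trans := fun h k => by filter_upwards [h, k] with x hx kx using hx.trans kx }

/-- Tensor fields up to equality almost everywhere. -/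
def TensorClass [MeasurableSpace M] (𝒜 : AmenableAtlas n M) (g : TensorField n M) : Type _ :=
  Quotient (aeSetoid 𝒜 g)

/-- The class of a tensor field. -/
def toClass [MeasurableSpace M] (𝒜 : AmenableAtlas n M) (g h : TensorField n M) :
    TensorClass 𝒜 g :=
  Quotient.mk (aeSetoid 𝒜 g) h

/-- The distance `‖h - k‖_g` of two classes. -/
def l2Dist [MeasurableSpace M] (𝒜 : AmenableAtlas n M) (g : TensorField n M) :
    TensorClass 𝒜 g → TensorClass 𝒜 g → ℝ :=
  Quotient.lift₂ (s₁ := aeSetoid 𝒜 g) (s₂ := aeSetoid 𝒜 g) (fun h k => l2Norm 𝒜 g (h - k)) (by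
    intro h k h' k' hh hk
    have hh' : ∀ᵐ x ∂(vol 𝒜 g), h x = h' x := hh
    have hk' : ∀ᵐ x ∂(vol 𝒜 g), k x = k' x := hk
    unfold l2Norm
    congr 1
    refine integral_congr_ae ?_
    filter_upwards [hh', hk'] with x hx kx
    simp only [Pi.sub_apply, hx, kx])

/-- A symmetric tensor field with (Lebesgue) measurable coefficients and finite `L²` norm. -/
structure IsL2Tensor [MeasurableSpace M] (𝒜 : AmenableAtlas n M) (g h : TensorField n M) :
    Prop where
  symm : ∀ (x : M) (u v : TangentSpace (𝓡 n) x), h x u v = h x v u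
  measurable : ∀ (a : Fin 𝒜.size) (i j : Fin n),
    AEMeasurable (fun x => coeff (𝒜.chart a) h (𝒜.chart a x) i j)
      ((vol 𝒜 g).restrict (𝒜.chart a).source)
  integrable : Integrable (fun x => trPair (g x) (h x) (h x)) (vol 𝒜 g)

/-- The space `𝓜⁰`: classes of `L²` symmetric tensor fields that are positive definite at almost
every point. -/
def l2Metrics [MeasurableSpace M] (𝒜 : AmenableAtlas n M) (g : TensorField n M) :
    Set (TensorClass 𝒜 g) :=
  {p | ∃ h : TensorField n M, toClass 𝒜 g h = p ∧ IsL2Tensor 𝒜 g h ∧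
    ∀ᵐ x ∂(vol 𝒜 g), ∀ v : TangentSpace (𝓡 n) x, v ≠ 0 → 0 < h x v v}

variable [IsManifold (𝓡 n) ∞ M]

/-- A sequence of smooth tensor fields `L²`-converges to a class. -/
def L2Tendsto [MeasurableSpace M] (𝒜 : AmenableAtlas n M) (g : TensorField n M)
    (s : ℕ → SymTensor n M) (p : TensorClass 𝒜 g) : Prop :=
  Tendsto (fun k => l2Dist 𝒜 g (toClass 𝒜 g (field (s k))) p) atTop (𝓝 0)

/-- The set `𝒰⁰` of all elements of `𝓜⁰` that are `L²`-limits of sequences in `𝒰`. -/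
def l2Closure [MeasurableSpace M] (𝒜 : AmenableAtlas n M) (g : TensorField n M)
    (𝒰 : Set (SymTensor n M)) : Set (TensorClass 𝒜 g) :=
  {p | p ∈ l2Metrics 𝒜 g ∧ ∃ s : ℕ → SymTensor n M, (∀ k, s k ∈ 𝒰) ∧ L2Tendsto 𝒜 g s p}

/-! ### Paths in `𝓜` and the Riemannian distance -/

/-- Convergence in the Fréchet space `𝒮`, i.e. with respect to all `C^k` norms: all derivatives of
all coefficients converge uniformly on the charts of the atlas. -/
def CInfTendsto (𝒜 : AmenableAtlas n M) {β : Type*} (f : β → SymTensor n M) (l : Filter β)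
    (h : SymTensor n M) : Prop :=
  ∀ (a : Fin 𝒜.size) (i j : Fin n) (k : ℕ),
    TendstoUniformlyOn
      (fun t y => iteratedFDeriv ℝ k (fun z => coeff (𝒜.chart a) (field (f t)) z i j) y)
      (fun y => iteratedFDeriv ℝ k (fun z => coeff (𝒜.chart a) (field h) z i j) y)
      l (𝒜.chart a).target

/-- A piecewise `C¹` path in `𝓜` (with respect to the Fréchet topology) from `g₀` to `g₁`, defined
on `[time 0, time N]` and `C¹` on each `[time i, time (i+1)]`, where `vel i` is its derivative. -/
structure PiecewiseC1Path (𝒜 : AmenableAtlas n M) (g₀ g₁ : SymTensor n M) where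
  /-- the number of pieces -/
  N : ℕ
  /-- the partition -/
  time : Fin (N + 1) → ℝ
  time_mono : StrictMono time
  /-- the path -/
  path : ℝ → SymTensor n M
  /-- the derivative of the path on each piece -/
  vel : Fin N → ℝ → SymTensor n M
  start : path (time 0) = g₀
  finish : path (time (Fin.last N)) = g₁
  mem : ∀ t ∈ Icc (time 0) (time (Fin.last N)), path t ∈ riemMetrics n M
  deriv : ∀ (i : Fin N), ∀ t ∈ Icc (time i.castSucc) (time i.succ),
    CInfTendsto 𝒜 (fun s => (s - t)⁻¹ • (path s - path t))
      (𝓝[Icc (time i.castSucc) (time i.succ) \ {t}] t) (vel i t)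
  vel_cont : ∀ (i : Fin N), ∀ t ∈ Icc (time i.castSucc) (time i.succ),
    CInfTendsto 𝒜 (vel i) (𝓝[Icc (time i.castSucc) (time i.succ)] t) (vel i t)

/-- The length `∫ ‖g_t'‖_{g_t} dt` of a path with respect to the `L²` metric on `𝓜`. -/
def PiecewiseC1Path.length [MeasurableSpace M] {𝒜 : AmenableAtlas n M} {g₀ g₁ : SymTensor n M}
    (γ : PiecewiseC1Path 𝒜 g₀ g₁) : ℝ :=
  ∑ i : Fin γ.N, ∫ t in (γ.time i.castSucc)..(γ.time i.succ),
    l2Norm 𝒜 (field (γ.path t)) (field (γ.vel i t))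

/-- The Riemannian distance function `d` of the `L²` metric on `𝓜`. -/
def riemDist [MeasurableSpace M] (𝒜 : AmenableAtlas n M) (g₀ g₁ : SymTensor n M) : ℝ :=
  ⨅ γ : PiecewiseC1Path 𝒜 g₀ g₁, γ.length

/-! ### Amenable subsets -/

/-- Amenable subsets of `𝓜`, with respect to the reference metric `g` and the atlas `𝒜`. -/
structure IsAmenable (𝒜 : AmenableAtlas n M) (g : SymTensor n M) (𝒰 : Set (SymTensor n M)) :
    Prop where
  subset : 𝒰 ⊆ riemMetrics n M
  convex : Convex ℝ 𝒰
  bounds : ∃ C > (0 : ℝ), ∃ δ > (0 : ℝ), ∀ h ∈ 𝒰,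
    (∀ (x : M) (lam : ℝ),
      Module.End.HasEigenvalue (Matrix.toLin' (raise (field g x) (field h x))) lam → δ ≤ lam) ∧
    (∀ (a : Fin 𝒜.size), ∀ x ∈ (𝒜.chart a).source, ∀ i j : Fin n,
      |coeff (𝒜.chart a) (field h) (𝒜.chart a x) i j| ≤ C)

end

end MetricManifold

end

/-!
# The completion of an amenable set of Riemannian metrics for the `L²` metric

On an amenable set `𝒰` the distance `d` and the `L²` norm are bi-Lipschitz equivalent; everything
else follows from this and from the completeness of `𝒰⁰`.

All integrals are taken against one finite measure `refMeasure 𝒜`, coordinate Lebesgue measure on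
disjoint pieces of `M`, and tensor fields are replaced by their coefficient matrices `coefM 𝒜 h` in
the corresponding charts. Then `‖h‖_g² = ∫ tr (A⁻¹ H A⁻¹ H) √(det A)` with `A` and `H` the
coefficient matrices of `g` and `h` (`l2Norm_eq`). Amenability means that the matrices `A` of all
metrics in `𝒰` have bounded entries and determinant bounded below by a positive constant
(`IsAmenable.exists_inRegion`). On such a region the integrand is comparable to the Frobenius norm
of `H` (`exists_matPair_le`, `exists_frobSq_le`).

*Upper bound for `d`.* The set `𝒰` is convex, the norms `‖·‖_{g_t}` along a segment are uniformly
comparable to `‖·‖_g`, and so the length of the segment is at most `K ‖g₁ - g₀‖_g`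
(`IsAmenable.exists_riemDist_le`).

*Lower bound for `d`.* A path in `𝓜` between two elements of `𝒰` may leave every bounded region, so
one needs functions whose variation is controlled on the whole cone of positive definite matrices.
The functions `rootFun v A = det(A)^{1/4} / (1 + vᵀ A v)` are such: along any path `A(t)`,
`|d/dt rootFun v A| ≤ (n + 1) (tr (A⁻¹ A' A⁻¹ A') √(det A))^{1/2}`
(`exists_hasDerivWithinAt_rootFun`). Integrating in `t`, taking `L²` norms over `M` and using
Minkowski's integral inequality bounds the `L²` distance of `rootFun v A₀` and `rootFun v A₁` by a
multiple of the length of the path (`IsC1MatrixPath.eLpNorm_rootFun_sub_le`). On a bounded region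
the entries of `A` are Lipschitz functions of finitely many of the values `rootFun v A`
(`exists_entry_sub_le`), whence `‖g₁ - g₀‖_g ≤ K d(g₀, g₁)` (`IsAmenable.exists_l2Norm_le`).

*Completeness of `𝒰⁰`.* A rapidly Cauchy sequence in `𝒰` has coefficients that converge in `L²` and
almost everywhere. The limit is positive semidefinite with determinant bounded below by a positive
constant, hence positive definite (`IsAmenable.exists_l2_limit`). So `𝒰⁰` with the `L²` distance is
complete and contains `𝒰`, with a metric uniformly equivalent to `d`, as a dense subset; this
identifies it with the completion of `(𝒰, d)` (`exists_completion_equiv`).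
-/

noncomputable section

namespace MetricManifold

/-! ### Symmetric matrices and the invariant metric on the positive definite cone -/

section MatrixLayer

open Matrix

variable {n : ℕ}

/-- The squared Frobenius norm of a matrix. -/
def frobSq (H : Matrix (Fin n) (Fin n) ℝ) : ℝ := ∑ i, ∑ j, H i j ^ 2

/-- The pairing `tr (A⁻¹ H A⁻¹ K)` of matrices. -/
def matPair (A H K : Matrix (Fin n) (Fin n) ℝ) : ℝ := ((A⁻¹ * H) * (A⁻¹ * K)).trace

lemma frobSq_nonneg (H : Matrix (Fin n) (Fin n) ℝ) : 0 ≤ frobSq H := by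
  unfold frobSq; positivity

lemma frobSq_eq_trace {S : Matrix (Fin n) (Fin n) ℝ} : frobSq S = (Sᵀ * S).trace := by
  simp only [frobSq, Matrix.trace, Matrix.diag, Matrix.mul_apply, Matrix.transpose_apply]
  rw [Finset.sum_comm]
  exact Finset.sum_congr rfl fun i _ => Finset.sum_congr rfl fun j _ => by ring

lemma frobSq_transpose (H : Matrix (Fin n) (Fin n) ℝ) : frobSq Hᵀ = frobSq H := by
  simp only [frobSq, Matrix.transpose_apply]
  exact Finset.sum_comm

lemma sq_le_frobSq (H : Matrix (Fin n) (Fin n) ℝ) (i j : Fin n) : H i j ^ 2 ≤ frobSq H := by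
  unfold frobSq
  calc H i j ^ 2 ≤ ∑ j, H i j ^ 2 :=
        Finset.single_le_sum (f := fun j => H i j ^ 2) (fun _ _ => sq_nonneg _) (Finset.mem_univ j)
    _ ≤ _ := Finset.single_le_sum (f := fun i => ∑ j, H i j ^ 2)
        (fun _ _ => Finset.sum_nonneg fun _ _ => sq_nonneg _) (Finset.mem_univ i)

lemma frobSq_mul_le (X Y : Matrix (Fin n) (Fin n) ℝ) : frobSq (X * Y) ≤ frobSq X * frobSq Y := by
  have h : ∀ i j, (X * Y) i j ^ 2 ≤ (∑ k, X i k ^ 2) * ∑ k, Y k j ^ 2 := fun i j => by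
    rw [Matrix.mul_apply]
    exact Finset.sum_mul_sq_le_sq_mul_sq _ _ _
  calc frobSq (X * Y) ≤ ∑ i, ∑ j, (∑ k, X i k ^ 2) * ∑ k, Y k j ^ 2 :=
        Finset.sum_le_sum fun i _ => Finset.sum_le_sum fun j _ => h i j
    _ = frobSq X * frobSq Y := by
        simp only [← Finset.mul_sum, ← Finset.sum_mul, frobSq]
        rw [Finset.sum_comm (f := fun i j => Y i j ^ 2)]

lemma trace_mul_self_le (X : Matrix (Fin n) (Fin n) ℝ) : (X * X).trace ≤ frobSq X := by
  have h1 : (X * X).trace = ∑ i, ∑ j, X i j * X j i := by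
    simp [Matrix.trace, Matrix.mul_apply]
  have h2 : frobSq X = ∑ i, ∑ j, (X i j ^ 2 + X j i ^ 2) / 2 := by
    have h3 : ∑ i, ∑ j, X j i ^ 2 = frobSq X := Finset.sum_comm
    simp only [← Finset.sum_div, Finset.sum_add_distrib, h3]
    unfold frobSq; ring
  rw [h1, h2]
  exact Finset.sum_le_sum fun i _ => Finset.sum_le_sum fun j _ => by
    nlinarith [sq_nonneg (X i j - X j i)]

/-- A positive definite matrix `A` factors as `Bᵀ B` with `B` invertible. -/
lemma exists_transpose_mul_self {A : Matrix (Fin n) (Fin n) ℝ} (hA : A.PosDef) :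
    ∃ B : Matrix (Fin n) (Fin n) ℝ, IsUnit B.det ∧ A = Bᵀ * B := by
  open scoped MatrixOrder in
  obtain ⟨B, hB⟩ := CStarAlgebra.nonneg_iff_eq_star_mul_self.mp
    (Matrix.nonneg_iff_posSemidef.mpr hA.posSemidef)
  have hB' : A = Bᵀ * B := by
    rw [hB, Matrix.star_eq_conjTranspose, conjTranspose_eq_transpose_of_trivial]
  refine ⟨B, ?_, hB'⟩
  have := hA.det_pos
  rw [hB', Matrix.det_mul, Matrix.det_transpose] at this
  exact isUnit_iff_ne_zero.mpr fun h => by simp [h] at this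

/-- Normal form: in coordinates where `A` is the identity, a symmetric `H` becomes a symmetric
`S`, and the invariant pairing becomes the Frobenius pairing. -/
lemma exists_normal_form {A H : Matrix (Fin n) (Fin n) ℝ} (hA : A.PosDef) (hH : Hᵀ = H) :
    ∃ B S : Matrix (Fin n) (Fin n) ℝ, IsUnit B.det ∧ A = Bᵀ * B ∧ Sᵀ = S ∧ H = Bᵀ * S * B ∧
      A⁻¹ * H = B⁻¹ * S * B ∧ matPair A H H = frobSq S := by
  obtain ⟨B, hB, hAB⟩ := exists_transpose_mul_self hA
  have hBt : IsUnit Bᵀ.det := by rwa [Matrix.det_transpose]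
  set S := (Bᵀ)⁻¹ * H * B⁻¹ with hS
  have hSt : Sᵀ = S := by
    rw [hS, transpose_mul, transpose_mul, hH, transpose_nonsing_inv, transpose_nonsing_inv,
      transpose_transpose, Matrix.mul_assoc]
  have hHS : H = Bᵀ * S * B := by
    rw [hS, Matrix.mul_assoc, Matrix.mul_assoc, Matrix.nonsing_inv_mul _ hB, Matrix.mul_one,
      ← Matrix.mul_assoc, Matrix.mul_nonsing_inv _ hBt, Matrix.one_mul]
  have hAH : A⁻¹ * H = B⁻¹ * S * B := by
    rw [hHS, hAB, Matrix.mul_inv_rev, Matrix.mul_assoc, Matrix.mul_assoc Bᵀ,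
      ← Matrix.mul_assoc (Bᵀ)⁻¹, Matrix.nonsing_inv_mul _ hBt, Matrix.one_mul, ← Matrix.mul_assoc]
  refine ⟨B, S, hB, hAB, hSt, hHS, hAH, ?_⟩
  rw [matPair, hAH, frobSq_eq_trace, hSt]
  have : B⁻¹ * S * B * (B⁻¹ * S * B) = B⁻¹ * (S * S * B) := by
    simp only [Matrix.mul_assoc]
    rw [← Matrix.mul_assoc B, Matrix.mul_nonsing_inv _ hB, Matrix.one_mul]
  rw [this, Matrix.trace_mul_comm, Matrix.mul_assoc, Matrix.mul_nonsing_inv _ hB, Matrix.mul_one]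

lemma matPair_self_nonneg {A H : Matrix (Fin n) (Fin n) ℝ} (hA : A.PosDef) (hH : Hᵀ = H) :
    0 ≤ matPair A H H := by
  obtain ⟨B, S, -, -, -, -, -, h⟩ := exists_normal_form hA hH
  rw [h]; exact frobSq_nonneg S

lemma frobSq_le_matPair {A H : Matrix (Fin n) (Fin n) ℝ} (hA : A.PosDef) (hH : Hᵀ = H) :
    frobSq H ≤ A.trace ^ 2 * matPair A H H := by
  obtain ⟨B, S, -, hAB, -, hHS, -, h⟩ := exists_normal_form hA hH
  rw [h, hAB, ← frobSq_eq_trace, hHS]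
  calc frobSq (Bᵀ * S * B) ≤ frobSq (Bᵀ * S) * frobSq B := frobSq_mul_le _ _
    _ ≤ (frobSq Bᵀ * frobSq S) * frobSq B :=
        mul_le_mul_of_nonneg_right (frobSq_mul_le _ _) (frobSq_nonneg _)
    _ = _ := by rw [frobSq_transpose]; ring

lemma trace_sq_le_matPair {A H : Matrix (Fin n) (Fin n) ℝ} (hA : A.PosDef) (hH : Hᵀ = H) :
    (A⁻¹ * H).trace ^ 2 ≤ n * matPair A H H := by
  obtain ⟨B, S, hB, -, -, -, hAH, h⟩ := exists_normal_form hA hH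
  have htr : (A⁻¹ * H).trace = ∑ i, S i i := by
    rw [hAH, Matrix.mul_assoc, Matrix.trace_mul_comm, Matrix.mul_assoc,
      Matrix.mul_nonsing_inv _ hB, Matrix.mul_one]
    rfl
  rw [h, htr]
  calc (∑ i, S i i) ^ 2 ≤ (Finset.univ : Finset (Fin n)).card * ∑ i, S i i ^ 2 :=
        sq_sum_le_card_mul_sum_sq
    _ ≤ n * frobSq S := by
        rw [Finset.card_univ, Fintype.card_fin]
        refine mul_le_mul_of_nonneg_left (Finset.sum_le_sum fun i _ => ?_) (Nat.cast_nonneg n)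
        exact Finset.single_le_sum (f := fun j => S i j ^ 2) (fun _ _ => sq_nonneg _)
          (Finset.mem_univ i)

lemma quadForm_sq_le_frobSq (S : Matrix (Fin n) (Fin n) ℝ) (w : Fin n → ℝ) :
    (w ⬝ᵥ S *ᵥ w) ^ 2 ≤ (w ⬝ᵥ w) ^ 2 * frobSq S := by
  have h1 : (w ⬝ᵥ S *ᵥ w) ^ 2 ≤ (∑ i, w i ^ 2) * ∑ i, (S *ᵥ w) i ^ 2 :=
    Finset.sum_mul_sq_le_sq_mul_sq _ _ _
  have h2 : ∑ i, (S *ᵥ w) i ^ 2 ≤ frobSq S * ∑ i, w i ^ 2 := by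
    rw [frobSq, Finset.sum_mul]
    refine Finset.sum_le_sum fun i _ => ?_
    change (∑ j, S i j * w j) ^ 2 ≤ _
    exact Finset.sum_mul_sq_le_sq_mul_sq _ _ _
  have h3 : w ⬝ᵥ w = ∑ i, w i ^ 2 := by
    simp only [dotProduct, sq]
  have h4 : 0 ≤ ∑ i, w i ^ 2 := by positivity
  rw [h3]
  calc _ ≤ _ := h1
    _ ≤ (∑ i, w i ^ 2) * (frobSq S * ∑ i, w i ^ 2) := mul_le_mul_of_nonneg_left h2 h4
    _ = _ := by ring

lemma quadForm_sq_le_matPair {A H : Matrix (Fin n) (Fin n) ℝ} (hA : A.PosDef) (hH : Hᵀ = H)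
    (v : Fin n → ℝ) : (v ⬝ᵥ H *ᵥ v) ^ 2 ≤ (v ⬝ᵥ A *ᵥ v) ^ 2 * matPair A H H := by
  obtain ⟨B, S, hB, hAB, -, hHS, -, h⟩ := exists_normal_form hA hH
  have h1 : v ⬝ᵥ H *ᵥ v = (B *ᵥ v) ⬝ᵥ S *ᵥ (B *ᵥ v) := by
    rw [hHS, ← Matrix.mulVec_mulVec, ← Matrix.mulVec_mulVec, Matrix.dotProduct_mulVec,
      Matrix.vecMul_transpose]
  have h2 : v ⬝ᵥ A *ᵥ v = (B *ᵥ v) ⬝ᵥ (B *ᵥ v) := by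
    rw [hAB, ← Matrix.mulVec_mulVec, Matrix.dotProduct_mulVec, Matrix.vecMul_transpose]
  rw [h, h1, h2]
  exact quadForm_sq_le_frobSq S _

/-- A lower bound for the eigenvalues of `G⁻¹ A` bounds its determinant from below. -/
lemma pow_le_det_of_eigenvalues {G A : Matrix (Fin n) (Fin n) ℝ} (hG : G.PosDef) (hA : Aᵀ = A)
    {δ : ℝ} (hδ : 0 < δ)
    (h : ∀ lam : ℝ, Module.End.HasEigenvalue (Matrix.toLin' (G⁻¹ * A)) lam → δ ≤ lam) :
    δ ^ n ≤ (G⁻¹ * A).det := by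
  obtain ⟨B, S, hB, -, hS, -, hGA, -⟩ := exists_normal_form hG hA
  have hSh : S.IsHermitian := by
    rw [Matrix.IsHermitian, conjTranspose_eq_transpose_of_trivial, hS]
  have hdet : (G⁻¹ * A).det = S.det := by
    rw [hGA, Matrix.det_mul, Matrix.det_mul, mul_right_comm, ← Matrix.det_mul,
      Matrix.nonsing_inv_mul _ hB, Matrix.det_one, one_mul]
  rw [hdet, hSh.det_eq_prod_eigenvalues]
  have hev : ∀ i, δ ≤ hSh.eigenvalues i := fun i => by
    refine h _ ?_
    set w : Fin n → ℝ := (hSh.eigenvectorBasis i : EuclideanSpace ℝ (Fin n)).ofLp with hw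
    have hw0 : w ≠ 0 := by
      intro h0
      have := hSh.eigenvectorBasis.orthonormal.ne_zero i
      exact this (by ext k; exact congrFun h0 k)
    have hSw : S *ᵥ w = hSh.eigenvalues i • w := hSh.mulVec_eigenvectorBasis i
    refine Module.End.hasEigenvalue_of_hasEigenvector (x := B⁻¹ *ᵥ w) ⟨?_, ?_⟩
    · rw [Module.End.mem_eigenspace_iff, Matrix.toLin'_apply, hGA, Matrix.mulVec_mulVec,
        Matrix.mul_assoc, Matrix.mul_nonsing_inv _ hB, Matrix.mul_one, ← Matrix.mulVec_mulVec, hSw,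
        Matrix.mulVec_smul]
    · intro h0
      apply hw0
      have := congrArg (B *ᵥ ·) h0
      simpa [Matrix.mulVec_mulVec, Matrix.mul_nonsing_inv _ hB] using this
  calc δ ^ n = ∏ _i : Fin n, δ := by simp
    _ ≤ _ := Finset.prod_le_prod (fun _ _ => hδ.le) fun i _ => hev i

/-! ### Bounded regions of the positive definite cone -/

/-- The positive definite matrices with entries bounded by `C` and determinant at least `c`. -/
structure InRegion (C c : ℝ) (A : Matrix (Fin n) (Fin n) ℝ) : Prop where
  posDef : A.PosDef
  entry_le : ∀ i j, |A i j| ≤ C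
  le_det : c ≤ A.det

/-- A continuous function of a matrix is bounded on matrices with bounded entries. -/
lemma exists_bound_of_entries {f : Matrix (Fin n) (Fin n) ℝ → ℝ} (hf : Continuous f) (C : ℝ) :
    ∃ K > 0, ∀ A : Matrix (Fin n) (Fin n) ℝ, (∀ i j, |A i j| ≤ C) → |f A| ≤ K := by
  have hc : IsCompact (Set.pi Set.univ fun _ : Fin n => Set.pi Set.univ fun _ : Fin n =>
      Set.Icc (-C) C) :=
    isCompact_univ_pi fun _ => isCompact_univ_pi fun _ => isCompact_Icc
  obtain ⟨K, hK⟩ := hc.exists_bound_of_continuousOn (f := f) hf.continuousOn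
  refine ⟨max K 1, by positivity, fun A hA => le_max_of_le_left ?_⟩
  exact hK A fun i _ j _ => abs_le.mp (hA i j)

lemma exists_frobSq_inv_le (n : ℕ) (C : ℝ) {c : ℝ} (hc : 0 < c) :
    ∃ K > 0, ∀ A : Matrix (Fin n) (Fin n) ℝ, InRegion C c A → frobSq A⁻¹ ≤ K := by
  have hcont : Continuous fun A : Matrix (Fin n) (Fin n) ℝ => frobSq A.adjugate := by
    unfold frobSq
    refine continuous_finsetSum _ fun i _ => continuous_finsetSum _ fun j _ => ?_
    exact ((continuous_id.matrix_adjugate).matrix_elem i j).pow 2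
  obtain ⟨K, hK, h⟩ := exists_bound_of_entries hcont C
  refine ⟨K / c ^ 2, by positivity, fun A hA => ?_⟩
  have hdet : 0 < A.det := hc.trans_le hA.le_det
  have h1 : frobSq A⁻¹ = frobSq A.adjugate / A.det ^ 2 := by
    rw [Matrix.inv_def, Ring.inverse_eq_inv']
    simp only [frobSq, Matrix.smul_apply, smul_eq_mul, mul_pow, ← Finset.mul_sum]
    field_simp
  rw [h1]
  have h2 := (le_abs_self _).trans (h A hA.entry_le)
  have h3 : c ^ 2 ≤ A.det ^ 2 := pow_le_pow_left₀ hc.le hA.le_det 2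
  exact div_le_div₀ hK.le h2 (by positivity) h3

/-- On a bounded region, the integrand of the `L²` metric is bounded by the Frobenius norm. -/
lemma exists_matPair_le (n : ℕ) (C : ℝ) {c : ℝ} (hc : 0 < c) :
    ∃ K > 0, ∀ A H : Matrix (Fin n) (Fin n) ℝ, InRegion C c A →
      matPair A H H * √A.det ≤ K * frobSq H := by
  obtain ⟨K, hK, h⟩ := exists_frobSq_inv_le n C hc
  obtain ⟨D, hD, h'⟩ := exists_bound_of_entries
    (f := fun A : Matrix (Fin n) (Fin n) ℝ => √A.det) (Real.continuous_sqrt.comp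
      (continuous_id.matrix_det)) C
  refine ⟨K * D, by positivity, fun A H hA => ?_⟩
  have h1 : matPair A H H ≤ K * frobSq H :=
    (trace_mul_self_le _).trans ((frobSq_mul_le _ _).trans
      (mul_le_mul_of_nonneg_right (h A hA) (frobSq_nonneg _)))
  have h2 : √A.det ≤ D := (le_abs_self _).trans (h' A hA.entry_le)
  calc matPair A H H * √A.det ≤ (K * frobSq H) * √A.det :=
        mul_le_mul_of_nonneg_right h1 (Real.sqrt_nonneg _)
    _ ≤ (K * frobSq H) * D :=
        mul_le_mul_of_nonneg_left h2 (mul_nonneg hK.le (frobSq_nonneg _))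
    _ = _ := by ring

/-- On a bounded region, the Frobenius norm is bounded by the integrand of the `L²` metric. -/
lemma exists_frobSq_le (n : ℕ) (C : ℝ) {c : ℝ} (hc : 0 < c) :
    ∃ K > 0, ∀ A H : Matrix (Fin n) (Fin n) ℝ, InRegion C c A → Hᵀ = H →
      frobSq H ≤ K * (matPair A H H * √A.det) := by
  obtain ⟨D, hD, h'⟩ := exists_bound_of_entries
    (f := fun A : Matrix (Fin n) (Fin n) ℝ => A.trace) (continuous_id.matrix_trace) C
  refine ⟨D ^ 2 / √c, by positivity, fun A H hA hH => ?_⟩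
  have h1 := frobSq_le_matPair hA.posDef hH
  have h2 : A.trace ^ 2 ≤ D ^ 2 := by
    rw [← sq_abs]; exact pow_le_pow_left₀ (abs_nonneg _) (h' A hA.entry_le) 2
  have h3 : √c ≤ √A.det := Real.sqrt_le_sqrt hA.le_det
  have h4 := matPair_self_nonneg hA.posDef hH
  have h5 : 0 < √c := Real.sqrt_pos.mpr hc
  calc frobSq H ≤ A.trace ^ 2 * matPair A H H := h1
    _ ≤ D ^ 2 * matPair A H H := mul_le_mul_of_nonneg_right h2 h4
    _ = D ^ 2 / √c * (matPair A H H * √c) := by field_simp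
    _ ≤ _ := by gcongr

lemma continuousWithinAt_matPair {X : Type*} [TopologicalSpace X]
    {A H K : X → Matrix (Fin n) (Fin n) ℝ} {x : X} {s : Set X}
    (hA : ContinuousWithinAt A s x) (hH : ContinuousWithinAt H s x)
    (hK : ContinuousWithinAt K s x) (hdet : (A x).det ≠ 0) :
    ContinuousWithinAt (fun y => matPair (A y) (H y) (K y)) s x := by
  have hinv : ContinuousWithinAt (fun y => (A y)⁻¹) s x := by
    have e : (fun y => (A y)⁻¹) = fun y => ((A y).det)⁻¹ • (A y).adjugate := by
      funext p; rw [Matrix.inv_def, Ring.inverse_eq_inv']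
    rw [e]
    have h1 : ContinuousWithinAt (fun y => (A y).det) s x :=
      (Continuous.matrix_det (A := fun M : Matrix (Fin n) (Fin n) ℝ => M)
        continuous_id).continuousAt.comp_continuousWithinAt hA
    have h2 : ContinuousWithinAt (fun y => (A y).adjugate) s x :=
      (Continuous.matrix_adjugate (A := fun M : Matrix (Fin n) (Fin n) ℝ => M)
        continuous_id).continuousAt.comp_continuousWithinAt hA
    exact (h1.inv₀ hdet).smul h2
  have h3 := (hinv.mul hH).mul (hinv.mul hK)
  exact (Continuous.matrix_trace (A := fun M : Matrix (Fin n) (Fin n) ℝ => M)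
        continuous_id).continuousAt.comp_continuousWithinAt h3

/-! ### Functions with controlled variation along paths of positive definite matrices -/

/-- Jacobi's formula for the derivative of the determinant at an invertible matrix. -/
lemma differentiable_det_of :
    Differentiable ℝ (fun m : Fin n → Fin n → ℝ => (Matrix.of m).det) ∧
    ∀ a x : Fin n → Fin n → ℝ, (Matrix.of a).det ≠ 0 →
      fderiv ℝ (fun m : Fin n → Fin n → ℝ => (Matrix.of m).det) a x =
        (Matrix.of a).det * ((Matrix.of a)⁻¹ * Matrix.of x).trace := by
  have hf : Differentiable ℝ (fun m : Fin n → Fin n → ℝ => (Matrix.of m).det) := by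
    simp only [Matrix.det_apply', Matrix.of_apply]
    fun_prop
  refine ⟨hf, fun a x hdet => ?_⟩
  set f : (Fin n → Fin n → ℝ) → ℝ := fun m => (Matrix.of m).det with hfd
  have h3 : HasDerivAt (fun r : ℝ => f (a + r • x)) (fderiv ℝ f a x) 0 := by
    have h4 : HasDerivAt (fun r : ℝ => a + r • x) x 0 := by
      simpa using ((hasDerivAt_id (0 : ℝ)).smul_const x).const_add a
    have h5 : HasFDerivAt f (fderiv ℝ f a) (a + (0 : ℝ) • x) := by
      simpa using (hf a).hasFDerivAt
    exact h5.comp_hasDerivAt (0 : ℝ) h4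
  -- expand `det (a + r x) = det a * det (1 + r a⁻¹ x)` to first order in `r`
  have h6 : ∀ r : ℝ, f (a + r • x) = (Matrix.of a).det *
      (1 + ((Matrix.of a)⁻¹ * Matrix.of x).trace * r +
        (det (1 + (Polynomial.X : Polynomial ℝ) •
          ((Matrix.of a)⁻¹ * Matrix.of x).map Polynomial.C)).divX.divX.eval r * r ^ 2) := fun r => by
    rw [← Matrix.det_one_add_smul, ← Matrix.det_mul]
    change (Matrix.of a + r • Matrix.of x).det = _
    rw [Matrix.mul_add, Matrix.mul_one, Matrix.mul_smul, ← Matrix.mul_assoc,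
      Matrix.mul_nonsing_inv _ (isUnit_iff_ne_zero.mpr hdet), Matrix.one_mul]
  have h7 : HasDerivAt (fun r : ℝ => f (a + r • x))
      ((Matrix.of a).det * ((Matrix.of a)⁻¹ * Matrix.of x).trace) 0 := by
    simp only [h6]
    generalize (det (1 + (Polynomial.X : Polynomial ℝ) •
          ((Matrix.of a)⁻¹ * Matrix.of x).map Polynomial.C)).divX.divX = p
    have h8 := ((((hasDerivAt_id (0 : ℝ)).const_mul ((Matrix.of a)⁻¹ * Matrix.of x).trace).const_add
      1).add ((p.hasDerivAt 0).mul (hasDerivAt_pow 2 (0 : ℝ)))).const_mul (Matrix.of a).det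
    refine h8.congr_deriv ?_
    simp
  exact h3.unique h7

lemma hasDerivWithinAt_det {A : ℝ → Matrix (Fin n) (Fin n) ℝ} {X : Matrix (Fin n) (Fin n) ℝ}
    {s : Set ℝ} {t : ℝ} (hA : ∀ i j, HasDerivWithinAt (fun u => A u i j) (X i j) s t)
    (hdet : (A t).det ≠ 0) :
    HasDerivWithinAt (fun u => (A u).det) ((A t).det * ((A t)⁻¹ * X).trace) s t := by
  obtain ⟨hf, e⟩ := differentiable_det_of (n := n)
  have h1 : HasDerivWithinAt (fun u => fun i j => A u i j) (fun i j => X i j) s t :=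
    hasDerivWithinAt_pi.mpr fun i => hasDerivWithinAt_pi.mpr fun j => hA i j
  have h2 := (hf (fun i j => A t i j)).hasFDerivAt.comp_hasDerivWithinAt t h1
  have h3 := e (fun i j => A t i j) (fun i j => X i j) hdet
  rw [h3] at h2
  exact h2

/-- The function `det(A)^{1/4} / (1 + vᵀ A v)`. Along a path of positive definite matrices its
derivative is bounded by `tr (A⁻¹ A' A⁻¹ A')^{1/2} det(A)^{1/4}`, uniformly over the whole cone. -/
def rootFun (v : Fin n → ℝ) (A : Matrix (Fin n) (Fin n) ℝ) : ℝ :=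
  A.det ^ (1 / 4 : ℝ) / (1 + v ⬝ᵥ A *ᵥ v)

lemma quadForm_nonneg {A : Matrix (Fin n) (Fin n) ℝ} (hA : A.PosDef) (v : Fin n → ℝ) :
    0 ≤ v ⬝ᵥ A *ᵥ v := by
  simpa using hA.posSemidef.dotProduct_mulVec_nonneg v

lemma hasDerivWithinAt_quadForm {A : ℝ → Matrix (Fin n) (Fin n) ℝ}
    {X : Matrix (Fin n) (Fin n) ℝ} {s : Set ℝ} {t : ℝ}
    (hA : ∀ i j, HasDerivWithinAt (fun u => A u i j) (X i j) s t) (v : Fin n → ℝ) :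
    HasDerivWithinAt (fun u => v ⬝ᵥ A u *ᵥ v) (v ⬝ᵥ X *ᵥ v) s t := by
  simp only [dotProduct, Matrix.mulVec]
  exact HasDerivWithinAt.fun_sum fun i _ => HasDerivWithinAt.const_mul _
    (HasDerivWithinAt.fun_sum fun j _ => (hA i j).mul_const _)

/-- The variation of `rootFun v` along a path is controlled by the integrand of the `L²` metric.
The factor `det(A)^{1/4}` is what makes the square of the bound that integrand, and the division by
`1 + vᵀ A v` makes the term `vᵀ A' v` bounded, so that the constant does not depend on `A`. -/
lemma exists_hasDerivWithinAt_rootFun {A : ℝ → Matrix (Fin n) (Fin n) ℝ}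
    {X : Matrix (Fin n) (Fin n) ℝ} {s : Set ℝ} {t : ℝ}
    (hA : ∀ i j, HasDerivWithinAt (fun u => A u i j) (X i j) s t) (hpos : (A t).PosDef)
    (hX : Xᵀ = X) (v : Fin n → ℝ) :
    ∃ d, HasDerivWithinAt (fun u => rootFun v (A u)) d s t ∧
      |d| ≤ (n + 1) * √(matPair (A t) X X * √(A t).det) := by
  have hdet := hpos.det_pos
  have hq := quadForm_nonneg hpos v
  have hq1 : 1 + v ⬝ᵥ A t *ᵥ v ≠ 0 := by positivity
  have h1 := (hasDerivWithinAt_det hA hdet.ne').rpow_const (p := (1 / 4 : ℝ)) (Or.inl hdet.ne')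
  have h2 := (hasDerivWithinAt_quadForm hA v).const_add 1
  have h3 := h1.div h2 hq1
  refine ⟨_, h3, ?_⟩
  set r := (A t).det ^ (1 / 4 : ℝ) with hr
  set m := matPair (A t) X X with hm
  set q := v ⬝ᵥ A t *ᵥ v with hqd
  set τ := ((A t)⁻¹ * X).trace with hτ
  set x := v ⬝ᵥ X *ᵥ v with hx
  have hr0 : 0 < r := Real.rpow_pos_of_pos hdet _
  have hm0 : 0 ≤ m := matPair_self_nonneg hpos hX
  have hsq : √(m * √(A t).det) = √m * r := by
    rw [Real.sqrt_mul hm0]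
    congr 1
    rw [Real.sqrt_eq_rpow, Real.sqrt_eq_rpow, ← Real.rpow_mul hdet.le, hr]
    norm_num
  have hpow : (A t).det * τ * (1 / 4) * (A t).det ^ ((1 / 4 : ℝ) - 1) = τ / 4 * r := by
    rw [Real.rpow_sub_one hdet.ne', hr]
    field_simp
  have hτm : |τ| ≤ n * √m := by
    have h4 : τ ^ 2 ≤ n * m := trace_sq_le_matPair hpos hX
    have h5 : (n : ℝ) ≤ n ^ 2 := by exact_mod_cast Nat.le_self_pow two_ne_zero n
    refine abs_le_of_sq_le_sq ?_ (by positivity)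
    rw [mul_pow, Real.sq_sqrt hm0]
    exact h4.trans (mul_le_mul_of_nonneg_right h5 hm0)
  have hxm : |x| ≤ q * √m := by
    refine abs_le_of_sq_le_sq ?_ (by positivity)
    rw [mul_pow, Real.sq_sqrt hm0]
    exact quadForm_sq_le_matPair hpos hX v
  rw [hpow, hsq]
  have hm' : 0 ≤ √m := Real.sqrt_nonneg m
  have key : |τ / 4 * r * (1 + q) - r * x| ≤ (n + 1) * (√m * r) * (1 + q) ^ 2 := by
    have h6 : |τ / 4 * r * (1 + q) - r * x| ≤ |τ| / 4 * r * (1 + q) + r * |x| := by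
      refine (abs_sub _ _).trans (le_of_eq ?_)
      rw [abs_mul, abs_mul, abs_mul, abs_div, abs_of_pos hr0,
        abs_of_nonneg (by positivity : 0 ≤ 1 + q)]
      norm_num
    refine h6.trans ?_
    have hn : (0 : ℝ) ≤ n := Nat.cast_nonneg n
    have h7 : |τ| / 4 * r * (1 + q) ≤ (n * √m) * r * (1 + q) := by
      have : |τ| / 4 ≤ n * √m := by linarith [abs_nonneg τ]
      gcongr
    have h8 : r * |x| ≤ r * (q * √m) := mul_le_mul_of_nonneg_left hxm hr0.le
    have h9 : 0 ≤ n * (√m * r) * (q + q ^ 2) := by positivity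
    have h10 : 0 ≤ √m * r * (1 + q + q ^ 2) := by positivity
    nlinarith
  rw [abs_div, abs_of_pos (by positivity : 0 < (1 + q) ^ 2), div_le_iff₀ (by positivity)]
  exact key

lemma continuous_quadForm (v : Fin n → ℝ) :
    Continuous fun A : Matrix (Fin n) (Fin n) ℝ => v ⬝ᵥ A *ᵥ v :=
  continuous_const.dotProduct (continuous_id.matrix_mulVec continuous_const)

/-- On a bounded region the quadratic form `vᵀ A v` is a Lipschitz function of the values
`rootFun 0 A = det(A)^{1/4}` and `rootFun v A`. -/
lemma exists_quadForm_sub_le (C : ℝ) {c : ℝ} (hc : 0 < c) (v : Fin n → ℝ) :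
    ∃ K > 0, ∀ A B : Matrix (Fin n) (Fin n) ℝ, InRegion C c A → InRegion C c B →
      |v ⬝ᵥ A *ᵥ v - v ⬝ᵥ B *ᵥ v| ≤
        K * (|rootFun 0 A - rootFun 0 B| + |rootFun v A - rootFun v B|) := by
  obtain ⟨Q, hQ, hQ'⟩ := exists_bound_of_entries (continuous_quadForm v) C
  have hr0 : 0 < c ^ (1 / 4 : ℝ) := Real.rpow_pos_of_pos hc _
  set r := c ^ (1 / 4 : ℝ) with hr
  -- `1 + vᵀ A v = rootFun 0 A / rootFun v A`, with denominator at least `r / (1 + Q)`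
  refine ⟨(1 + Q) ^ 2 / r, by positivity, fun A B hA hB => ?_⟩
  have hqA := quadForm_nonneg hA.posDef v
  have hqB := quadForm_nonneg hB.posDef v
  have hQA := (le_abs_self _).trans (hQ' A hA.entry_le)
  have hQB := (le_abs_self _).trans (hQ' B hB.entry_le)
  have hdA : r ≤ A.det ^ (1 / 4 : ℝ) := Real.rpow_le_rpow hc.le hA.le_det (by norm_num)
  have e0 : ∀ D : Matrix (Fin n) (Fin n) ℝ, rootFun 0 D = D.det ^ (1 / 4 : ℝ) := fun D => by
    simp [rootFun]
  simp only [e0]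
  simp only [rootFun]
  set a := A.det ^ (1 / 4 : ℝ)
  set b := B.det ^ (1 / 4 : ℝ)
  set p := v ⬝ᵥ A *ᵥ v
  set q := v ⬝ᵥ B *ᵥ v
  have ha : 0 < a := hr0.trans_le hdA
  have hp1 : (1 + p) ≠ 0 := by positivity
  have hq1 : (1 + q) ≠ 0 := by positivity
  have key : a * (p - q) = (1 + p) * (a - b) - (1 + p) * (1 + q) * (a / (1 + p) - b / (1 + q)) := by
    field_simp
    ring
  have h1 : a * |p - q| ≤ (1 + Q) ^ 2 * (|a - b| + |a / (1 + p) - b / (1 + q)|) := by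
    rw [← abs_of_pos ha, ← abs_mul, abs_of_pos ha, key]
    refine (abs_sub _ _).trans ?_
    rw [abs_mul, abs_mul, abs_mul, abs_of_nonneg (by positivity : 0 ≤ 1 + p),
      abs_of_nonneg (by positivity : 0 ≤ 1 + q), mul_add ((1 + Q) ^ 2)]
    have h2 : 1 + p ≤ (1 + Q) ^ 2 := by nlinarith
    have h3 : (1 + p) * (1 + q) ≤ (1 + Q) ^ 2 := by rw [sq]; gcongr
    exact add_le_add (mul_le_mul_of_nonneg_right h2 (abs_nonneg _))
      (mul_le_mul_of_nonneg_right h3 (abs_nonneg _))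
  rw [div_mul_eq_mul_div, le_div_iff₀ hr0]
  calc |p - q| * r ≤ |p - q| * a := by gcongr
    _ = a * |p - q| := mul_comm _ _
    _ ≤ _ := h1

/-- The vectors `0`, `e_i`, `e_j`, `e_i + e_j`, whose quadratic forms determine the entry `(i,j)`
of a symmetric matrix. -/
def testVec (i j : Fin n) : Fin 4 → Fin n → ℝ :=
  ![0, Pi.single i 1, Pi.single j 1, Pi.single i 1 + Pi.single j 1]

/-- On a bounded region the entries of `A` are Lipschitz functions of values of `rootFun`, by
polarization of the quadratic forms `vᵀ A v`. -/
lemma exists_entry_sub_le (n : ℕ) (C : ℝ) {c : ℝ} (hc : 0 < c) :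
    ∃ K > 0, ∀ A B : Matrix (Fin n) (Fin n) ℝ, InRegion C c A → InRegion C c B → ∀ i j,
      |A i j - B i j| ≤ K * ∑ l, |rootFun (testVec i j l) A - rootFun (testVec i j l) B| := by
  choose K hK h using fun v : Fin n → ℝ => exists_quadForm_sub_le (n := n) C hc v
  let K' : Fin n → Fin n → ℝ := fun i j => ∑ l, K (testVec i j l)
  have hK'pos : ∀ i j, 0 ≤ K' i j := fun i j => Finset.sum_nonneg fun l _ => (hK _).le
  refine ⟨3 * (∑ i, ∑ j, K' i j) + 1, ?_, fun A B hA hB i j => ?_⟩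
  · have : 0 ≤ ∑ i, ∑ j, K' i j := Finset.sum_nonneg fun i _ =>
      Finset.sum_nonneg fun j _ => hK'pos i j
    linarith
  set T := ∑ i, ∑ j, K' i j with hT
  have hKT : ∀ l, K (testVec i j l) ≤ T := fun l =>
    calc K (testVec i j l) ≤ K' i j :=
          Finset.single_le_sum (f := fun l => K (testVec i j l)) (fun l _ => (hK _).le)
            (Finset.mem_univ l)
      _ ≤ ∑ j, K' i j := Finset.single_le_sum (f := fun j => K' i j) (fun j _ => hK'pos i j)
            (Finset.mem_univ j)
      _ ≤ T := Finset.single_le_sum (f := fun i => ∑ j, K' i j)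
            (fun i _ => Finset.sum_nonneg fun j _ => hK'pos i j) (Finset.mem_univ i)
  have pol : ∀ D : Matrix (Fin n) (Fin n) ℝ, D.PosDef → 2 * D i j =
      testVec i j 3 ⬝ᵥ D *ᵥ testVec i j 3 - testVec i j 1 ⬝ᵥ D *ᵥ testVec i j 1
        - testVec i j 2 ⬝ᵥ D *ᵥ testVec i j 2 := fun D hD => by
    have hs : D j i = D i j := by
      have := congrFun (congrFun hD.isHermitian i) j
      simpa using this
    simp [testVec, Matrix.mulVec_add, add_dotProduct, dotProduct_add, hs]
    ring
  set R := ∑ l, |rootFun (testVec i j l) A - rootFun (testVec i j l) B| with hS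
  have hl : ∀ l, |testVec i j l ⬝ᵥ A *ᵥ testVec i j l - testVec i j l ⬝ᵥ B *ᵥ testVec i j l| ≤
      T * (2 * R) := fun l => by
    refine (h (testVec i j l) A B hA hB).trans ?_
    have h1 : ∀ l, |rootFun (testVec i j l) A - rootFun (testVec i j l) B| ≤ R := fun l =>
      Finset.single_le_sum (f := fun l => |rootFun (testVec i j l) A - rootFun (testVec i j l) B|)
        (fun _ _ => abs_nonneg _) (Finset.mem_univ l)
    have h0 : |rootFun 0 A - rootFun 0 B| ≤ R := h1 0
    have h1 := h1 l
    have h2 := hKT l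
    have h3 := (hK (testVec i j l)).le
    exact mul_le_mul h2 (by linarith) (by positivity) (h3.trans h2)
  have hR : 0 ≤ R := Finset.sum_nonneg fun _ _ => abs_nonneg _
  have e : 2 * (A i j - B i j) =
      (testVec i j 3 ⬝ᵥ A *ᵥ testVec i j 3 - testVec i j 3 ⬝ᵥ B *ᵥ testVec i j 3)
      - (testVec i j 1 ⬝ᵥ A *ᵥ testVec i j 1 - testVec i j 1 ⬝ᵥ B *ᵥ testVec i j 1)
      - (testVec i j 2 ⬝ᵥ A *ᵥ testVec i j 2 - testVec i j 2 ⬝ᵥ B *ᵥ testVec i j 2) := by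
    rw [mul_sub, pol A hA.posDef, pol B hB.posDef]; ring
  have l1 := abs_le.mp (hl 1)
  have l2 := abs_le.mp (hl 2)
  have l3 := abs_le.mp (hl 3)
  rw [abs_le]
  constructor <;> nlinarith

/-- `rootFun v A` is bounded by `det(A)^{1/4}`. -/
lemma exists_rootFun_le (n : ℕ) (C : ℝ) :
    ∃ K > 0, ∀ A : Matrix (Fin n) (Fin n) ℝ, A.PosDef → (∀ i j, |A i j| ≤ C) →
      ∀ v, |rootFun v A| ≤ K := by
  obtain ⟨K, hK, h⟩ := exists_bound_of_entries
    (f := fun A : Matrix (Fin n) (Fin n) ℝ => A.det ^ (1 / 4 : ℝ))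
    ((continuous_id.matrix_det).rpow_const fun _ => Or.inr (by norm_num)) C
  refine ⟨K, hK, fun A hA hC v => ?_⟩
  have hq := quadForm_nonneg hA v
  rw [rootFun, abs_div, abs_of_nonneg (by positivity : 0 ≤ 1 + v ⬝ᵥ A *ᵥ v)]
  exact (div_le_self (abs_nonneg _) (by linarith)).trans (h A hC)

end MatrixLayer

/-! ### Coefficients of tensor fields in charts -/

section Geometry

open Matrix

variable {n : ℕ} {M : Type*} [TopologicalSpace M] [ChartedSpace (EuclideanSpace ℝ (Fin n)) M]

/-- The Jacobian matrix of `φ⁻¹`, with respect to the standard basis of `T_x M`. -/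
def jac (φ : OpenPartialHomeomorph M (EuclideanSpace ℝ (Fin n))) (y : EuclideanSpace ℝ (Fin n)) :
    Matrix (Fin n) (Fin n) ℝ :=
  Matrix.of fun k i => WithLp.ofLp (p := 2) (V := Fin n → ℝ) (coordVec φ y i) k

lemma eq_sum_smul_single (u : EuclideanSpace ℝ (Fin n)) :
    u = ∑ k, u k • EuclideanSpace.single k (1 : ℝ) := by
  ext i; simp [Finset.sum_apply, Pi.single_apply]

lemma bilin_apply_eq_sum
    (b : EuclideanSpace ℝ (Fin n) →L[ℝ] EuclideanSpace ℝ (Fin n) →L[ℝ] ℝ)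
    (u v : EuclideanSpace ℝ (Fin n)) :
    b u v = ∑ k, ∑ l, u k * b (EuclideanSpace.single k 1) (EuclideanSpace.single l 1) * v l := by
  conv_lhs => rw [eq_sum_smul_single u, eq_sum_smul_single v]
  simp only [map_sum, map_smul, _root_.sum_apply, _root_.smul_apply,
    smul_eq_mul, Finset.mul_sum]
  rw [Finset.sum_comm]
  exact Finset.sum_congr rfl fun k _ => Finset.sum_congr rfl fun l _ => by ring

lemma bilin_apply_eq_gram {x : M} (b : BilinFibre n M x) (u v : EuclideanSpace ℝ (Fin n)) :
    b u v = u.ofLp ⬝ᵥ gram b *ᵥ v.ofLp := by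
  refine (bilin_apply_eq_sum b u v).trans ?_
  simp only [dotProduct, Matrix.mulVec, Finset.mul_sum, gram, Matrix.of_apply, mul_assoc]
  rfl

lemma coeff_eq_jac (φ : OpenPartialHomeomorph M (EuclideanSpace ℝ (Fin n))) (h : TensorField n M)
    (y : EuclideanSpace ℝ (Fin n)) :
    coeff φ h y = (jac φ y)ᵀ * gram (h (φ.symm y)) * jac φ y := by
  ext i j
  refine (bilin_apply_eq_sum (h (φ.symm y)) (coordVec φ y i) (coordVec φ y j)).trans ?_
  rw [Matrix.mul_assoc]
  simp only [Matrix.mul_apply, Finset.mul_sum, Matrix.transpose_apply, jac, gram, Matrix.of_apply,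
    mul_assoc]
  rfl

lemma mdifferentiable_of_mem_maximalAtlas
    {φ : OpenPartialHomeomorph M (EuclideanSpace ℝ (Fin n))}
    (hφ : φ ∈ IsManifold.maximalAtlas (𝓡 n) ∞ M) : φ.MDifferentiable (𝓡 n) (𝓡 n) :=
  ⟨(contMDiffOn_of_mem_maximalAtlas hφ).mdifferentiableOn (by simp),
    (contMDiffOn_symm_of_mem_maximalAtlas hφ).mdifferentiableOn (by simp)⟩

lemma isUnit_det_jac {φ : OpenPartialHomeomorph M (EuclideanSpace ℝ (Fin n))}
    (hφ : φ ∈ IsManifold.maximalAtlas (𝓡 n) ∞ M) {y : EuclideanSpace ℝ (Fin n)}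
    (hy : y ∈ φ.target) : IsUnit (jac φ y).det := by
  have hinj := (mdifferentiable_of_mem_maximalAtlas hφ).symm.mfderiv_injective (x := y) hy
  let D : EuclideanSpace ℝ (Fin n) →L[ℝ] EuclideanSpace ℝ (Fin n) := mfderiv (𝓡 n) (𝓡 n) φ.symm y
  have hinj' : Function.Injective D := hinj
  have hD : ∀ w : EuclideanSpace ℝ (Fin n), jac φ y *ᵥ w.ofLp = (D w).ofLp := fun w => by
    conv_rhs => rw [eq_sum_smul_single w]
    ext k
    simp only [map_sum, map_smul, Matrix.mulVec, dotProduct, jac, Matrix.of_apply,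
      WithLp.ofLp_sum, Finset.sum_apply, WithLp.ofLp_smul, Pi.smul_apply, smul_eq_mul]
    exact Finset.sum_congr rfl fun l _ => mul_comm _ _
  rw [← Matrix.isUnit_iff_isUnit_det, ← Matrix.mulVec_injective_iff_isUnit]
  intro a b hab
  have := hD (WithLp.toLp 2 a - WithLp.toLp 2 b)
  have h0 : D (WithLp.toLp 2 a - WithLp.toLp 2 b) = 0 := by
    ext k
    rw [← this]
    have hab' : jac φ y *ᵥ a = jac φ y *ᵥ b := hab
    simp [Matrix.mulVec_sub, hab']
  have h1 := hinj' (h0.trans (map_zero D).symm)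
  exact congrArg WithLp.ofLp (sub_eq_zero.mp h1)

lemma continuousOn_coordVec [IsManifold (𝓡 n) ∞ M]
    {φ : OpenPartialHomeomorph M (EuclideanSpace ℝ (Fin n))}
    (hφ : φ ∈ IsManifold.maximalAtlas (𝓡 n) ∞ M) (i : Fin n) :
    ContinuousOn (fun y => (TotalSpace.mk' (EuclideanSpace ℝ (Fin n)) (φ.symm y) (coordVec φ y i) :
      TangentBundle (𝓡 n) M)) φ.target := by
  have h1 := (contMDiffOn_symm_of_mem_maximalAtlas hφ).continuousOn_tangentMapWithin
    (by simp) φ.open_target.uniqueMDiffOn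
  have h2 : Continuous (fun y : EuclideanSpace ℝ (Fin n) =>
      (⟨y, (EuclideanSpace.single i (1 : ℝ) : EuclideanSpace ℝ (Fin n))⟩ :
        TangentBundle (𝓡 n) (EuclideanSpace ℝ (Fin n)))) :=
    (tangentBundleModelSpaceHomeomorph (𝓡 n)).symm.continuous.comp
      (Continuous.prodMk continuous_id continuous_const : Continuous fun y =>
        ((y, EuclideanSpace.single i (1 : ℝ)) :
          ModelProd (EuclideanSpace ℝ (Fin n)) (EuclideanSpace ℝ (Fin n))))
  refine (h1.comp h2.continuousOn fun y hy => hy).congr fun y hy => ?_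
  simp only [tangentMapWithin, Function.comp, coordVec]
  rw [mfderivWithin_of_isOpen φ.open_target hy]

lemma continuousOn_coeff [IsManifold (𝓡 n) ∞ M]
    {φ : OpenPartialHomeomorph M (EuclideanSpace ℝ (Fin n))}
    (hφ : φ ∈ IsManifold.maximalAtlas (𝓡 n) ∞ M) {h : TensorField n M}
    (hh : IsSmooth h) :
    ContinuousOn (coeff φ h) φ.target := by
  refine continuousOn_pi.mpr fun i => continuousOn_pi.mpr fun j => ?_
  have h0 : ContinuousOn (fun y => TotalSpace.mk'
      (EuclideanSpace ℝ (Fin n) →L[ℝ] EuclideanSpace ℝ (Fin n) →L[ℝ] ℝ) (E := BilinFibre n M)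
      (φ.symm y) (h (φ.symm y))) φ.target :=
    hh.continuous.comp_continuousOn φ.continuousOn_symm
  have h1 := ContinuousOn.clm_bundle_apply₂ (F₁ := EuclideanSpace ℝ (Fin n))
    (F₂ := EuclideanSpace ℝ (Fin n)) (F₃ := ℝ) (E₁ := TangentSpace (𝓡 n) (M := M))
    (E₂ := TangentSpace (𝓡 n) (M := M)) (E₃ := fun _ : M => ℝ)
    (ψ := fun y => h (φ.symm y)) h0 (continuousOn_coordVec hφ i) (continuousOn_coordVec hφ j)
  simp only [ContinuousOn, FiberBundle.continuousWithinAt_totalSpace] at h1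
  exact fun y hy => (h1 y hy).2

section Coefficients

variable {φ : OpenPartialHomeomorph M (EuclideanSpace ℝ (Fin n))}

lemma gram_transpose {x : M} {b : BilinFibre n M x} (hb : ∀ u v, b u v = b v u) :
    (gram b)ᵀ = gram b := by
  ext i j; exact hb _ _

lemma gram_injective {x : M} : Function.Injective (gram : BilinFibre n M x → _) := by
  intro b c hbc
  refine ContinuousLinearMap.ext fun u => ContinuousLinearMap.ext fun v => ?_
  rw [bilin_apply_eq_gram b u v, bilin_apply_eq_gram c u v, hbc]

lemma gram_posDef_iff {x : M} {b : BilinFibre n M x} (hb : ∀ u v, b u v = b v u) :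
    (gram b).PosDef ↔ ∀ v : TangentSpace (𝓡 n) x, v ≠ 0 → 0 < b v v := by
  rw [Matrix.posDef_iff_dotProduct_mulVec]
  constructor
  · rintro ⟨-, h⟩ v hv
    rw [bilin_apply_eq_gram b v v]
    have hv' : WithLp.ofLp (p := 2) (V := Fin n → ℝ) v ≠ 0 := fun h0 =>
      hv (WithLp.ofLp_injective 2 h0)
    simpa using h hv'
  · intro h
    refine ⟨by rw [Matrix.IsHermitian, conjTranspose_eq_transpose_of_trivial, gram_transpose hb],
      fun v hv => ?_⟩
    have hv' : (WithLp.toLp 2 v : EuclideanSpace ℝ (Fin n)) ≠ 0 := fun h0 =>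
      hv (WithLp.toLp_injective 2 h0)
    have := h (WithLp.toLp 2 v : EuclideanSpace ℝ (Fin n)) hv'
    rw [bilin_apply_eq_gram b] at this
    simpa using this

lemma coeff_transpose {h : TensorField n M}
    (hh : ∀ (x : M) (u v : TangentSpace (𝓡 n) x), h x u v = h x v u)
    (y : EuclideanSpace ℝ (Fin n)) : (coeff φ h y)ᵀ = coeff φ h y := by
  ext i j; exact hh _ _ _

variable (hφ : φ ∈ IsManifold.maximalAtlas (𝓡 n) ∞ M) {x : M} (hx : x ∈ φ.source)
include hφ hx

/-- In a chart around `x`, the coefficient matrix and the Gram matrix are congruent. -/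
lemma exists_coeff_eq_gram : ∃ P : Matrix (Fin n) (Fin n) ℝ, IsUnit P.det ∧
    ∀ h : TensorField n M, coeff φ h (φ x) = Pᵀ * gram (h x) * P := by
  refine ⟨jac φ (φ x), isUnit_det_jac hφ (φ.map_source hx), fun h => ?_⟩
  rw [coeff_eq_jac]
  have e := φ.left_inv hx
  have : gram (h (φ.symm (φ x))) = gram (h x) := congrArg (fun z => gram (h z)) e
  rw [this]

lemma eq_of_coeff_eq {h k : TensorField n M} (hk : coeff φ h (φ x) = coeff φ k (φ x)) :
    h x = k x := by
  obtain ⟨P, hP, e⟩ := exists_coeff_eq_gram hφ hx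
  have hPt : IsUnit Pᵀ.det := by rwa [Matrix.det_transpose]
  refine gram_injective ?_
  have e' : ∀ h : TensorField n M, gram (h x) = (Pᵀ)⁻¹ * coeff φ h (φ x) * P⁻¹ := fun h => by
    rw [e h, Matrix.mul_assoc, Matrix.mul_assoc, Matrix.mul_assoc, Matrix.mul_nonsing_inv _ hP,
      Matrix.mul_one, ← Matrix.mul_assoc, Matrix.nonsing_inv_mul _ hPt, Matrix.one_mul]
  rw [e', e', hk]

lemma coeff_posDef_iff {h : TensorField n M} (hh : ∀ u v, h x u v = h x v u) :
    (coeff φ h (φ x)).PosDef ↔ ∀ v : TangentSpace (𝓡 n) x, v ≠ 0 → 0 < h x v v := by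
  obtain ⟨P, hP, e⟩ := exists_coeff_eq_gram hφ hx
  rw [e, ← gram_posDef_iff hh]
  have := Matrix.IsUnit.posDef_star_left_conjugate_iff (x := gram (h x))
    ((Matrix.isUnit_iff_isUnit_det P).mpr hP)
  rwa [Matrix.star_eq_conjTranspose, conjTranspose_eq_transpose_of_trivial] at this

lemma coeff_inv_mul (g : TensorField n M) :
    ∃ P : Matrix (Fin n) (Fin n) ℝ, IsUnit P.det ∧ ∀ h : TensorField n M,
      (coeff φ g (φ x))⁻¹ * coeff φ h (φ x) = P⁻¹ * raise (g x) (h x) * P := by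
  obtain ⟨P, hP, e⟩ := exists_coeff_eq_gram hφ hx
  have hPt : IsUnit Pᵀ.det := by rwa [Matrix.det_transpose]
  refine ⟨P, hP, fun h => ?_⟩
  rw [e, e, raise, Matrix.mul_inv_rev, Matrix.mul_inv_rev]
  simp only [Matrix.mul_assoc]
  rw [← Matrix.mul_assoc (Pᵀ)⁻¹, Matrix.nonsing_inv_mul _ hPt, Matrix.one_mul]

lemma trPair_eq_matPair (g h k : TensorField n M) :
    trPair (g x) (h x) (k x) = matPair (coeff φ g (φ x)) (coeff φ h (φ x)) (coeff φ k (φ x)) := by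
  obtain ⟨P, hP, e⟩ := coeff_inv_mul hφ hx g
  rw [matPair, e, e, trPair]
  simp only [Matrix.mul_assoc]
  rw [← Matrix.mul_assoc P, Matrix.mul_nonsing_inv _ hP, Matrix.one_mul, Matrix.trace_mul_comm P⁻¹]
  simp only [Matrix.mul_assoc]
  rw [Matrix.mul_nonsing_inv _ hP, Matrix.mul_one]

lemma det_raise (g h : TensorField n M) :
    (raise (g x) (h x)).det = ((coeff φ g (φ x))⁻¹ * coeff φ h (φ x)).det := by
  obtain ⟨P, hP, e⟩ := coeff_inv_mul hφ hx g
  rw [e, Matrix.det_mul, Matrix.det_mul, mul_right_comm, ← Matrix.det_mul,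
    Matrix.nonsing_inv_mul _ hP, Matrix.det_one, one_mul]

end Coefficients

/-- Coefficients in a chart and in a larger chart that extends it agree. -/
lemma coeff_eq_of_eqOn {φ ψ : OpenPartialHomeomorph M (EuclideanSpace ℝ (Fin n))}
    (hs : φ.source ⊆ ψ.source) (he : EqOn φ ψ φ.source) (h : TensorField n M)
    {y : EuclideanSpace ℝ (Fin n)} (hy : y ∈ φ.target) : coeff φ h y = coeff ψ h y := by
  have e : EqOn φ.symm ψ.symm φ.target := fun z hz => by
    have h1 := φ.map_target hz
    have h2 : ψ (φ.symm z) = z := by rw [← he h1, φ.right_inv hz]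
    rw [← ψ.left_inv (hs h1), h2]
  have h1 : φ.symm =ᶠ[𝓝 y] ψ.symm := e.eventuallyEq_of_mem (φ.open_target.mem_nhds hy)
  have h2 : jac φ y = jac ψ y := by
    ext k i
    have := h1.mfderiv_eq (I := 𝓡 n) (I' := 𝓡 n)
    exact congrArg (fun D : EuclideanSpace ℝ (Fin n) →L[ℝ] EuclideanSpace ℝ (Fin n) =>
      (D (EuclideanSpace.single i 1)) k) this
  have h3 : gram (h (φ.symm y)) = gram (h (ψ.symm y)) := congrArg (fun z => gram (h z)) (e hy)
  rw [coeff_eq_jac, coeff_eq_jac, h2, h3]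

end Geometry

/-! ### The reference measure and the global coefficient matrix -/

section Atlas

open Matrix

variable {n : ℕ} {M : Type*} [TopologicalSpace M] [ChartedSpace (EuclideanSpace ℝ (Fin n)) M]
  (𝒜 : AmenableAtlas n M)

lemma AmenableAtlas.exists_mem_piece_of_mem {x : M} {b : Fin 𝒜.size}
    (hb : x ∈ (𝒜.chart b).source) : ∃ a, a ≤ b ∧ x ∈ 𝒜.piece a := by
  induction b using WellFoundedLT.induction with
  | ind b ih =>
    by_cases h : ∃ c, c < b ∧ x ∈ (𝒜.chart c).source
    · obtain ⟨c, hc, hx⟩ := h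
      obtain ⟨a, ha, hxa⟩ := ih c hc hx
      exact ⟨a, ha.trans hc.le, hxa⟩
    · refine ⟨b, le_rfl, hb, ?_⟩
      simp only [mem_iUnion, not_exists]
      exact fun c hc hx => h ⟨c, hc, hx⟩

lemma AmenableAtlas.exists_mem_piece (x : M) : ∃ a, x ∈ 𝒜.piece a := by
  obtain ⟨b, hb⟩ := 𝒜.cover x
  obtain ⟨a, -, ha⟩ := 𝒜.exists_mem_piece_of_mem hb
  exact ⟨a, ha⟩

lemma AmenableAtlas.piece_unique {x : M} {a b : Fin 𝒜.size} (ha : x ∈ 𝒜.piece a)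
    (hb : x ∈ 𝒜.piece b) : a = b := by
  rcases lt_trichotomy a b with h | h | h
  · exact absurd (mem_iUnion₂.mpr ⟨a, h, ha.1⟩) hb.2
  · exact h
  · exact absurd (mem_iUnion₂.mpr ⟨b, h, hb.1⟩) ha.2

/-- The index of the piece of the atlas that contains `x`. -/
def AmenableAtlas.idx (x : M) : Fin 𝒜.size := (𝒜.exists_mem_piece x).choose

lemma AmenableAtlas.mem_piece_idx (x : M) : x ∈ 𝒜.piece (𝒜.idx x) :=
  (𝒜.exists_mem_piece x).choose_spec

lemma AmenableAtlas.mem_source_idx (x : M) : x ∈ (𝒜.chart (𝒜.idx x)).source :=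
  (𝒜.mem_piece_idx x).1

lemma AmenableAtlas.idx_eq {x : M} {a : Fin 𝒜.size} (h : x ∈ 𝒜.piece a) : 𝒜.idx x = a :=
  𝒜.piece_unique (𝒜.mem_piece_idx x) h

/-- The coefficient matrix of `h` at `x`, in the chart of the piece that contains `x`. -/
def coefM (h : TensorField n M) (x : M) : Matrix (Fin n) (Fin n) ℝ :=
  coeff (𝒜.chart (𝒜.idx x)) h (𝒜.chart (𝒜.idx x) x)

lemma coefM_eq {x : M} {a : Fin 𝒜.size} (hx : x ∈ 𝒜.piece a) (h : TensorField n M) :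
    coefM 𝒜 h x = coeff (𝒜.chart a) h (𝒜.chart a x) := by
  rw [coefM, 𝒜.idx_eq hx]

lemma coefM_transpose {h : TensorField n M}
    (hh : ∀ (x : M) (u v : TangentSpace (𝓡 n) x), h x u v = h x v u) (x : M) :
    (coefM 𝒜 h x)ᵀ = coefM 𝒜 h x := coeff_transpose hh _

lemma eq_of_coefM_eq {h k : TensorField n M} {x : M} (e : coefM 𝒜 h x = coefM 𝒜 k x) :
    h x = k x := eq_of_coeff_eq (𝒜.chart_mem _) (𝒜.mem_source_idx x) e

lemma trPair_eq_coefM (g h k : TensorField n M) (x : M) :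
    trPair (g x) (h x) (k x) = matPair (coefM 𝒜 g x) (coefM 𝒜 h x) (coefM 𝒜 k x) :=
  trPair_eq_matPair (𝒜.chart_mem _) (𝒜.mem_source_idx x) g h k

lemma coefM_posDef_iff {h : TensorField n M} {x : M} (hh : ∀ u v, h x u v = h x v u) :
    (coefM 𝒜 h x).PosDef ↔ ∀ v : TangentSpace (𝓡 n) x, v ≠ 0 → 0 < h x v v :=
  coeff_posDef_iff (𝒜.chart_mem _) (𝒜.mem_source_idx x) hh

lemma AmenableAtlas.isOpen_earlier (a : Fin 𝒜.size) :
    IsOpen (⋃ b : Fin 𝒜.size, ⋃ _ : b < a, (𝒜.chart b).source) :=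
  isOpen_iUnion fun b => isOpen_iUnion fun _ => (𝒜.chart b).open_source

/-- The part of the target of a chart over which that chart is used to integrate. -/
def AmenableAtlas.dom (a : Fin 𝒜.size) : Set (EuclideanSpace ℝ (Fin n)) :=
  (𝒜.chart a).target ∩ (𝒜.chart a).symm ⁻¹' 𝒜.piece a

lemma AmenableAtlas.measurableSet_dom (a : Fin 𝒜.size) : MeasurableSet (𝒜.dom a) := by
  have h1 := (𝒜.chart a).symm.isOpen_inter_preimage (𝒜.chart a).open_source
  have h2 := (𝒜.chart a).symm.isOpen_inter_preimage (𝒜.isOpen_earlier a)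
  have : 𝒜.dom a = (𝒜.chart a).target \ ((𝒜.chart a).symm.source ∩
      (𝒜.chart a).symm ⁻¹' (⋃ b : Fin 𝒜.size, ⋃ _ : b < a, (𝒜.chart b).source)) := by
    ext y
    simp only [AmenableAtlas.dom, AmenableAtlas.piece, mem_inter_iff, mem_preimage, Set.mem_sdiff,
      OpenPartialHomeomorph.symm_source, not_and]
    exact ⟨fun h => ⟨h.1, fun _ => h.2.2⟩, fun h => ⟨h.1, (𝒜.chart a).map_target h.1, h.2 h.1⟩⟩
  rw [this]
  exact (𝒜.chart a).open_target.measurableSet.diff h2.measurableSet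

lemma coefM_symm {a : Fin 𝒜.size} {y : EuclideanSpace ℝ (Fin n)} (hy : y ∈ 𝒜.dom a)
    (h : TensorField n M) : coefM 𝒜 h ((𝒜.chart a).symm y) = coeff (𝒜.chart a) h y := by
  rw [coefM_eq 𝒜 hy.2, (𝒜.chart a).right_inv hy.1]

/-- Every chart target of the atlas lies in a compact subset of the target of a larger chart with
the same coefficients. -/
lemma AmenableAtlas.exists_compact (a : Fin 𝒜.size) :
    ∃ (ψ : OpenPartialHomeomorph M (EuclideanSpace ℝ (Fin n))) (L : Set (EuclideanSpace ℝ (Fin n))),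
      ψ ∈ IsManifold.maximalAtlas (𝓡 n) ∞ M ∧ IsCompact L ∧ L ⊆ ψ.target ∧
      (𝒜.chart a).target ⊆ L ∧
      ∀ (h : TensorField n M), ∀ y ∈ (𝒜.chart a).target, coeff (𝒜.chart a) h y = coeff ψ h y := by
  obtain ⟨K, ψ, hψ, hK, hs, hKψ, he⟩ := 𝒜.extends_chart a
  refine ⟨ψ, ψ '' K, hψ, hK.image_of_continuousOn (ψ.continuousOn.mono hKψ), ?_, ?_,
    fun h y hy => coeff_eq_of_eqOn (hs.trans hKψ) he h hy⟩
  · rintro _ ⟨x, hx, rfl⟩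
    exact ψ.map_source (hKψ hx)
  · intro y hy
    have h1 := (𝒜.chart a).map_target hy
    exact ⟨_, hs h1, by rw [← he h1, (𝒜.chart a).right_inv hy]⟩

section Smooth

variable [IsManifold (𝓡 n) ∞ M]

lemma exists_coeff_bound {h : TensorField n M} (hh : IsSmooth h) :
    ∃ C, ∀ a, ∀ y ∈ (𝒜.chart a).target, ∀ i j, |coeff (𝒜.chart a) h y i j| ≤ C := by
  have key : ∀ (a : Fin 𝒜.size) (i j : Fin n), ∃ C, ∀ y ∈ (𝒜.chart a).target,
      |coeff (𝒜.chart a) h y i j| ≤ C := fun a i j => by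
    obtain ⟨ψ, L, hψ, hL, hLψ, haL, e⟩ := 𝒜.exists_compact a
    have hc : ContinuousOn (fun y => coeff ψ h y i j) L :=
      (continuousOn_pi.mp (continuousOn_pi.mp (continuousOn_coeff hψ hh) i) j).mono hLψ
    obtain ⟨C, hC⟩ := hL.exists_bound_of_continuousOn hc
    exact ⟨C, fun y hy => by rw [e h y hy]; exact hC y (haL hy)⟩
  choose C hC using key
  refine ⟨∑ a, ∑ i, ∑ j, |C a i j|, fun a y hy i j => (hC a i j y hy).trans ?_⟩
  calc C a i j ≤ |C a i j| := le_abs_self _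
    _ ≤ ∑ j, |C a i j| := Finset.single_le_sum (f := fun j => |C a i j|)
        (fun _ _ => abs_nonneg _) (Finset.mem_univ j)
    _ ≤ ∑ i, ∑ j, |C a i j| := Finset.single_le_sum (f := fun i => ∑ j, |C a i j|)
        (fun _ _ => Finset.sum_nonneg fun _ _ => abs_nonneg _) (Finset.mem_univ i)
    _ ≤ _ := Finset.single_le_sum (f := fun a => ∑ i, ∑ j, |C a i j|)
        (fun _ _ => Finset.sum_nonneg fun _ _ => Finset.sum_nonneg fun _ _ => abs_nonneg _)
        (Finset.mem_univ a)

lemma field_symm (h : SymTensor n M) (x : M) (u v : TangentSpace (𝓡 n) x) :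
    field h x u v = field h x v u := h.2.2 x u v

lemma field_smooth (h : SymTensor n M) : IsSmooth (field h) := h.2.1

lemma exists_det_bound {g : SymTensor n M} (hg : g ∈ riemMetrics n M) :
    ∃ c > 0, ∀ a, ∀ y ∈ (𝒜.chart a).target, c ≤ (coeff (𝒜.chart a) (field g) y).det := by
  have key : ∀ a : Fin 𝒜.size, ∃ C, ∀ y ∈ (𝒜.chart a).target,
      0 < (coeff (𝒜.chart a) (field g) y).det ∧
      ((coeff (𝒜.chart a) (field g) y).det)⁻¹ ≤ C := fun a => by
    obtain ⟨ψ, L, hψ, hL, hLψ, haL, e⟩ := 𝒜.exists_compact a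
    have hpos : ∀ y ∈ L, 0 < (coeff ψ (field g) y).det := fun y hy => by
      have h1 := (coeff_posDef_iff hψ (ψ.map_target (hLψ hy)) (field_symm g _)).mpr (hg _)
      rw [ψ.right_inv (hLψ hy)] at h1
      exact h1.det_pos
    have hc : ContinuousOn (fun y => ((coeff ψ (field g) y).det)⁻¹) L := by
      refine ContinuousOn.inv₀ ?_ fun y hy => (hpos y hy).ne'
      exact (Continuous.matrix_det (A := fun M : Matrix (Fin n) (Fin n) ℝ => M)
        continuous_id).comp_continuousOn ((continuousOn_coeff hψ (field_smooth g)).mono hLψ)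
    obtain ⟨C, hC⟩ := hL.exists_bound_of_continuousOn hc
    refine ⟨C, fun y hy => ?_⟩
    rw [e _ y hy]
    exact ⟨hpos y (haL hy), (le_abs_self _).trans (hC y (haL hy))⟩
  choose C hC using key
  have hS : 0 ≤ ∑ a, |C a| := Finset.sum_nonneg fun _ _ => abs_nonneg _
  refine ⟨(∑ a, |C a| + 1)⁻¹, by positivity, fun a y hy => ?_⟩
  obtain ⟨h1, h2⟩ := hC a y hy
  rw [inv_le_comm₀ (by positivity) h1]
  refine h2.trans ((le_abs_self _).trans ?_)
  have := Finset.single_le_sum (f := fun a => |C a|) (fun _ _ => abs_nonneg _) (Finset.mem_univ a)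
  linarith

/-- The coefficients of a smooth Riemannian metric stay in a bounded region of the cone. -/
lemma exists_inRegion {g : SymTensor n M} (hg : g ∈ riemMetrics n M) :
    ∃ C, ∃ c > 0, ∀ x, InRegion C c (coefM 𝒜 (field g) x) := by
  obtain ⟨C, hC⟩ := exists_coeff_bound 𝒜 (field_smooth g)
  obtain ⟨c, hc, hc'⟩ := exists_det_bound 𝒜 hg
  refine ⟨C, c, hc, fun x => ⟨(coefM_posDef_iff 𝒜 (field_symm g x)).mpr (hg x), ?_, ?_⟩⟩
  · exact hC _ _ ((𝒜.chart _).map_source (𝒜.mem_source_idx x))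
  · exact hc' _ _ ((𝒜.chart _).map_source (𝒜.mem_source_idx x))

lemma exists_coefM_bound (h : SymTensor n M) :
    ∃ C, ∀ x i j, |coefM 𝒜 (field h) x i j| ≤ C := by
  obtain ⟨C, hC⟩ := exists_coeff_bound 𝒜 (field_smooth h)
  exact ⟨C, fun x => hC _ _ ((𝒜.chart _).map_source (𝒜.mem_source_idx x))⟩

/-- The coefficients of the elements of an amenable set stay in a common bounded region. -/
lemma IsAmenable.exists_inRegion {𝒜 : AmenableAtlas n M} {g : SymTensor n M}
    (hg : g ∈ riemMetrics n M) {𝒰 : Set (SymTensor n M)} (h𝒰 : IsAmenable 𝒜 g 𝒰) :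
    ∃ C, ∃ c > 0, ∀ h ∈ 𝒰, ∀ x, InRegion C c (coefM 𝒜 (field h) x) := by
  obtain ⟨C, -, δ, hδ, hb⟩ := h𝒰.bounds
  obtain ⟨c, hc, hc'⟩ := exists_det_bound 𝒜 hg
  refine ⟨C, δ ^ n * c, by positivity, fun h hh x =>
    ⟨(coefM_posDef_iff 𝒜 (field_symm h x)).mpr (h𝒰.subset hh x), ?_, ?_⟩⟩
  · exact fun i j => (hb h hh).2 _ x (𝒜.mem_source_idx x) i j
  · have h1 : δ ^ n ≤ (raise (field g x) (field h x)).det :=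
      pow_le_det_of_eigenvalues ((gram_posDef_iff (field_symm g x)).mpr (hg x))
        (gram_transpose (field_symm h x)) hδ ((hb h hh).1 x)
    rw [det_raise (𝒜.chart_mem _) (𝒜.mem_source_idx x), Matrix.det_mul, Matrix.det_nonsing_inv,
      Ring.inverse_eq_inv'] at h1
    have h2 : c ≤ (coefM 𝒜 (field g) x).det :=
      hc' _ _ ((𝒜.chart _).map_source (𝒜.mem_source_idx x))
    have h3 : 0 < (coefM 𝒜 (field g) x).det := hc.trans_le h2
    change δ ^ n ≤ ((coefM 𝒜 (field g) x).det)⁻¹ * (coefM 𝒜 (field h) x).det at h1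
    rw [inv_mul_eq_div, le_div_iff₀ h3] at h1
    exact (mul_le_mul_of_nonneg_left h2 (by positivity)).trans h1

lemma continuousOn_coeff_comp_chart (h : SymTensor n M) (a : Fin 𝒜.size) :
    ContinuousOn (fun x => coeff (𝒜.chart a) (field h) (𝒜.chart a x)) (𝒜.chart a).source :=
  (continuousOn_coeff (𝒜.chart_mem a) (field_smooth h)).comp (𝒜.chart a).continuousOn
    (𝒜.chart a).mapsTo

end Smooth

section Measure

variable [MeasurableSpace M]

/-- Coordinate Lebesgue measure on the pieces of the atlas. -/
def refMeasure : Measure M :=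
  Measure.sum fun a : Fin 𝒜.size =>
    ((volume : Measure (EuclideanSpace ℝ (Fin n))).restrict (𝒜.dom a)).map (𝒜.chart a).symm

variable [BorelSpace M]

lemma aemeasurable_chart_symm (a : Fin 𝒜.size) (μ : Measure (EuclideanSpace ℝ (Fin n))) :
    AEMeasurable (𝒜.chart a).symm (μ.restrict (𝒜.dom a)) :=
  ((𝒜.chart a).continuousOn_symm.aemeasurable (𝒜.chart a).open_target.measurableSet).mono_measure
    (Measure.restrict_mono inter_subset_left le_rfl)

instance isFiniteMeasure_refMeasure : IsFiniteMeasure (refMeasure 𝒜) := by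
  refine ⟨?_⟩
  rw [refMeasure, Measure.sum_apply _ MeasurableSet.univ, tsum_fintype]
  refine ENNReal.sum_lt_top.mpr fun a _ => ?_
  rw [Measure.map_apply_of_aemeasurable (aemeasurable_chart_symm 𝒜 a _) MeasurableSet.univ,
    preimage_univ, Measure.restrict_apply_univ]
  obtain ⟨ψ, L, -, hL, -, haL, -⟩ := 𝒜.exists_compact a
  exact (measure_mono (inter_subset_left.trans haL)).trans_lt hL.measure_lt_top

lemma refMeasure_pos_of_isOpen {U : Set M} (hU : IsOpen U) (hne : U.Nonempty) :
    0 < refMeasure 𝒜 U := by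
  obtain ⟨x, hx⟩ := hne
  -- take the first chart whose domain meets `U`
  let T : Finset (Fin 𝒜.size) := by
    classical exact Finset.univ.filter fun a => (U ∩ (𝒜.chart a).source).Nonempty
  have hT : T.Nonempty := by
    obtain ⟨a, ha⟩ := 𝒜.cover x
    exact ⟨a, by simp only [T, Finset.mem_filter, Finset.mem_univ, true_and]; exact ⟨x, hx, ha⟩⟩
  set a := T.min' hT with ha
  have haT : (U ∩ (𝒜.chart a).source).Nonempty := by
    have := T.min'_mem hT
    simp only [T, Finset.mem_filter, Finset.mem_univ, true_and] at this
    exact this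
  have hsub : U ∩ (𝒜.chart a).source ⊆ 𝒜.piece a := by
    rintro z ⟨hzU, hza⟩
    refine ⟨hza, ?_⟩
    simp only [mem_iUnion, not_exists]
    intro b hb hzb
    have : a ≤ b := T.min'_le b (by
      simp only [T, Finset.mem_filter, Finset.mem_univ, true_and]; exact ⟨z, hzU, hzb⟩)
    exact absurd hb (not_lt.mpr this)
  set V := (𝒜.chart a).target ∩ (𝒜.chart a).symm ⁻¹' U with hV
  have hVo : IsOpen V := (𝒜.chart a).symm.isOpen_inter_preimage hU
  have hVne : V.Nonempty := by
    obtain ⟨z, hzU, hza⟩ := haT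
    exact ⟨𝒜.chart a z, (𝒜.chart a).map_source hza, by
      rw [mem_preimage, (𝒜.chart a).left_inv hza]; exact hzU⟩
  have hVd : V ⊆ (𝒜.chart a).symm ⁻¹' U ∩ 𝒜.dom a := fun y hy =>
    ⟨hy.2, hy.1, hsub ⟨hy.2, (𝒜.chart a).map_target hy.1⟩⟩
  calc 0 < volume V := hVo.measure_pos volume hVne
    _ ≤ volume ((𝒜.chart a).symm ⁻¹' U ∩ 𝒜.dom a) := measure_mono hVd
    _ = ((volume.restrict (𝒜.dom a)).map (𝒜.chart a).symm) U := by
        rw [Measure.map_apply_of_aemeasurable (aemeasurable_chart_symm 𝒜 a _) hU.measurableSet,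
          Measure.restrict_apply' (𝒜.measurableSet_dom a)]
    _ ≤ refMeasure 𝒜 U :=
        Measure.le_sum (fun a => (volume.restrict (𝒜.dom a)).map (𝒜.chart a).symm) a U

lemma AmenableAtlas.measurableSet_piece (a : Fin 𝒜.size) : MeasurableSet (𝒜.piece a) :=
  (𝒜.chart a).open_source.measurableSet.diff (𝒜.isOpen_earlier a).measurableSet

variable [IsManifold (𝓡 n) ∞ M]

lemma measurable_coefM (h : SymTensor n M) (i j : Fin n) :
    Measurable fun x => coefM 𝒜 (field h) x i j := by
  have h1 : (fun x => coefM 𝒜 (field h) x i j) = fun x => ∑ a, (𝒜.piece a).indicator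
      (fun x => coeff (𝒜.chart a) (field h) (𝒜.chart a x) i j) x := by
    funext x
    rw [Finset.sum_eq_single (𝒜.idx x)]
    · rw [indicator_of_mem (𝒜.mem_piece_idx x)]; rfl
    · intro b _ hb
      exact indicator_of_notMem (fun hx => hb (𝒜.idx_eq hx).symm) _
    · simp
  rw [h1]
  refine Finset.measurable_sum _ fun a _ => ?_
  have hc : ContinuousOn (fun x => coeff (𝒜.chart a) (field h) (𝒜.chart a x) i j) (𝒜.piece a) :=
    (continuousOn_pi.mp (continuousOn_pi.mp (continuousOn_coeff_comp_chart 𝒜 h a) i) j).mono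
      sdiff_subset
  classical
  rw [← Set.piecewise_eq_indicator]
  exact hc.measurable_piecewise continuousOn_const (𝒜.measurableSet_piece a)

/-- The density of `μ_g` with respect to the reference measure. -/
def density (g : TensorField n M) (x : M) : ENNReal := ENNReal.ofReal (√(coefM 𝒜 g x).det)

lemma measurable_det_coefM (g : SymTensor n M) :
    Measurable fun x => (coefM 𝒜 (field g) x).det := by
  simp only [Matrix.det_apply']
  exact Finset.measurable_sum _ fun σ _ => measurable_const.mul
    (Finset.measurable_prod _ fun i _ => measurable_coefM 𝒜 g _ _)

lemma measurable_density (g : SymTensor n M) : Measurable (density 𝒜 (field g)) :=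
  (measurable_det_coefM 𝒜 g).sqrt.ennreal_ofReal

lemma vol_eq_withDensity (g : SymTensor n M) :
    vol 𝒜 (field g) = (refMeasure 𝒜).withDensity (density 𝒜 (field g)) := by
  rw [vol, refMeasure, withDensity_sum]
  refine congrArg Measure.sum (funext fun a => ?_)
  change (Measure.restrict _ (𝒜.dom a)).map _ = _
  refine Measure.ext fun s hs => ?_
  rw [Measure.map_apply_of_aemeasurable (aemeasurable_chart_symm 𝒜 a _) hs,
    restrict_withDensity (𝒜.measurableSet_dom a), withDensity_apply', withDensity_apply' _ s,
    Measure.restrict_map_of_aemeasurable (aemeasurable_chart_symm 𝒜 a _) hs,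
    lintegral_map' (measurable_density 𝒜 g).aemeasurable
      ((aemeasurable_chart_symm 𝒜 a _).mono_measure Measure.restrict_le_self)]
  refine lintegral_congr_ae (ae_restrict_of_ae ?_)
  filter_upwards [ae_restrict_mem (𝒜.measurableSet_dom a)] with y hy
  rw [density, coefM_symm 𝒜 hy]

end Measure

end Atlas

/-! ### Paths of fields of positive definite matrices -/

section MatrixPaths

open Matrix

variable {n : ℕ}

lemma matPair_eq_adjugate (A H K : Matrix (Fin n) (Fin n) ℝ) :
    matPair A H K = (A.det)⁻¹ ^ 2 * ((A.adjugate * H) * (A.adjugate * K)).trace := by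
  rw [matPair, Matrix.inv_def, Ring.inverse_eq_inv']
  simp only [Matrix.smul_mul, Matrix.mul_smul, Matrix.trace_smul, smul_eq_mul, sq, mul_assoc]

/-- A continuous function of a matrix with measurable entries is measurable. -/
lemma measurable_comp_of_entries {Y : Type*} [MeasurableSpace Y]
    {f : Matrix (Fin n) (Fin n) ℝ → ℝ} (hf : Continuous f)
    {A : Y → Matrix (Fin n) (Fin n) ℝ} (hA : ∀ i j, Measurable fun y => A y i j) :
    Measurable fun y => f (A y) := by
  let f' : (Fin n → Fin n → ℝ) → ℝ := fun m => f (Matrix.of m)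
  have hf' : Continuous f' := hf
  exact hf'.measurable.comp (measurable_pi_lambda _ fun i => measurable_pi_lambda _ fun j => hA i j)

lemma measurable_matPair {Y : Type*} [MeasurableSpace Y]
    {A H K : Y → Matrix (Fin n) (Fin n) ℝ} (hA : ∀ i j, Measurable fun y => A y i j)
    (hH : ∀ i j, Measurable fun y => H y i j) (hK : ∀ i j, Measurable fun y => K y i j) :
    Measurable fun y => matPair (A y) (H y) (K y) := by
  simp only [matPair_eq_adjugate]
  have hdet := measurable_comp_of_entries (continuous_id.matrix_det (n := Fin n) (R := ℝ)) hA
  have hadj : ∀ i j, Measurable fun y => (A y).adjugate i j := fun i j =>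
    measurable_comp_of_entries (f := fun A : Matrix (Fin n) (Fin n) ℝ => A.adjugate i j)
      ((continuous_id.matrix_adjugate).matrix_elem i j) hA
  refine (hdet.inv.pow_const 2).mul ?_
  simp only [Matrix.trace, Matrix.diag, Matrix.mul_apply]
  fun_prop

/-- A continuous function of a matrix is uniformly continuous on bounded sets. -/
lemma exists_modulus {f : Matrix (Fin n) (Fin n) ℝ → ℝ} (hf : Continuous f) (C : ℝ) {ε : ℝ}
    (hε : 0 < ε) : ∃ δ > 0, ∀ A B : Matrix (Fin n) (Fin n) ℝ, (∀ i j, |A i j| ≤ C) →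
      (∀ i j, |B i j| ≤ C) → (∀ i j, |A i j - B i j| < δ) → |f A - f B| < ε := by
  let f' : (Fin n → Fin n → ℝ) → ℝ := fun m => f (Matrix.of m)
  have hf' : Continuous f' := hf
  have hc : IsCompact (Set.pi Set.univ fun _ : Fin n => Set.pi Set.univ fun _ : Fin n =>
      Set.Icc (-C) C) :=
    isCompact_univ_pi fun _ => isCompact_univ_pi fun _ => isCompact_Icc
  obtain ⟨δ, hδ, h⟩ := Metric.uniformContinuousOn_iff.mp
    (hc.uniformContinuousOn_of_continuous hf'.continuousOn) ε hε
  refine ⟨δ, hδ, fun A B hA hB hAB => ?_⟩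
  exact h (fun i j => A i j) (fun i _ j _ => abs_le.mp (hA i j)) (fun i j => B i j)
    (fun i _ j _ => abs_le.mp (hB i j))
    ((dist_pi_lt_iff hδ).mpr fun i => (dist_pi_lt_iff hδ).mpr fun j => hAB i j)

variable {X : Type*}

/-- A `C¹` path `t ↦ A t` of fields of positive definite matrices on `X`, with derivative `V`, for
the topology of uniform convergence. At each time `A` takes values in a bounded region of the cone
and `V` is bounded. -/
structure IsC1MatrixPath [MeasurableSpace X] (a b : ℝ)
    (A V : ℝ → X → Matrix (Fin n) (Fin n) ℝ) : Prop where
  le : a ≤ b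
  deriv : ∀ t ∈ Icc a b, ∀ x i j,
    HasDerivWithinAt (fun s => A s x i j) (V t x i j) (Icc a b) t
  cont : ∀ t ∈ Icc a b, ∀ ε > 0, ∀ᶠ s in 𝓝[Icc a b] t, ∀ x i j, |A s x i j - A t x i j| < ε
  cont_deriv : ∀ t ∈ Icc a b, ∀ ε > 0, ∀ᶠ s in 𝓝[Icc a b] t, ∀ x i j,
    |V s x i j - V t x i j| < ε
  region : ∀ t ∈ Icc a b, ∃ C, ∃ c > 0, ∀ x, InRegion C c (A t x)
  posDef : ∀ t ∈ Icc a b, ∀ x, (A t x).PosDef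
  bound : ∀ t ∈ Icc a b, ∃ C, ∀ x i j, |V t x i j| ≤ C
  symm : ∀ t ∈ Icc a b, ∀ x, (V t x)ᵀ = V t x
  measurable : ∀ t i j, Measurable fun x => A t x i j
  measurable_deriv : ∀ t i j, Measurable fun x => V t x i j

/-- The integrand `tr (A⁻¹ H A⁻¹ H) √(det A)` of the `L²` metric. -/
def energyDensity (A H : Matrix (Fin n) (Fin n) ℝ) : ℝ := matPair A H H * √A.det

lemma frobSq_le_of_entries {H : Matrix (Fin n) (Fin n) ℝ} {C : ℝ} (h : ∀ i j, |H i j| ≤ C) :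
    frobSq H ≤ n * (n * C ^ 2) := by
  unfold frobSq
  have h1 : ∀ i j, H i j ^ 2 ≤ C ^ 2 := fun i j => by
    rw [← sq_abs]; exact pow_le_pow_left₀ (abs_nonneg _) (h i j) 2
  calc _ ≤ ∑ _i : Fin n, ∑ _j : Fin n, C ^ 2 :=
        Finset.sum_le_sum fun i _ => Finset.sum_le_sum fun j _ => h1 i j
    _ = _ := by simp

lemma energyDensity_nonneg {A H : Matrix (Fin n) (Fin n) ℝ} (hA : A.PosDef) (hH : Hᵀ = H) :
    0 ≤ energyDensity A H := mul_nonneg (matPair_self_nonneg hA hH) (Real.sqrt_nonneg _)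

lemma measurable_energyDensity {Y : Type*} [MeasurableSpace Y]
    {A H : Y → Matrix (Fin n) (Fin n) ℝ} (hA : ∀ i j, Measurable fun y => A y i j)
    (hH : ∀ i j, Measurable fun y => H y i j) :
    Measurable fun y => energyDensity (A y) (H y) :=
  (measurable_matPair hA hH hH).mul
    (measurable_comp_of_entries (continuous_id.matrix_det (n := Fin n) (R := ℝ)) hA).sqrt

lemma continuousWithinAt_energyDensity {Y : Type*} [TopologicalSpace Y]
    {A H : Y → Matrix (Fin n) (Fin n) ℝ} {y : Y} {s : Set Y}
    (hA : ContinuousWithinAt A s y) (hH : ContinuousWithinAt H s y) (hdet : (A y).det ≠ 0) :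
    ContinuousWithinAt (fun z => energyDensity (A z) (H z)) s y :=
  (continuousWithinAt_matPair hA hH hH hdet).mul
    ((Continuous.matrix_det (A := fun M : Matrix (Fin n) (Fin n) ℝ => M)
        continuous_id).continuousAt.comp_continuousWithinAt hA).sqrt

namespace IsC1MatrixPath

variable [MeasurableSpace X] {a b : ℝ} {A V : ℝ → X → Matrix (Fin n) (Fin n) ℝ}
  (hp : IsC1MatrixPath a b A V)
include hp

lemma continuousWithinAt {t : ℝ} (ht : t ∈ Icc a b) (x : X) :
    ContinuousWithinAt (fun s => A s x) (Icc a b) t :=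
  continuousWithinAt_pi.mpr fun i => continuousWithinAt_pi.mpr fun j =>
    (hp.deriv t ht x i j).continuousWithinAt

lemma continuousWithinAt_deriv {t : ℝ} (ht : t ∈ Icc a b) (x : X) :
    ContinuousWithinAt (fun s => V s x) (Icc a b) t := by
  refine continuousWithinAt_pi.mpr fun i => continuousWithinAt_pi.mpr fun j => ?_
  refine Metric.tendsto_nhds.mpr fun ε hε => ?_
  filter_upwards [hp.cont_deriv t ht ε hε] with s hs using hs x i j

lemma continuousWithinAt_energyDensity {t : ℝ} (ht : t ∈ Icc a b) (x : X) :
    ContinuousWithinAt (fun s => energyDensity (A s x) (V s x)) (Icc a b) t :=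
  MetricManifold.continuousWithinAt_energyDensity (hp.continuousWithinAt ht x)
    (hp.continuousWithinAt_deriv ht x) (hp.posDef t ht x).det_pos.ne'

/-- Near each time, the path stays in one bounded region of the cone. -/
lemma eventually_inRegion {t : ℝ} (ht : t ∈ Icc a b) :
    ∃ C, ∃ c > 0, ∀ᶠ s in 𝓝[Icc a b] t, ∀ x, InRegion C c (A s x) := by
  obtain ⟨C, c, hc, hreg⟩ := hp.region t ht
  obtain ⟨δ, hδ, hmod⟩ := exists_modulus (continuous_id.matrix_det (n := Fin n) (R := ℝ)) (C + 1)
    (half_pos hc)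
  refine ⟨C + 1, c / 2, half_pos hc, ?_⟩
  filter_upwards [hp.cont t ht 1 one_pos, hp.cont t ht δ hδ, self_mem_nhdsWithin] with s h1 h2 hs x
  have hA1 : ∀ i j, |A s x i j| ≤ C + 1 := fun i j => by
    have e1 := (hreg x).entry_le i j
    have e2 := h1 x i j
    have := abs_sub_abs_le_abs_sub (A s x i j) (A t x i j)
    linarith
  refine ⟨hp.posDef s hs x, hA1, ?_⟩
  have h3 := hmod (A s x) (A t x) hA1 (fun i j => ((hreg x).entry_le i j).trans (by linarith))
    (h2 x)
  have h4 := (hreg x).le_det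
  have h5 := (abs_lt.mp h3).1
  simp only [id] at h5
  linarith

lemma eventually_energyDensity_le {t : ℝ} (ht : t ∈ Icc a b) :
    ∃ K, ∀ᶠ s in 𝓝[Icc a b] t, ∀ x, energyDensity (A s x) (V s x) ≤ K := by
  obtain ⟨C, c, hc, hreg⟩ := hp.eventually_inRegion ht
  obtain ⟨D, hD⟩ := hp.bound t ht
  obtain ⟨K, hK, hK'⟩ := exists_matPair_le n C hc
  refine ⟨K * (n * (n * (D + 1) ^ 2)), ?_⟩
  filter_upwards [hreg, hp.cont_deriv t ht 1 one_pos] with s h1 h2 x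
  refine (hK' _ (V s x) (h1 x)).trans (mul_le_mul_of_nonneg_left ?_ hK.le)
  refine frobSq_le_of_entries fun i j => ?_
  have e1 := hD x i j
  have e2 := h2 x i j
  have := abs_sub_abs_le_abs_sub (V s x i j) (V t x i j)
  linarith

lemma integrable_energyDensity (μ : Measure X) [IsFiniteMeasure μ] {t : ℝ} (ht : t ∈ Icc a b) :
    Integrable (fun x => energyDensity (A t x) (V t x)) μ := by
  obtain ⟨K, hK⟩ := hp.eventually_energyDensity_le ht
  have hK' := hK.self_of_nhdsWithin ht
  refine (integrable_const K).mono'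
    (measurable_energyDensity (hp.measurable t) (hp.measurable_deriv t)).aestronglyMeasurable
    (Eventually.of_forall fun x => ?_)
  rw [Real.norm_of_nonneg (energyDensity_nonneg (hp.posDef t ht x) (hp.symm t ht x))]
  exact hK' x

lemma continuousOn_energy (μ : Measure X) [IsFiniteMeasure μ] :
    ContinuousOn (fun t => ∫ x, energyDensity (A t x) (V t x) ∂μ) (Icc a b) := by
  intro t ht
  obtain ⟨K, hK⟩ := hp.eventually_energyDensity_le ht
  refine continuousWithinAt_of_dominated (bound := fun _ => K) (Eventually.of_forall fun s =>
    (measurable_energyDensity (hp.measurable s) (hp.measurable_deriv s)).aestronglyMeasurable)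
    ?_ (integrable_const K) (Eventually.of_forall fun x => hp.continuousWithinAt_energyDensity ht x)
  filter_upwards [hK, self_mem_nhdsWithin] with s hs hsI
  refine Eventually.of_forall fun x => ?_
  rw [Real.norm_of_nonneg (energyDensity_nonneg (hp.posDef s hsI x) (hp.symm s hsI x))]
  exact hs x

/-- Pointwise estimate: the variation of `rootFun v` is at most the integral of the speed. -/
lemma abs_rootFun_sub_le (v : Fin n → ℝ) (x : X) :
    |rootFun v (A b x) - rootFun v (A a x)| ≤
      ∫ t in a..b, (n + 1) * √(energyDensity (A t x) (V t x)) := by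
  have hd : ∀ t ∈ Icc a b, ∃ d, HasDerivWithinAt (fun u => rootFun v (A u x)) d (Icc a b) t ∧
      |d| ≤ (n + 1) * √(energyDensity (A t x) (V t x)) := fun t ht =>
    exists_hasDerivWithinAt_rootFun (hp.deriv t ht x) (hp.posDef t ht x) (hp.symm t ht x) v
  choose! d hd hd' using hd
  have hcont : ContinuousOn (fun u => rootFun v (A u x)) (Icc a b) := fun t ht =>
    (hd t ht).continuousWithinAt
  have hint : IntegrableOn (fun t => (n + 1) * √(energyDensity (A t x) (V t x))) (Icc a b) :=
    ContinuousOn.integrableOn_Icc fun t ht =>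
      continuousWithinAt_const.mul (hp.continuousWithinAt_energyDensity ht x).sqrt
  have hder : ∀ t ∈ Ioo a b, HasDerivWithinAt (fun u => rootFun v (A u x)) (d t) (Ioi t) t :=
    fun t ht => ((hd t (Ioo_subset_Icc_self ht)).hasDerivAt
      (Icc_mem_nhds ht.1 ht.2)).hasDerivWithinAt
  refine abs_le.mpr ⟨?_, ?_⟩
  · have := intervalIntegral.sub_le_integral_of_hasDeriv_right_of_le hp.le hcont.neg
      (fun t ht => (hder t ht).neg) hint
      (fun t ht => (neg_le_abs _).trans (hd' t (Ioo_subset_Icc_self ht)))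
    simp only [Pi.neg_apply] at this
    linarith
  · exact intervalIntegral.sub_le_integral_of_hasDeriv_right_of_le hp.le hcont hder hint
      (fun t ht => (le_abs_self _).trans (hd' t (Ioo_subset_Icc_self ht)))

end IsC1MatrixPath

/-- Minkowski's inequality in integrated form: if `f` is pointwise bounded by the integral of
`s t` over `t`, then the `L²` norm of `f` is bounded by the integral of the `L²` norms. -/
lemma lintegral_sq_le_of_le_lintegral {X T : Type*} [MeasurableSpace X] [MeasurableSpace T]
    {μ : Measure X} {ν : Measure T} [SFinite μ] [SFinite ν] {f : X → ENNReal}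
    {s : T → X → ENNReal} (hf : Measurable f) (hs : Measurable (Function.uncurry s))
    (hfin : ∫⁻ x, f x ^ (2 : ℝ) ∂μ ≠ ⊤) (h : ∀ x, f x ≤ ∫⁻ t, s t x ∂ν) :
    (∫⁻ x, f x ^ (2 : ℝ) ∂μ) ^ (1 / 2 : ℝ) ≤ ∫⁻ t, (∫⁻ x, s t x ^ (2 : ℝ) ∂μ) ^ (1 / 2 : ℝ) ∂ν := by
  set I := ∫⁻ x, f x ^ (2 : ℝ) ∂μ with hI
  have hst : ∀ t, Measurable (s t) := fun t => hs.comp measurable_prodMk_left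
  have hsx : ∀ x, Measurable fun t => s t x := fun x => hs.comp measurable_prodMk_right
  have h1 : I ≤ I ^ (1 / 2 : ℝ) * ∫⁻ t, (∫⁻ x, s t x ^ (2 : ℝ) ∂μ) ^ (1 / 2 : ℝ) ∂ν :=
    calc I ≤ ∫⁻ x, ∫⁻ t, f x * s t x ∂ν ∂μ := by
          refine lintegral_mono fun x => ?_
          rw [lintegral_const_mul _ (hsx x), ENNReal.rpow_two, sq]
          gcongr
          exact h x
      _ = ∫⁻ t, ∫⁻ x, f x * s t x ∂μ ∂ν :=
          lintegral_lintegral_swap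
            ((hf.comp measurable_fst).mul (hs.comp measurable_swap)).aemeasurable
      _ ≤ ∫⁻ t, I ^ (1 / 2 : ℝ) * (∫⁻ x, s t x ^ (2 : ℝ) ∂μ) ^ (1 / 2 : ℝ) ∂ν :=
          lintegral_mono fun t => ENNReal.lintegral_mul_le_Lp_mul_Lq μ
            Real.HolderConjugate.two_two hf.aemeasurable (hst t).aemeasurable
      _ = _ := lintegral_const_mul' _ _ (ENNReal.rpow_ne_top_of_nonneg (by norm_num) hfin)
  rcases eq_or_ne I 0 with h0 | h0
  · rw [h0, ENNReal.zero_rpow_of_pos (by norm_num)]; exact zero_le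
  · have h2 : I ^ (1 / 2 : ℝ) ≠ 0 := by simp [ENNReal.rpow_eq_zero_iff, h0]
    have h3 : I ^ (1 / 2 : ℝ) ≠ ⊤ := ENNReal.rpow_ne_top_of_nonneg (by norm_num) hfin
    have h4 : I = I ^ (1 / 2 : ℝ) * I ^ (1 / 2 : ℝ) := by
      rw [← ENNReal.rpow_add_of_nonneg _ _ (by norm_num) (by norm_num)]; norm_num
    nth_rewrite 1 [h4] at h1
    exact (ENNReal.mul_le_mul_iff_right h2 h3).mp h1

/-- The `L²` distance between the values of `rootFun v` at the ends of a path is bounded by the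
length of the path. -/
lemma IsC1MatrixPath.eLpNorm_rootFun_sub_le [MeasurableSpace X] {a b : ℝ}
    {A V : ℝ → X → Matrix (Fin n) (Fin n) ℝ} (hp : IsC1MatrixPath a b A V)
    (μ : Measure X) [IsFiniteMeasure μ] (v : Fin n → ℝ)
    (hm : ∀ t ∈ Icc a b, Measurable fun x => rootFun v (A t x)) :
    eLpNorm (fun x => rootFun v (A b x) - rootFun v (A a x)) 2 μ ≤
      ENNReal.ofReal ((n + 1) * ∫ t in a..b, √(∫ x, energyDensity (A t x) (V t x) ∂μ)) := by
  have ha : a ∈ Icc a b := left_mem_Icc.mpr hp.le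
  have hb : b ∈ Icc a b := right_mem_Icc.mpr hp.le
  set q : ℝ → X → ℝ := fun t x => (n + 1) * √(energyDensity (A t x) (V t x)) with hq
  have hqc : ∀ x, ContinuousOn (fun t => q t x) (Icc a b) := fun x t ht =>
    continuousWithinAt_const.mul (hp.continuousWithinAt_energyDensity ht x).sqrt
  have hqm : ∀ t, Measurable (q t) := fun t => measurable_const.mul
    (measurable_energyDensity (hp.measurable t) (hp.measurable_deriv t)).sqrt
  -- outside `[a, b]` the speed is extended by its boundary values, to get joint measurability
  let s : ℝ → X → ENNReal := fun t x => ENNReal.ofReal (q (projIcc a b hp.le t) x)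
  have hs : Measurable (Function.uncurry s) := by
    have : Measurable (Function.uncurry fun (t : ℝ) (x : X) => q (projIcc a b hp.le t) x) :=
      measurable_uncurry_of_continuous_of_measurable
        (fun x => (hqc x).comp_continuous (continuous_subtype_val.comp continuous_projIcc)
          fun t => (projIcc a b hp.le t).2) (fun t => hqm _)
    exact this.ennreal_ofReal
  have hsI : ∀ t ∈ Icc a b, s t = fun x => ENNReal.ofReal (q t x) := fun t ht => by
    simp only [s, projIcc_of_mem hp.le ht]
  set f : X → ENNReal := fun x => ‖rootFun v (A b x) - rootFun v (A a x)‖ₑ with hf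
  have hfm : Measurable f := ((hm b hb).sub (hm a ha)).enorm
  have hle : ∀ x, f x ≤ ∫⁻ t, s t x ∂(volume.restrict (Icc a b)) := fun x => by
    have e1 : ∫⁻ t, s t x ∂(volume.restrict (Icc a b)) =
        ∫⁻ t in Icc a b, ENNReal.ofReal (q t x) :=
      setLIntegral_congr_fun measurableSet_Icc fun t ht => by
        rw [hsI t ht]
    rw [e1, ← ofReal_integral_eq_lintegral_ofReal (hqc x).integrableOn_Icc
      (Eventually.of_forall fun t => by simp only [hq, Pi.zero_apply]; positivity),
      integral_Icc_eq_integral_Ioc, ← intervalIntegral.integral_of_le hp.le]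
    simp only [hf]
    rw [Real.enorm_eq_ofReal_abs]
    exact ENNReal.ofReal_le_ofReal (hp.abs_rootFun_sub_le v x)
  have hfin : ∫⁻ x, f x ^ (2 : ℝ) ∂μ ≠ ⊤ := by
    obtain ⟨C, c, hc, hC⟩ := hp.region a ha
    obtain ⟨C', c', hc', hC'⟩ := hp.region b hb
    obtain ⟨K, hK, hKb⟩ := exists_rootFun_le n C
    obtain ⟨K', hK', hKb'⟩ := exists_rootFun_le n C'
    have hbd : ∀ x, f x ≤ ENNReal.ofReal (K' + K) := fun x => by
      simp only [hf]
      rw [Real.enorm_eq_ofReal_abs]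
      refine ENNReal.ofReal_le_ofReal ((abs_sub _ _).trans (add_le_add ?_ ?_))
      · exact hKb' _ (hC' x).posDef (hC' x).entry_le v
      · exact hKb _ (hC x).posDef (hC x).entry_le v
    refine ((lintegral_mono fun x => ENNReal.rpow_le_rpow (hbd x) (by norm_num)).trans_lt ?_).ne
    rw [lintegral_const]
    exact ENNReal.mul_lt_top (ENNReal.rpow_lt_top_of_nonneg (by norm_num) ENNReal.ofReal_ne_top)
      (measure_lt_top μ _)
  have hmink := lintegral_sq_le_of_le_lintegral hfm hs hfin hle
  have hE := hp.continuousOn_energy μ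
  have e2 : ∫⁻ t, (∫⁻ x, s t x ^ (2 : ℝ) ∂μ) ^ (1 / 2 : ℝ) ∂(volume.restrict (Icc a b)) =
      ENNReal.ofReal ((n + 1) * ∫ t in a..b, √(∫ x, energyDensity (A t x) (V t x) ∂μ)) := by
    have e3 : ∀ t ∈ Icc a b, (∫⁻ x, s t x ^ (2 : ℝ) ∂μ) ^ (1 / 2 : ℝ) =
        ENNReal.ofReal ((n + 1) * √(∫ x, energyDensity (A t x) (V t x) ∂μ)) := fun t ht => by
      have e4 : ∀ x, s t x ^ (2 : ℝ) =
          ENNReal.ofReal ((n + 1) ^ 2 * energyDensity (A t x) (V t x)) := fun x => by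
        have h0 := energyDensity_nonneg (hp.posDef t ht x) (hp.symm t ht x)
        rw [hsI t ht, ENNReal.ofReal_rpow_of_nonneg (by simp only [hq]; positivity) (by norm_num)]
        simp only [hq]
        rw [Real.rpow_two, mul_pow, Real.sq_sqrt h0]
      have h1 : 0 ≤ ∫ x, energyDensity (A t x) (V t x) ∂μ := integral_nonneg fun x =>
        energyDensity_nonneg (hp.posDef t ht x) (hp.symm t ht x)
      simp only [e4]
      rw [← ofReal_integral_eq_lintegral_ofReal ((hp.integrable_energyDensity μ ht).const_mul _)
        (Eventually.of_forall fun x => mul_nonneg (by positivity)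
          (energyDensity_nonneg (hp.posDef t ht x) (hp.symm t ht x))), integral_const_mul,
        ENNReal.ofReal_rpow_of_nonneg (by positivity) (by norm_num), ← Real.sqrt_eq_rpow,
        Real.sqrt_mul (by positivity), Real.sqrt_sq (by positivity)]
    have hint : IntegrableOn
        (fun t => ((n : ℝ) + 1) * √(∫ x, energyDensity (A t x) (V t x) ∂μ)) (Icc a b) :=
      ContinuousOn.integrableOn_Icc (continuousOn_const.mul hE.sqrt)
    rw [setLIntegral_congr_fun measurableSet_Icc e3, ← ofReal_integral_eq_lintegral_ofReal hint
        (Eventually.of_forall fun t => by simp only [Pi.zero_apply]; positivity),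
      integral_Icc_eq_integral_Ioc, ← intervalIntegral.integral_of_le hp.le,
      intervalIntegral.integral_const_mul]
  rw [e2] at hmink
  rw [eLpNorm_eq_lintegral_rpow_enorm_toReal (by norm_num) (by norm_num)]
  simpa using hmink

end MatrixPaths

/-! ### Convergence of smooth tensor fields -/

section Paths

open Matrix

variable {n : ℕ} {M : Type*} [TopologicalSpace M] [ChartedSpace (EuclideanSpace ℝ (Fin n)) M]
  [IsManifold (𝓡 n) ∞ M] {𝒜 : AmenableAtlas n M}

lemma field_injective : Function.Injective (field : SymTensor n M → TensorField n M) :=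
  Subtype.val_injective

namespace CInfTendsto

variable {β β' : Type*} {f f' : β → SymTensor n M} {l : Filter β} {h : SymTensor n M}

lemma congr' (hf : CInfTendsto 𝒜 f l h) (e : f =ᶠ[l] f') : CInfTendsto 𝒜 f' l h := by
  intro a i j k u hu
  filter_upwards [hf a i j k u hu, e] with t ht et
  rwa [← et]

lemma comp (hf : CInfTendsto 𝒜 f l h) {φ : β' → β} {l' : Filter β'} (hφ : Tendsto φ l' l) :
    CInfTendsto 𝒜 (fun t => f (φ t)) l' h :=
  fun a i j k u hu => hφ.eventually (hf a i j k u hu)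

lemma neg (hf : CInfTendsto 𝒜 f l h) : CInfTendsto 𝒜 (fun t => -f t) l (-h) := by
  intro a i j k
  have e : ∀ (h : SymTensor n M) (y : EuclideanSpace ℝ (Fin n)), iteratedFDeriv ℝ k
      (fun z => coeff (𝒜.chart a) (field (-h)) z i j) y = -iteratedFDeriv ℝ k
      (fun z => coeff (𝒜.chart a) (field h) z i j) y := fun h y =>
    iteratedFDeriv_neg_apply (f := fun z => coeff (𝒜.chart a) (field h) z i j)
  have h0 := hf a i j k
  rw [Metric.tendstoUniformlyOn_iff] at h0 ⊢
  intro ε hε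
  filter_upwards [h0 ε hε] with t ht y hy
  rw [e, e, dist_neg_neg]
  exact ht y hy

lemma const (l : Filter β) (h : SymTensor n M) : CInfTendsto 𝒜 (fun _ => h) l h :=
  fun _ _ _ _ _ hu => Eventually.of_forall fun _ _ _ => refl_mem_uniformity hu

/-- Convergence in `𝒮` implies uniform convergence of the coefficients. -/
lemma eventually_coefM (hf : CInfTendsto 𝒜 f l h) {ε : ℝ} (hε : 0 < ε) :
    ∀ᶠ t in l, ∀ x i j, |coefM 𝒜 (field (f t)) x i j - coefM 𝒜 (field h) x i j| < ε := by
  have h1 : ∀ a i j, ∀ᶠ t in l, ∀ y ∈ (𝒜.chart a).target,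
      |coeff (𝒜.chart a) (field (f t)) y i j - coeff (𝒜.chart a) (field h) y i j| < ε := by
    intro a i j
    have h0 := Metric.tendstoUniformlyOn_iff.mp (hf a i j 0) ε hε
    filter_upwards [h0] with t ht y hy
    have := ht y hy
    rw [iteratedFDeriv_zero_eq_comp, iteratedFDeriv_zero_eq_comp, Function.comp, Function.comp,
      LinearIsometryEquiv.dist_map, dist_comm, Real.dist_eq] at this
    exact this
  have h2 : ∀ᶠ t in l, ∀ a i j, ∀ y ∈ (𝒜.chart a).target,
      |coeff (𝒜.chart a) (field (f t)) y i j - coeff (𝒜.chart a) (field h) y i j| < ε :=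
    eventually_all.mpr fun a => eventually_all.mpr fun i => eventually_all.mpr fun j => h1 a i j
  filter_upwards [h2] with t ht x i j
  exact ht _ i j _ ((𝒜.chart _).map_source (𝒜.mem_source_idx x))

end CInfTendsto

/-! ### Operations on paths -/

omit [IsManifold (𝓡 n) ∞ M] in
lemma l2Norm_neg [MeasurableSpace M] (g h : TensorField n M) :
    l2Norm 𝒜 g (-h) = l2Norm 𝒜 g h := by
  simp only [l2Norm]
  congr 2
  funext x
  have hm : ∀ h : BilinFibre n M x, gram (-h) = -gram h := fun _ => rfl
  have : (-h) x = -(h x) := rfl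
  rw [this, trPair, trPair, raise, raise, hm]
  simp only [Matrix.mul_neg, Matrix.neg_mul, neg_neg]

namespace PiecewiseC1Path

variable {g₀ g₁ g₂ : SymTensor n M}

lemma Icc_subset (γ : PiecewiseC1Path 𝒜 g₀ g₁) (i : Fin γ.N) :
    Icc (γ.time i.castSucc) (γ.time i.succ) ⊆ Icc (γ.time 0) (γ.time (Fin.last γ.N)) :=
  Icc_subset_Icc (γ.time_mono.monotone (Fin.zero_le _)) (γ.time_mono.monotone (Fin.le_last _))

lemma time_le (γ : PiecewiseC1Path 𝒜 g₀ g₁) (i : Fin γ.N) :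
    γ.time i.castSucc ≤ γ.time i.succ :=
  (γ.time_mono Fin.castSucc_lt_succ).le

/-- The constant path, with no pieces. -/
def constant {g : SymTensor n M} (hg : g ∈ riemMetrics n M) : PiecewiseC1Path 𝒜 g g where
  N := 0
  time := fun _ => 0
  time_mono := fun i j hij => by omega
  path := fun _ => g
  vel := fun i => i.elim0
  start := rfl
  finish := rfl
  mem := fun _ _ => hg
  deriv := fun i => i.elim0
  vel_cont := fun i => i.elim0

/-- The segment from `g₀` to `g₁`. -/
def segment (h : ∀ t ∈ Icc (0 : ℝ) 1, g₀ + t • (g₁ - g₀) ∈ riemMetrics n M) :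
    PiecewiseC1Path 𝒜 g₀ g₁ where
  N := 1
  time := ![0, 1]
  time_mono := by
    rw [Fin.strictMono_iff_lt_succ]
    intro i
    fin_cases i
    simp
  path := fun t => g₀ + t • (g₁ - g₀)
  vel := fun _ _ => g₁ - g₀
  start := by simp
  finish := by
    have : (![0, 1] : Fin (1 + 1) → ℝ) (Fin.last 1) = 1 := rfl
    rw [this, one_smul, add_sub_cancel]
  mem := fun t ht => h t ht
  deriv := fun i t _ => by
    refine (CInfTendsto.const _ _).congr' ?_
    filter_upwards [self_mem_nhdsWithin] with s hs
    have hst : s - t ≠ 0 := sub_ne_zero.mpr hs.2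
    have : g₀ + s • (g₁ - g₀) - (g₀ + t • (g₁ - g₀)) = (s - t) • (g₁ - g₀) := by
      rw [sub_smul]; abel
    rw [this, smul_smul, inv_mul_cancel₀ hst, one_smul]
  vel_cont := fun i t _ => CInfTendsto.const _ _

/-- The path run backwards. -/
def reverse (γ : PiecewiseC1Path 𝒜 g₀ g₁) : PiecewiseC1Path 𝒜 g₁ g₀ where
  N := γ.N
  time := fun i => -γ.time i.rev
  time_mono := fun i j hij => neg_lt_neg (γ.time_mono (Fin.rev_lt_rev.mpr hij))
  path := fun t => γ.path (-t)
  vel := fun i t => -γ.vel i.rev (-t)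
  start := by rw [neg_neg, Fin.rev_zero, γ.finish]
  finish := by rw [neg_neg, Fin.rev_last, γ.start]
  mem := fun t ht => by
    rw [Fin.rev_zero, Fin.rev_last] at ht
    exact γ.mem _ ⟨by linarith [ht.2], by linarith [ht.1]⟩
  deriv := fun i t ht => by
    rw [Fin.rev_castSucc, Fin.rev_succ] at ht ⊢
    have h1 := γ.deriv i.rev (-t) ⟨by linarith [ht.2], by linarith [ht.1]⟩
    have h2 : Tendsto (fun s : ℝ => -s)
        (𝓝[Icc (-γ.time i.rev.succ) (-γ.time i.rev.castSucc) \ {t}] t)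
        (𝓝[Icc (γ.time i.rev.castSucc) (γ.time i.rev.succ) \ {-t}] (-t)) :=
      continuous_neg.continuousWithinAt.tendsto_nhdsWithin fun s hs =>
        ⟨⟨by linarith [hs.1.2], by linarith [hs.1.1]⟩, fun e => hs.2 (neg_injective e)⟩
    refine ((h1.comp h2).neg).congr' (Eventually.of_forall fun s => ?_)
    change -((-s - -t)⁻¹ • _) = (s - t)⁻¹ • _
    rw [← neg_smul, ← inv_neg]
    congr 2
    ring
  vel_cont := fun i t ht => by
    rw [Fin.rev_castSucc, Fin.rev_succ] at ht ⊢
    have h1 := γ.vel_cont i.rev (-t) ⟨by linarith [ht.2], by linarith [ht.1]⟩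
    have h2 : Tendsto (fun s : ℝ => -s)
        (𝓝[Icc (-γ.time i.rev.succ) (-γ.time i.rev.castSucc)] t)
        (𝓝[Icc (γ.time i.rev.castSucc) (γ.time i.rev.succ)] (-t)) :=
      continuous_neg.continuousWithinAt.tendsto_nhdsWithin fun s hs =>
        ⟨by linarith [hs.2], by linarith [hs.1]⟩
    exact (h1.comp h2).neg

section Concatenation

variable (γ : PiecewiseC1Path 𝒜 g₀ g₁) (γ' : PiecewiseC1Path 𝒜 g₁ g₂)

/-- The time shift that lets `γ'` start when `γ` ends. -/
def shift : ℝ := γ.time (Fin.last γ.N) - γ'.time 0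

/-- The partition of the concatenation of two paths. -/
def concatTime (i : Fin (γ.N + γ'.N + 1)) : ℝ :=
  if h : (i : ℕ) ≤ γ.N then γ.time ⟨i, by omega⟩
  else γ'.time ⟨i - γ.N, by omega⟩ + γ.shift γ'

lemma concatTime_of_le {i : Fin (γ.N + γ'.N + 1)} (j : Fin (γ.N + 1)) (h : (i : ℕ) = j) :
    γ.concatTime γ' i = γ.time j := by
  have hj := j.2
  rw [concatTime, dif_pos (by omega)]
  congr 1
  exact Fin.ext h

lemma concatTime_of_ge {i : Fin (γ.N + γ'.N + 1)} (j : Fin (γ'.N + 1)) (h : (i : ℕ) = γ.N + j) :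
    γ.concatTime γ' i = γ'.time j + γ.shift γ' := by
  rcases eq_or_ne j 0 with rfl | hj
  · rw [γ.concatTime_of_le γ' (Fin.last γ.N) (by simpa using h), shift]
    ring
  · have hj' : (j : ℕ) ≠ 0 := fun e => hj (Fin.ext e)
    rw [concatTime, dif_neg (by omega)]
    congr 2
    exact Fin.ext (by simp only; omega)

/-- The path that runs through `γ` and then through `γ'`. -/
def concatPath (t : ℝ) : SymTensor n M :=
  if t ≤ γ.time (Fin.last γ.N) then γ.path t else γ'.path (t - γ.shift γ')

lemma concatPath_of_le {t : ℝ} (h : t ≤ γ.time (Fin.last γ.N)) :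
    γ.concatPath γ' t = γ.path t := if_pos h

lemma concatPath_of_ge {t : ℝ} (h : γ.time (Fin.last γ.N) ≤ t) :
    γ.concatPath γ' t = γ'.path (t - γ.shift γ') := by
  rcases h.eq_or_lt with rfl | h
  · rw [concatPath, if_pos le_rfl, γ.finish, shift, sub_sub_cancel, γ'.start]
  · exact if_neg (not_le.mpr h)

/-- The concatenation of two paths. -/
def concat : PiecewiseC1Path 𝒜 g₀ g₂ where
  N := γ.N + γ'.N
  time := γ.concatTime γ'
  time_mono := by
    rw [Fin.strictMono_iff_lt_succ]
    refine Fin.addCases (fun i => ?_) fun j => ?_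
    · rw [γ.concatTime_of_le γ' i.castSucc (by simp), γ.concatTime_of_le γ' i.succ (by simp)]
      exact γ.time_mono Fin.castSucc_lt_succ
    · rw [γ.concatTime_of_ge γ' j.castSucc (by simp),
        γ.concatTime_of_ge γ' j.succ (by simp [add_assoc])]
      linarith [γ'.time_mono (Fin.castSucc_lt_succ (i := j))]
  path := γ.concatPath γ'
  vel := Fin.addCases γ.vel fun j t => γ'.vel j (t - γ.shift γ')
  start := by
    rw [γ.concatTime_of_le γ' 0 (by simp),
      γ.concatPath_of_le γ' (γ.time_mono.monotone (Fin.zero_le _)), γ.start]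
  finish := by
    rw [γ.concatTime_of_ge γ' (Fin.last _) (by simp), γ.concatPath_of_ge γ', add_sub_cancel_right,
      γ'.finish]
    rw [shift]
    linarith [γ'.time_mono.monotone (Fin.zero_le (Fin.last γ'.N))]
  mem := fun t ht => by
    rw [γ.concatTime_of_le γ' 0 (by simp), γ.concatTime_of_ge γ' (Fin.last _) (by simp)] at ht
    rcases le_total t (γ.time (Fin.last γ.N)) with h | h
    · rw [γ.concatPath_of_le γ' h]
      exact γ.mem t ⟨ht.1, h⟩
    · rw [γ.concatPath_of_ge γ' h]
      refine γ'.mem _ ⟨?_, by linarith [ht.2]⟩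
      rw [shift]; linarith
  deriv := by
    refine Fin.addCases (fun i => ?_) fun j => ?_
    · rw [γ.concatTime_of_le γ' i.castSucc (by simp), γ.concatTime_of_le γ' i.succ (by simp)]
      intro t ht
      rw [Fin.addCases_left]
      refine (γ.deriv i t ht).congr' ?_
      filter_upwards [self_mem_nhdsWithin] with s hs
      rw [γ.concatPath_of_le γ' (γ.Icc_subset i hs.1).2,
        γ.concatPath_of_le γ' (γ.Icc_subset i ht).2]
    · rw [γ.concatTime_of_ge γ' j.castSucc (by simp),
        γ.concatTime_of_ge γ' j.succ (by simp [add_assoc])]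
      intro t ht
      have hge : ∀ s ∈ Icc (γ'.time j.castSucc + γ.shift γ') (γ'.time j.succ + γ.shift γ'),
          γ.time (Fin.last γ.N) ≤ s := fun s hs => by
        have := hs.1
        have h1 := γ'.time_mono.monotone (Fin.zero_le j.castSucc)
        rw [shift] at this
        linarith
      rw [Fin.addCases_right]
      have h1 := γ'.deriv j (t - γ.shift γ') ⟨by linarith [ht.1], by linarith [ht.2]⟩
      have h2 : Tendsto (fun s : ℝ => s - γ.shift γ')
          (𝓝[Icc (γ'.time j.castSucc + γ.shift γ') (γ'.time j.succ + γ.shift γ') \ {t}] t)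
          (𝓝[Icc (γ'.time j.castSucc) (γ'.time j.succ) \ {t - γ.shift γ'}] (t - γ.shift γ')) :=
        (continuous_sub_right _).continuousWithinAt.tendsto_nhdsWithin fun s hs =>
          ⟨⟨by linarith [hs.1.1], by linarith [hs.1.2]⟩, fun e => hs.2 (sub_left_injective e)⟩
      refine (h1.comp h2).congr' ?_
      filter_upwards [self_mem_nhdsWithin] with s hs
      rw [γ.concatPath_of_ge γ' (hge s hs.1), γ.concatPath_of_ge γ' (hge t ht),
        sub_sub_sub_cancel_right]
  vel_cont := by
    refine Fin.addCases (fun i => ?_) fun j => ?_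
    · rw [γ.concatTime_of_le γ' i.castSucc (by simp), γ.concatTime_of_le γ' i.succ (by simp)]
      intro t ht
      rw [Fin.addCases_left]
      exact γ.vel_cont i t ht
    · rw [γ.concatTime_of_ge γ' j.castSucc (by simp),
        γ.concatTime_of_ge γ' j.succ (by simp [add_assoc])]
      intro t ht
      rw [Fin.addCases_right]
      have h1 := γ'.vel_cont j (t - γ.shift γ') ⟨by linarith [ht.1], by linarith [ht.2]⟩
      refine h1.comp ?_
      exact (continuous_sub_right _).continuousWithinAt.tendsto_nhdsWithin fun s hs =>
          ⟨by linarith [hs.1], by linarith [hs.2]⟩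

end Concatenation

variable [MeasurableSpace M]

/-- The length of the `i`-th piece of a path. -/
def pieceLength (γ : PiecewiseC1Path 𝒜 g₀ g₁) (i : Fin γ.N) : ℝ :=
  ∫ t in (γ.time i.castSucc)..(γ.time i.succ), l2Norm 𝒜 (field (γ.path t)) (field (γ.vel i t))

lemma pieceLength_eq (γ : PiecewiseC1Path 𝒜 g₀ g₁) (i : Fin γ.N) {a b : ℝ}
    {p v : ℝ → SymTensor n M} (ha : γ.time i.castSucc = a) (hb : γ.time i.succ = b)
    (hp : ∀ t ∈ Icc a b, γ.path t = p t) (hv : ∀ t, γ.vel i t = v t) :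
    γ.pieceLength i = ∫ t in a..b, l2Norm 𝒜 (field (p t)) (field (v t)) := by
  have hab := γ.time_le i
  subst ha hb
  refine intervalIntegral.integral_congr fun t ht => ?_
  rw [uIcc_of_le hab] at ht
  rw [hp t ht, hv t]

lemma length_reverse (γ : PiecewiseC1Path 𝒜 g₀ g₁) : γ.reverse.length = γ.length := by
  have h : ∀ i : Fin γ.N, γ.reverse.pieceLength i = γ.pieceLength i.rev := fun i => by
    have h1 : γ.reverse.time i.castSucc = -γ.time i.rev.succ := by
      rw [← Fin.rev_castSucc]; rfl
    have h2 : γ.reverse.time i.succ = -γ.time i.rev.castSucc := by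
      rw [← Fin.rev_succ]; rfl
    have h3 := intervalIntegral.integral_comp_neg (a := -γ.time i.rev.succ)
      (b := -γ.time i.rev.castSucc)
      (fun t => l2Norm 𝒜 (field (γ.path t)) (field (γ.vel i.rev t)))
    rw [neg_neg, neg_neg] at h3
    rw [γ.reverse.pieceLength_eq i h1 h2 (p := fun t => γ.path (-t))
      (v := fun t => -γ.vel i.rev (-t)) (fun _ _ => rfl) fun _ => rfl, pieceLength, ← h3]
    exact intervalIntegral.integral_congr fun t _ =>
      l2Norm_neg (field (γ.path (-t))) (field (γ.vel i.rev (-t)))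
  calc γ.reverse.length = ∑ i : Fin γ.N, γ.reverse.pieceLength i := rfl
    _ = ∑ i : Fin γ.N, γ.pieceLength (Fin.revPerm i) := Finset.sum_congr rfl fun i _ => h i
    _ = ∑ i, γ.pieceLength i := Equiv.sum_comp Fin.revPerm _
    _ = γ.length := rfl

lemma length_concat (γ : PiecewiseC1Path 𝒜 g₀ g₁) (γ' : PiecewiseC1Path 𝒜 g₁ g₂) :
    (γ.concat γ').length = γ.length + γ'.length := by
  have hl : ∀ i : Fin γ.N, (γ.concat γ').pieceLength (Fin.castAdd γ'.N i) = γ.pieceLength i :=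
    fun i => (γ.concat γ').pieceLength_eq (Fin.castAdd γ'.N i)
      (γ.concatTime_of_le γ' i.castSucc rfl) (γ.concatTime_of_le γ' i.succ rfl)
      (fun t ht => γ.concatPath_of_le γ' (γ.Icc_subset i ht).2)
      fun t => congrFun (Fin.addCases_left (m := γ.N) (n := γ'.N)
        (motive := fun _ => ℝ → SymTensor n M) (left := γ.vel)
        (right := fun j t => γ'.vel j (t - γ.shift γ')) i) t
  have hr : ∀ j : Fin γ'.N, (γ.concat γ').pieceLength (Fin.natAdd γ.N j) = γ'.pieceLength j :=
    fun j => by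
    rw [(γ.concat γ').pieceLength_eq (Fin.natAdd γ.N j)
      (p := fun t => γ'.path (t - γ.shift γ')) (v := fun t => γ'.vel j (t - γ.shift γ'))
      (γ.concatTime_of_ge γ' j.castSucc rfl)
      (γ.concatTime_of_ge γ' j.succ rfl)
      (fun t ht => γ.concatPath_of_ge γ' ?_)
      fun t => congrFun (Fin.addCases_right (m := γ.N) (n := γ'.N)
        (motive := fun _ => ℝ → SymTensor n M) (left := γ.vel)
        (right := fun j t => γ'.vel j (t - γ.shift γ')) j) t,
      intervalIntegral.integral_comp_sub_right
        (fun t => l2Norm 𝒜 (field (γ'.path t)) (field (γ'.vel j t))), add_sub_cancel_right,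
      add_sub_cancel_right, pieceLength]
    have h0 := ht.1
    have h1 := γ'.time_mono.monotone (Fin.zero_le j.castSucc)
    rw [shift] at h0
    linarith
  calc (γ.concat γ').length
      = ∑ i : Fin (γ.N + γ'.N), (γ.concat γ').pieceLength i := rfl
    _ = ∑ i : Fin γ.N, (γ.concat γ').pieceLength (Fin.castAdd γ'.N i) +
        ∑ j : Fin γ'.N, (γ.concat γ').pieceLength (Fin.natAdd γ.N j) :=
        Fin.sum_univ_add fun i : Fin (γ.N + γ'.N) => (γ.concat γ').pieceLength i
    _ = ∑ i, γ.pieceLength i + ∑ j, γ'.pieceLength j := by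
        rw [Finset.sum_congr rfl fun i _ => hl i, Finset.sum_congr rfl fun j _ => hr j]
    _ = γ.length + γ'.length := rfl

lemma length_nonneg (γ : PiecewiseC1Path 𝒜 g₀ g₁) : 0 ≤ γ.length :=
  Finset.sum_nonneg fun i _ => intervalIntegral.integral_nonneg (γ.time_le i) fun _ _ =>
    Real.sqrt_nonneg _

end PiecewiseC1Path

end Paths

/-! ### Square integrable tensor fields -/

section L2

open Matrix

variable {n : ℕ} {M : Type*} [TopologicalSpace M] [ChartedSpace (EuclideanSpace ℝ (Fin n)) M]
  [MeasurableSpace M] (𝒜 : AmenableAtlas n M)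

/-- Symmetric tensor fields whose coefficients are square integrable for the reference measure. -/
structure SqInt (h : TensorField n M) : Prop where
  symm : ∀ (x : M) (u v : TangentSpace (𝓡 n) x), h x u v = h x v u
  memLp : ∀ i j, MemLp (fun x => coefM 𝒜 h x i j) 2 (refMeasure 𝒜)

variable {𝒜}

lemma SqInt.sub {h k : TensorField n M} (hh : SqInt 𝒜 h) (hk : SqInt 𝒜 k) : SqInt 𝒜 (h - k) where
  symm x u v := by
    change h x u v - k x u v = h x v u - k x v u
    rw [hh.symm, hk.symm]
  memLp i j := (hh.memLp i j).sub (hk.memLp i j)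

lemma SqInt.add {h k : TensorField n M} (hh : SqInt 𝒜 h) (hk : SqInt 𝒜 k) : SqInt 𝒜 (h + k) where
  symm x u v := by
    change h x u v + k x u v = h x v u + k x v u
    rw [hh.symm, hk.symm]
  memLp i j := (hh.memLp i j).add (hk.memLp i j)

lemma SqInt.smul {h : TensorField n M} (hh : SqInt 𝒜 h) (r : ℝ) : SqInt 𝒜 (r • h) where
  symm x u v := by
    change r * h x u v = r * h x v u
    rw [hh.symm]
  memLp i j := (hh.memLp i j).const_mul r

lemma SqInt.coefM_symm {h : TensorField n M} (hh : SqInt 𝒜 h) (x : M) :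
    (coefM 𝒜 h x)ᵀ = coefM 𝒜 h x := coefM_transpose 𝒜 hh.symm x

lemma SqInt.integrable_frobSq {h : TensorField n M} (hh : SqInt 𝒜 h) :
    Integrable (fun x => frobSq (coefM 𝒜 h x)) (refMeasure 𝒜) :=
  integrable_finsetSum _ fun i _ => integrable_finsetSum _ fun j _ =>
    (hh.memLp i j).integrable_sq

lemma eLpNorm_two_eq {X : Type*} [MeasurableSpace X] {μ : Measure X} {f : X → ℝ}
    (hf : MemLp f 2 μ) : eLpNorm f 2 μ = ENNReal.ofReal (√(∫ x, f x ^ 2 ∂μ)) := by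
  rw [hf.eLpNorm_eq_integral_rpow_norm (by norm_num) (by norm_num), Real.sqrt_eq_rpow]
  simp

lemma integral_quadratic_comb {X : Type*} [MeasurableSpace X] {μ : Measure X} {f₁ f₂ f₃ : X → ℝ}
    (i₁ : Integrable f₁ μ) (i₂ : Integrable f₂ μ) (i₃ : Integrable f₃ μ) (t : ℝ) :
    ∫ x, (f₁ x + t * (f₃ x - f₁ x - f₂ x) + t ^ 2 * f₂ x) ∂μ =
      ∫ x, f₁ x ∂μ + t * (∫ x, f₃ x ∂μ - ∫ x, f₁ x ∂μ - ∫ x, f₂ x ∂μ) + t ^ 2 * ∫ x, f₂ x ∂μ := by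
  have j₁ : Integrable (fun x => f₃ x - f₁ x) μ := i₃.sub i₁
  have j₂ : Integrable (fun x => f₃ x - f₁ x - f₂ x) μ := j₁.sub i₂
  have j₃ : Integrable (fun x => t * (f₃ x - f₁ x - f₂ x)) μ := j₂.const_mul t
  have j₄ : Integrable (fun x => f₁ x + t * (f₃ x - f₁ x - f₂ x)) μ := i₁.add j₃
  rw [integral_add j₄ (i₂.const_mul _), integral_add i₁ j₃, integral_const_mul, integral_const_mul,
    integral_sub j₁ i₂, integral_sub i₃ i₁]

lemma l2Norm_nonneg (g h : TensorField n M) : 0 ≤ l2Norm 𝒜 g h := Real.sqrt_nonneg _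

variable [BorelSpace M] [IsManifold (𝓡 n) ∞ M]

lemma sqInt_field (h : SymTensor n M) : SqInt 𝒜 (field h) where
  symm := field_symm h
  memLp i j := by
    obtain ⟨C, hC⟩ := exists_coefM_bound 𝒜 h
    exact MemLp.of_bound (measurable_coefM 𝒜 h i j).aestronglyMeasurable C
      (Eventually.of_forall fun x => hC x i j)

lemma aemeasurable_energyDensity (g : SymTensor n M) {h : TensorField n M}
    (hh : ∀ i j, AEMeasurable (fun x => coefM 𝒜 h x i j) (refMeasure 𝒜)) :
    AEMeasurable (fun x => energyDensity (coefM 𝒜 (field g) x) (coefM 𝒜 h x)) (refMeasure 𝒜) := by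
  have h1 : Measurable fun x => energyDensity (coefM 𝒜 (field g) x)
      (Matrix.of fun i j => (hh i j).mk _ x) :=
    measurable_energyDensity (measurable_coefM 𝒜 g) fun i j => (hh i j).measurable_mk
  refine ⟨_, h1, ?_⟩
  filter_upwards [ae_all_iff.mpr fun i => ae_all_iff.mpr fun j => (hh i j).ae_eq_mk] with x hx
  rw [show coefM 𝒜 h x = Matrix.of fun i j => (hh i j).mk _ x from Matrix.ext hx]

/-- Integrals against `μ_g` as integrals against the reference measure. -/
lemma integral_vol (g : SymTensor n M) (f : M → ℝ) :
    ∫ x, f x ∂(vol 𝒜 (field g)) = ∫ x, f x * √(coefM 𝒜 (field g) x).det ∂(refMeasure 𝒜) := by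
  rw [vol_eq_withDensity, integral_withDensity_eq_integral_toReal_smul (measurable_density 𝒜 g)
    (Eventually.of_forall fun x => ENNReal.ofReal_lt_top)]
  refine integral_congr_ae (Eventually.of_forall fun x => ?_)
  simp only [density, ENNReal.toReal_ofReal (Real.sqrt_nonneg _), smul_eq_mul]
  ring

lemma integrable_vol_iff (g : SymTensor n M) (f : M → ℝ) :
    Integrable f (vol 𝒜 (field g)) ↔
      Integrable (fun x => f x * √(coefM 𝒜 (field g) x).det) (refMeasure 𝒜) := by
  rw [vol_eq_withDensity, integrable_withDensity_iff (measurable_density 𝒜 g)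
    (Eventually.of_forall fun x => ENNReal.ofReal_lt_top)]
  simp only [density, ENNReal.toReal_ofReal (Real.sqrt_nonneg _)]

lemma l2Norm_eq (g : SymTensor n M) (h : TensorField n M) :
    l2Norm 𝒜 (field g) h =
      √(∫ x, energyDensity (coefM 𝒜 (field g) x) (coefM 𝒜 h x) ∂(refMeasure 𝒜)) := by
  rw [l2Norm, integral_vol]
  simp only [trPair_eq_coefM 𝒜, energyDensity]

lemma vol_absolutelyContinuous (g : SymTensor n M) : vol 𝒜 (field g) ≪ refMeasure 𝒜 := by
  rw [vol_eq_withDensity]; exact withDensity_absolutelyContinuous _ _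

lemma absolutelyContinuous_vol {g : SymTensor n M} (hg : g ∈ riemMetrics n M) :
    refMeasure 𝒜 ≪ vol 𝒜 (field g) := by
  rw [vol_eq_withDensity]
  refine withDensity_absolutelyContinuous' (measurable_density 𝒜 g).aemeasurable
    (Eventually.of_forall fun x => ?_)
  have h1 := ((coefM_posDef_iff 𝒜 (field_symm g x)).mpr (hg x)).det_pos
  simpa [density] using h1

section Metric

variable {g : SymTensor n M} (hg : g ∈ riemMetrics n M)
include hg

omit [MeasurableSpace M] [BorelSpace M] in
lemma coefM_posDef (x : M) : (coefM 𝒜 (field g) x).PosDef :=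
  (coefM_posDef_iff 𝒜 (field_symm g x)).mpr (hg x)

omit [BorelSpace M] in
lemma SqInt.energyDensity_nonneg {h : TensorField n M} (hh : SqInt 𝒜 h) (x : M) :
    0 ≤ energyDensity (coefM 𝒜 (field g) x) (coefM 𝒜 h x) :=
  MetricManifold.energyDensity_nonneg (coefM_posDef hg x) (hh.coefM_symm x)

lemma SqInt.integrable_energyDensity {h : TensorField n M} (hh : SqInt 𝒜 h) :
    Integrable (fun x => energyDensity (coefM 𝒜 (field g) x) (coefM 𝒜 h x)) (refMeasure 𝒜) := by
  obtain ⟨C, c, hc, hreg⟩ := exists_inRegion 𝒜 hg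
  obtain ⟨K, hK, hK'⟩ := exists_matPair_le n C hc
  refine (hh.integrable_frobSq.const_mul K).mono'
    (aemeasurable_energyDensity g fun i j =>
      (hh.memLp i j).aestronglyMeasurable.aemeasurable).aestronglyMeasurable
    (Eventually.of_forall fun x => ?_)
  rw [Real.norm_of_nonneg (hh.energyDensity_nonneg hg x)]
  exact hK' _ _ (hreg x)

/-- The coefficients of a tensor field are controlled by its `L²` norm. -/
lemma exists_eLpNorm_coefM_le (𝒜 : AmenableAtlas n M) :
    ∃ K > 0, ∀ h, SqInt 𝒜 h → ∀ i j,
      eLpNorm (fun x => coefM 𝒜 h x i j) 2 (refMeasure 𝒜) ≤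
        ENNReal.ofReal (K * l2Norm 𝒜 (field g) h) := by
  obtain ⟨C, c, hc, hreg⟩ := exists_inRegion 𝒜 hg
  obtain ⟨K, hK, hK'⟩ := exists_frobSq_le n C hc
  refine ⟨√K, Real.sqrt_pos.mpr hK, fun h hh i j => ?_⟩
  rw [eLpNorm_two_eq (hh.memLp i j), l2Norm_eq, ← Real.sqrt_mul hK.le, ← integral_const_mul]
  refine ENNReal.ofReal_le_ofReal (Real.sqrt_le_sqrt ?_)
  refine integral_mono (hh.memLp i j).integrable_sq
    ((hh.integrable_energyDensity hg).const_mul K) fun x => ?_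
  exact (sq_le_frobSq _ i j).trans (hK' _ _ (hreg x) (hh.coefM_symm x))

/-- The triangle inequality, from the sign of the discriminant of `t ↦ ‖h + t k‖²`. -/
lemma SqInt.l2Norm_add_le {h k : TensorField n M} (hh : SqInt 𝒜 h) (hk : SqInt 𝒜 k) :
    l2Norm 𝒜 (field g) (h + k) ≤ l2Norm 𝒜 (field g) h + l2Norm 𝒜 (field g) k := by
  let E : TensorField n M → ℝ := fun h =>
    ∫ x, energyDensity (coefM 𝒜 (field g) x) (coefM 𝒜 h x) ∂(refMeasure 𝒜)
  have hE0 : ∀ h, SqInt 𝒜 h → 0 ≤ E h := fun h hh => integral_nonneg (hh.energyDensity_nonneg hg)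
  have hpt : ∀ (t : ℝ) (A H K : Matrix (Fin n) (Fin n) ℝ),
      energyDensity A (H + t • K) = energyDensity A H +
        t * (energyDensity A (H + K) - energyDensity A H - energyDensity A K) +
        t ^ 2 * energyDensity A K := fun t A H K => by
    have hc : (A⁻¹ * K * (A⁻¹ * H)).trace = (A⁻¹ * H * (A⁻¹ * K)).trace := Matrix.trace_mul_comm _ _
    simp only [energyDensity, matPair, Matrix.mul_add, Matrix.add_mul, Matrix.trace_add,
      Matrix.mul_smul, Matrix.smul_mul, Matrix.trace_smul, smul_eq_mul, hc]
    ring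
  have hE : ∀ t : ℝ, E (h + t • k) = E h + t * (E (h + k) - E h - E k) + t ^ 2 * E k := fun t => by
    have i1 := hh.integrable_energyDensity hg
    have i2 := hk.integrable_energyDensity hg
    have i3 := (hh.add hk).integrable_energyDensity hg
    refine (integral_congr_ae (Eventually.of_forall fun x => hpt t _ _ _)).trans ?_
    exact integral_quadratic_comb i1 i2 i3 t
  have hd := discrim_le_zero (a := E k) (b := E (h + k) - E h - E k) (c := E h) fun t => by
    have := hE0 _ (hh.add (hk.smul t))
    rw [hE t] at this
    linarith
  rw [discrim] at hd
  have e0 := hE0 h hh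
  have e1 := hE0 k hk
  rw [l2Norm_eq, l2Norm_eq, l2Norm_eq]
  change √(E (h + k)) ≤ √(E h) + √(E k)
  rw [Real.sqrt_le_left (by positivity), add_sq, Real.sq_sqrt e0, Real.sq_sqrt e1, mul_assoc,
    ← Real.sqrt_mul e0]
  have h1 : (E (h + k) - E h - E k) / 2 ≤ √(E h * E k) := Real.le_sqrt_of_sq_le (by nlinarith)
  linarith

lemma SqInt.l2Norm_sub_le {h k m : TensorField n M} (hh : SqInt 𝒜 h) (hk : SqInt 𝒜 k)
    (hm : SqInt 𝒜 m) :
    l2Norm 𝒜 (field g) (h - m) ≤ l2Norm 𝒜 (field g) (h - k) + l2Norm 𝒜 (field g) (k - m) := by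
  have : h - m = (h - k) + (k - m) := by abel
  rw [this]
  exact (hh.sub hk).l2Norm_add_le hg (hk.sub hm)

lemma SqInt.ae_eq_zero {h : TensorField n M} (hh : SqInt 𝒜 h) (h0 : l2Norm 𝒜 (field g) h = 0) :
    ∀ᵐ x ∂(refMeasure 𝒜), coefM 𝒜 h x = 0 := by
  obtain ⟨K, -, hK'⟩ := exists_eLpNorm_coefM_le hg 𝒜
  have h1 : ∀ i j, ∀ᵐ x ∂(refMeasure 𝒜), coefM 𝒜 h x i j = 0 := fun i j => by
    have := hK' h hh i j
    rw [h0, mul_zero, ENNReal.ofReal_zero, nonpos_iff_eq_zero,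
      eLpNorm_eq_zero_iff (hh.memLp i j).aestronglyMeasurable (by norm_num)] at this
    exact this
  filter_upwards [ae_all_iff.mpr fun i => ae_all_iff.mpr fun j => h1 i j] with x hx
  ext i j
  exact hx i j

lemma SqInt.ae_eq_of_l2Norm_sub {h k : TensorField n M} (hh : SqInt 𝒜 h) (hk : SqInt 𝒜 k)
    (h0 : l2Norm 𝒜 (field g) (h - k) = 0) : ∀ᵐ x ∂(vol 𝒜 (field g)), h x = k x := by
  refine (vol_absolutelyContinuous g).ae_le ?_
  filter_upwards [(hh.sub hk).ae_eq_zero hg h0] with x hx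
  exact eq_of_coefM_eq 𝒜 (sub_eq_zero.mp hx)

/-- The `L²` norm separates smooth tensor fields. -/
lemma eq_of_l2Norm_sub_eq_zero {h k : SymTensor n M}
    (h0 : l2Norm 𝒜 (field g) (field (h - k)) = 0) : h = k := by
  have hae := SqInt.ae_eq_zero hg (sqInt_field (h - k)) h0
  refine sub_eq_zero.mp (field_injective (funext fun x => ?_))
  by_contra hne
  obtain ⟨a, ha⟩ := 𝒜.cover x
  have hc : coeff (𝒜.chart a) (field (h - k)) (𝒜.chart a x) ≠ 0 := fun e =>
    hne (eq_of_coeff_eq (𝒜.chart_mem a) ha (k := field 0) e)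
  obtain ⟨i, j, hij⟩ : ∃ i j, coeff (𝒜.chart a) (field (h - k)) (𝒜.chart a x) i j ≠ 0 := by
    by_contra! hall
    exact hc (Matrix.ext hall)
  -- the coefficient is nonzero on a nonempty open set, which has positive measure
  have hcont := continuousOn_pi.mp (continuousOn_pi.mp
    (continuousOn_coeff_comp_chart 𝒜 (h - k) a) i) j
  have hU := hcont.isOpen_inter_preimage (𝒜.chart a).open_source isOpen_compl_singleton (t := {0}ᶜ)
  refine (refMeasure_pos_of_isOpen 𝒜 hU ⟨x, ha, hij⟩).ne' ?_
  refine measure_mono_null (fun y hy => ?_) (ae_iff.mp hae)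
  rintro (hy0 : coefM 𝒜 (field (h - k)) y = 0)
  have h1 : field (h - k) y = field (0 : SymTensor n M) y := eq_of_coefM_eq 𝒜 hy0
  obtain ⟨P, -, hP⟩ := exists_coeff_eq_gram (𝒜.chart_mem a) hy.1
  have h2 : coeff (𝒜.chart a) (field (h - k)) (𝒜.chart a y) =
      coeff (𝒜.chart a) (field (0 : SymTensor n M)) (𝒜.chart a y) := by rw [hP, hP, h1]
  exact hy.2 (congrFun (congrFun h2 i) j)

lemma IsL2Tensor.sqInt {h : TensorField n M} (hh : IsL2Tensor 𝒜 (field g) h) : SqInt 𝒜 h := by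
  obtain ⟨C, c, hc, hreg⟩ := exists_inRegion 𝒜 hg
  obtain ⟨K, hK, hK'⟩ := exists_frobSq_le n C hc
  have hmeas : ∀ i j, AEMeasurable (fun x => coefM 𝒜 h x i j) (refMeasure 𝒜) := fun i j => by
    have hu : (⋃ a, 𝒜.piece a) = univ := eq_univ_of_forall fun x =>
      mem_iUnion.mpr (𝒜.exists_mem_piece x)
    rw [← Measure.restrict_univ (μ := refMeasure 𝒜), ← hu, aemeasurable_iUnion_iff]
    intro a
    have h1 := (hh.measurable a i j).mono_ac ((absolutelyContinuous_vol hg).restrict _)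
    have h2 := h1.mono_measure (Measure.restrict_mono (sdiff_subset :
      𝒜.piece a ⊆ (𝒜.chart a).source) le_rfl)
    refine h2.congr ?_
    filter_upwards [ae_restrict_mem (𝒜.measurableSet_piece a)] with x hx
    rw [coefM_eq 𝒜 hx]
  have hint : Integrable (fun x => energyDensity (coefM 𝒜 (field g) x) (coefM 𝒜 h x))
      (refMeasure 𝒜) := by
    have := (integrable_vol_iff g _).mp hh.integrable
    simpa only [trPair_eq_coefM 𝒜, energyDensity] using this
  refine ⟨hh.symm, fun i j => (memLp_two_iff_integrable_sq (hmeas i j).aestronglyMeasurable).mpr ?_⟩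
  refine (hint.const_mul K).mono' ((hmeas i j).pow_const 2).aestronglyMeasurable
    (Eventually.of_forall fun x => ?_)
  rw [Real.norm_of_nonneg (sq_nonneg _)]
  exact (sq_le_frobSq _ i j).trans (hK' _ _ (hreg x) (coefM_transpose 𝒜 hh.symm x))

lemma SqInt.integrable_trPair {h : TensorField n M} (hh : SqInt 𝒜 h) :
    Integrable (fun x => trPair (field g x) (h x) (h x)) (vol 𝒜 (field g)) := by
  rw [integrable_vol_iff]
  simpa only [trPair_eq_coefM 𝒜, energyDensity] using hh.integrable_energyDensity hg

end Metric

/-- The `L²` norm is controlled by the coefficients, uniformly for metrics in a bounded region. -/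
lemma exists_l2Norm_le (𝒜 : AmenableAtlas n M) (C : ℝ) {c : ℝ} (hc : 0 < c) :
    ∃ K > 0, ∀ g : SymTensor n M, (∀ x, InRegion C c (coefM 𝒜 (field g) x)) →
      ∀ h, SqInt 𝒜 h → ∀ R ≥ 0,
      (∀ i j, eLpNorm (fun x => coefM 𝒜 h x i j) 2 (refMeasure 𝒜) ≤ ENNReal.ofReal R) →
        l2Norm 𝒜 (field g) h ≤ K * R := by
  obtain ⟨K, hK, hK'⟩ := exists_matPair_le n C hc
  refine ⟨√K * (n + 1), by positivity, fun g hreg h hh R hR hle => ?_⟩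
  have hg : g ∈ riemMetrics n M := fun x =>
    (coefM_posDef_iff 𝒜 (field_symm g x)).mp (hreg x).posDef
  rw [l2Norm_eq, Real.sqrt_le_left (by positivity)]
  have h1 : ∀ i j, ∫ x, coefM 𝒜 h x i j ^ 2 ∂(refMeasure 𝒜) ≤ R ^ 2 := fun i j => by
    have := hle i j
    rw [eLpNorm_two_eq (hh.memLp i j), ENNReal.ofReal_le_ofReal_iff hR,
      Real.sqrt_le_left hR] at this
    exact this
  calc ∫ x, energyDensity (coefM 𝒜 (field g) x) (coefM 𝒜 h x) ∂(refMeasure 𝒜)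
      ≤ ∫ x, K * frobSq (coefM 𝒜 h x) ∂(refMeasure 𝒜) :=
        integral_mono (hh.integrable_energyDensity hg) (hh.integrable_frobSq.const_mul K)
          fun x => hK' _ _ (hreg x)
    _ = K * ∑ i, ∑ j, ∫ x, coefM 𝒜 h x i j ^ 2 ∂(refMeasure 𝒜) := by
        rw [integral_const_mul]
        congr 1
        unfold frobSq
        rw [integral_finsetSum _ fun i _ => integrable_finsetSum _ fun j _ =>
          (hh.memLp i j).integrable_sq]
        exact Finset.sum_congr rfl fun i _ => integral_finsetSum _ fun j _ =>
          (hh.memLp i j).integrable_sq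
    _ ≤ K * ∑ _i : Fin n, ∑ _j : Fin n, R ^ 2 :=
        mul_le_mul_of_nonneg_left (Finset.sum_le_sum fun i _ => Finset.sum_le_sum fun j _ =>
          h1 i j) hK.le
    _ = K * (n * n * R ^ 2) := by simp [mul_assoc]
    _ ≤ K * ((n + 1) ^ 2 * R ^ 2) := by gcongr; nlinarith [(Nat.cast_nonneg n : (0 : ℝ) ≤ n)]
    _ = (√K * (n + 1) * R) ^ 2 := by rw [mul_pow, mul_pow, Real.sq_sqrt hK.le]; ring

end L2

/-! ### The Riemannian distance of the `L²` metric -/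

section Distance

open Matrix

variable {n : ℕ} {M : Type*} [TopologicalSpace M] [ChartedSpace (EuclideanSpace ℝ (Fin n)) M]
  [IsManifold (𝓡 n) ∞ M] [MeasurableSpace M] {𝒜 : AmenableAtlas n M}

lemma bddBelow_range_length (g₀ g₁ : SymTensor n M) :
    BddBelow (range fun γ : PiecewiseC1Path 𝒜 g₀ g₁ => γ.length) :=
  ⟨0, by rintro _ ⟨γ, rfl⟩; exact γ.length_nonneg⟩

lemma riemDist_nonneg (g₀ g₁ : SymTensor n M) : 0 ≤ riemDist 𝒜 g₀ g₁ :=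
  Real.iInf_nonneg fun γ => γ.length_nonneg

lemma riemDist_le_length {g₀ g₁ : SymTensor n M} (γ : PiecewiseC1Path 𝒜 g₀ g₁) :
    riemDist 𝒜 g₀ g₁ ≤ γ.length :=
  ciInf_le (bddBelow_range_length g₀ g₁) γ

lemma riemDist_self {g : SymTensor n M} (hg : g ∈ riemMetrics n M) : riemDist 𝒜 g g = 0 :=
  le_antisymm ((riemDist_le_length (PiecewiseC1Path.constant hg)).trans_eq Finset.sum_empty)
    (riemDist_nonneg g g)

lemma riemDist_comm (g₀ g₁ : SymTensor n M) : riemDist 𝒜 g₀ g₁ = riemDist 𝒜 g₁ g₀ := by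
  have key : ∀ g₀ g₁ : SymTensor n M, Nonempty (PiecewiseC1Path 𝒜 g₀ g₁) →
      riemDist 𝒜 g₁ g₀ ≤ riemDist 𝒜 g₀ g₁ := fun g₀ g₁ _ =>
    le_ciInf fun γ => (riemDist_le_length γ.reverse).trans_eq γ.length_reverse
  rcases isEmpty_or_nonempty (PiecewiseC1Path 𝒜 g₀ g₁) with h | h
  · have h' : IsEmpty (PiecewiseC1Path 𝒜 g₁ g₀) := ⟨fun γ => h.false γ.reverse⟩
    -- without any path, both infima are over the empty set and hence `0`
    rw [riemDist, riemDist, Real.iInf_of_isEmpty, Real.iInf_of_isEmpty]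
  · obtain ⟨γ⟩ := h
    exact le_antisymm (key g₁ g₀ ⟨γ.reverse⟩) (key g₀ g₁ ⟨γ⟩)

lemma riemDist_triangle {g₀ g₁ g₂ : SymTensor n M} (h₁ : Nonempty (PiecewiseC1Path 𝒜 g₀ g₁))
    (h₂ : Nonempty (PiecewiseC1Path 𝒜 g₁ g₂)) :
    riemDist 𝒜 g₀ g₂ ≤ riemDist 𝒜 g₀ g₁ + riemDist 𝒜 g₁ g₂ :=
  le_ciInf_add_ciInf fun γ γ' => (riemDist_le_length (γ.concat γ')).trans_eq (γ.length_concat γ')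

section Amenable

variable {g : SymTensor n M} {𝒰 : Set (SymTensor n M)} (h𝒰 : IsAmenable 𝒜 g 𝒰)
include h𝒰

omit [MeasurableSpace M] in
lemma IsAmenable.segment_mem {g₀ g₁ : SymTensor n M} (h₀ : g₀ ∈ 𝒰) (h₁ : g₁ ∈ 𝒰) {t : ℝ}
    (ht : t ∈ Icc (0 : ℝ) 1) : g₀ + t • (g₁ - g₀) ∈ 𝒰 :=
  h𝒰.convex.add_smul_sub_mem h₀ h₁ ht

/-- The segment between two elements of an amenable set. -/
def IsAmenable.segment {g₀ g₁ : SymTensor n M} (h₀ : g₀ ∈ 𝒰) (h₁ : g₁ ∈ 𝒰) :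
    PiecewiseC1Path 𝒜 g₀ g₁ :=
  PiecewiseC1Path.segment fun _ ht => h𝒰.subset (h𝒰.segment_mem h₀ h₁ ht)

variable [BorelSpace M] (hg : g ∈ riemMetrics n M)
include hg

/-- On an amenable set, the distance is bounded by the `L²` norm: the norms `‖·‖_{g_t}` along the
segment are uniformly comparable to `‖·‖_g`. -/
lemma IsAmenable.exists_riemDist_le : ∃ K > 0, ∀ g₀ ∈ 𝒰, ∀ g₁ ∈ 𝒰,
    riemDist 𝒜 g₀ g₁ ≤ K * l2Norm 𝒜 (field g) (field (g₁ - g₀)) := by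
  obtain ⟨C, c, hc, hreg⟩ := h𝒰.exists_inRegion hg
  obtain ⟨K₁, hK₁, hK₁'⟩ := exists_eLpNorm_coefM_le hg 𝒜
  obtain ⟨K₂, hK₂, hK₂'⟩ := exists_l2Norm_le 𝒜 C hc
  refine ⟨K₂ * K₁, by positivity, fun g₀ h₀ g₁ h₁ => ?_⟩
  refine (riemDist_le_length (h𝒰.segment h₀ h₁)).trans ?_
  have hlen : (h𝒰.segment h₀ h₁).length = ∫ t in (0 : ℝ)..1,
      l2Norm 𝒜 (field (g₀ + t • (g₁ - g₀))) (field (g₁ - g₀)) :=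
    Fin.sum_univ_one fun i : Fin 1 => (h𝒰.segment h₀ h₁).pieceLength i
  rw [hlen]
  have hb : ∀ t ∈ uIoc (0 : ℝ) 1, ‖l2Norm 𝒜 (field (g₀ + t • (g₁ - g₀))) (field (g₁ - g₀))‖ ≤
      K₂ * K₁ * l2Norm 𝒜 (field g) (field (g₁ - g₀)) := fun t ht => by
    rw [uIoc_of_le zero_le_one] at ht
    have hmem := h𝒰.segment_mem h₀ h₁ (Ioc_subset_Icc_self ht)
    rw [Real.norm_of_nonneg (l2Norm_nonneg _ _), mul_assoc]
    exact hK₂' _ (hreg _ hmem) _ (sqInt_field _) _ (mul_nonneg hK₁.le (l2Norm_nonneg _ _))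
      (hK₁' _ (sqInt_field _))
  have := intervalIntegral.norm_integral_le_of_norm_le_const hb
  simpa using (le_abs_self _).trans this

end Amenable

section Lower

variable [BorelSpace M] {g₀ g₁ : SymTensor n M}

/-- Each piece of a `C¹` path of metrics gives a `C¹` path of coefficient matrices. -/
lemma PiecewiseC1Path.isC1MatrixPath (γ : PiecewiseC1Path 𝒜 g₀ g₁) (i : Fin γ.N) :
    IsC1MatrixPath (γ.time i.castSucc) (γ.time i.succ) (fun t => coefM 𝒜 (field (γ.path t)))
      (fun t => coefM 𝒜 (field (γ.vel i t))) := by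
  have hmem : ∀ t ∈ Icc (γ.time i.castSucc) (γ.time i.succ), γ.path t ∈ riemMetrics n M :=
    fun t ht => γ.mem t (γ.Icc_subset i ht)
  have hslope : ∀ (s t : ℝ) x j k, coefM 𝒜 (field ((s - t)⁻¹ • (γ.path s - γ.path t))) x j k =
      (s - t)⁻¹ * (coefM 𝒜 (field (γ.path s)) x j k - coefM 𝒜 (field (γ.path t)) x j k) :=
    fun _ _ _ _ _ => rfl
  refine ⟨γ.time_le i, fun t ht x j k => ?_, fun t ht ε hε => ?_,
    fun t ht ε hε => (γ.vel_cont i t ht).eventually_coefM hε,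
    fun t ht => exists_inRegion 𝒜 (hmem t ht), fun t ht x => coefM_posDef (hmem t ht) x,
    fun t _ => exists_coefM_bound 𝒜 _, fun t _ x => coefM_transpose 𝒜 (field_symm _) x,
    fun t => measurable_coefM 𝒜 _, fun t => measurable_coefM 𝒜 _⟩
  · rw [hasDerivWithinAt_iff_tendsto_slope]
    refine Metric.tendsto_nhds.mpr fun ε hε => ?_
    filter_upwards [(γ.deriv i t ht).eventually_coefM hε] with s hs
    have := hs x j k
    rw [hslope] at this
    rw [slope_def_field, div_eq_inv_mul]
    exact this
  · -- the difference quotients are uniformly bounded near `t`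
    obtain ⟨C, hC⟩ := exists_coefM_bound 𝒜 (γ.vel i t)
    have h1 := (γ.deriv i t ht).eventually_coefM one_pos
    rw [eventually_nhdsWithin_iff] at h1 ⊢
    have hδ : 0 < ε / (|C| + 1) := by positivity
    filter_upwards [h1, Metric.ball_mem_nhds t hδ] with s hs hst hsI x j k
    rcases eq_or_ne s t with rfl | hne
    · simpa using hε
    · have h2 := hs ⟨hsI, hne⟩ x j k
      rw [hslope] at h2
      have h3 := hC x j k
      have hst0 : s - t ≠ 0 := sub_ne_zero.mpr hne
      set q := (s - t)⁻¹ *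
        (coefM 𝒜 (field (γ.path s)) x j k - coefM 𝒜 (field (γ.path t)) x j k) with hq
      have h4 : coefM 𝒜 (field (γ.path s)) x j k - coefM 𝒜 (field (γ.path t)) x j k =
          (s - t) * q := by rw [hq, mul_inv_cancel_left₀ hst0]
      have h5 : |q| ≤ |C| + 1 := by
        have := abs_sub_abs_le_abs_sub q (coefM 𝒜 (field (γ.vel i t)) x j k)
        linarith [le_abs_self C]
      rw [h4, abs_mul]
      rw [Metric.mem_ball, Real.dist_eq, lt_div_iff₀ (by positivity)] at hst
      exact (mul_le_mul_of_nonneg_left h5 (abs_nonneg _)).trans_lt hst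

/-- The function `rootFun v` of the coefficient matrix of a tensor field. -/
def rootField (𝒜 : AmenableAtlas n M) (v : Fin n → ℝ) (h : SymTensor n M) (x : M) : ℝ :=
  rootFun v (coefM 𝒜 (field h) x)

lemma measurable_rootField (v : Fin n → ℝ) (h : SymTensor n M) :
    Measurable (rootField 𝒜 v h) :=
  ((measurable_det_coefM 𝒜 h).pow_const _).div
    (measurable_const.add (measurable_comp_of_entries (continuous_quadForm v)
      (measurable_coefM 𝒜 h)))

lemma eLpNorm_telescope {X : Type*} [MeasurableSpace X] {μ : Measure X} {N : ℕ}
    (f : Fin (N + 1) → X → ℝ) (hf : ∀ i, Measurable (f i)) (b : Fin N → ℝ) (hb : ∀ i, 0 ≤ b i)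
    (h : ∀ i : Fin N, eLpNorm (f i.succ - f i.castSucc) 2 μ ≤ ENNReal.ofReal (b i)) :
    eLpNorm (f (Fin.last N) - f 0) 2 μ ≤ ENNReal.ofReal (∑ i, b i) := by
  induction N with
  | zero => simp
  | succ N ih =>
    have h1 := ih (fun i => f i.castSucc) (fun i => hf _) (fun i => b i.castSucc) (fun i => hb _)
      fun i => h i.castSucc
    have h2 : f (Fin.last (N + 1)) - f 0 = (f (Fin.last N).succ - f (Fin.last N).castSucc) +
        (f (Fin.last N).castSucc - f (Fin.castSucc 0)) := by
      rw [sub_add_sub_cancel]; rfl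
    rw [h2, Fin.sum_univ_castSucc, add_comm (∑ i : Fin N, _),
      ENNReal.ofReal_add (hb _) (Finset.sum_nonneg fun i _ => hb _)]
    refine (eLpNorm_add_le ((hf _).sub (hf _)).aestronglyMeasurable
      ((hf _).sub (hf _)).aestronglyMeasurable (by norm_num)).trans (add_le_add (h _) h1)

/-- `rootField v` is Lipschitz from the distance function `d` to the `L²` norm. -/
lemma eLpNorm_rootField_sub_le_length (γ : PiecewiseC1Path 𝒜 g₀ g₁) (v : Fin n → ℝ) :
    eLpNorm (rootField 𝒜 v g₁ - rootField 𝒜 v g₀) 2 (refMeasure 𝒜) ≤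
      ENNReal.ofReal ((n + 1) * γ.length) := by
  have h := eLpNorm_telescope (μ := refMeasure 𝒜)
    (fun i => rootField 𝒜 v (γ.path (γ.time i)))
    (fun i => measurable_rootField v _) (fun i => (n + 1) * γ.pieceLength i)
    (fun i => mul_nonneg (by positivity) (intervalIntegral.integral_nonneg (γ.time_le i)
      fun _ _ => l2Norm_nonneg _ _)) fun i => by
        have := (γ.isC1MatrixPath i).eLpNorm_rootFun_sub_le (refMeasure 𝒜) v
          fun t _ => measurable_rootField v _
        simp only [← l2Norm_eq] at this
        exact this
  rw [← Finset.mul_sum, γ.start, γ.finish] at h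
  exact h

lemma eLpNorm_rootField_sub_le (h : Nonempty (PiecewiseC1Path 𝒜 g₀ g₁)) (v : Fin n → ℝ) :
    eLpNorm (rootField 𝒜 v g₁ - rootField 𝒜 v g₀) 2 (refMeasure 𝒜) ≤
      ENNReal.ofReal ((n + 1) * riemDist 𝒜 g₀ g₁) := by
  obtain ⟨γ₀⟩ := id h
  have hfin : eLpNorm (rootField 𝒜 v g₁ - rootField 𝒜 v g₀) 2 (refMeasure 𝒜) ≠ ⊤ :=
    ((eLpNorm_rootField_sub_le_length γ₀ v).trans_lt ENNReal.ofReal_lt_top).ne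
  have hn : (0 : ℝ) < n + 1 := by positivity
  rw [← ENNReal.ofReal_toReal hfin]
  refine ENNReal.ofReal_le_ofReal ?_
  rw [← div_le_iff₀' hn]
  refine le_ciInf fun γ => ?_
  rw [div_le_iff₀' hn]
  exact ENNReal.toReal_le_of_le_ofReal (mul_nonneg hn.le γ.length_nonneg)
    (eLpNorm_rootField_sub_le_length γ v)

/-- On an amenable set, the `L²` norm is bounded by the distance. -/
lemma IsAmenable.exists_l2Norm_le {g : SymTensor n M} {𝒰 : Set (SymTensor n M)}
    (h𝒰 : IsAmenable 𝒜 g 𝒰) (hg : g ∈ riemMetrics n M) : ∃ K > 0, ∀ g₀ ∈ 𝒰, ∀ g₁ ∈ 𝒰,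
    l2Norm 𝒜 (field g) (field (g₁ - g₀)) ≤ K * riemDist 𝒜 g₀ g₁ := by
  obtain ⟨C, c, hc, hreg⟩ := h𝒰.exists_inRegion hg
  obtain ⟨C', c', hc', hreg'⟩ := MetricManifold.exists_inRegion 𝒜 hg
  obtain ⟨K₁, hK₁, hK₁'⟩ := exists_entry_sub_le n C hc
  obtain ⟨K₂, hK₂, hK₂'⟩ := MetricManifold.exists_l2Norm_le 𝒜 C' hc'
  refine ⟨K₂ * (K₁ * (4 * (n + 1))), by positivity, fun g₀ h₀ g₁ h₁ => ?_⟩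
  have hd := riemDist_nonneg (𝒜 := 𝒜) g₀ g₁
  rw [mul_assoc]
  refine hK₂' g hreg' _ (sqInt_field _) _ (by positivity) fun i j => ?_
  have hF : ∀ v, eLpNorm (fun x => |rootField 𝒜 v g₁ x - rootField 𝒜 v g₀ x|) 2 (refMeasure 𝒜) ≤
      ENNReal.ofReal ((n + 1) * riemDist 𝒜 g₀ g₁) := fun v => by
    refine le_of_eq_of_le ?_ (eLpNorm_rootField_sub_le ⟨h𝒰.segment h₀ h₁⟩ v)
    exact eLpNorm_norm (rootField 𝒜 v g₁ - rootField 𝒜 v g₀)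
  have hm : ∀ v, AEStronglyMeasurable
      (fun x => |rootField 𝒜 v g₁ x - rootField 𝒜 v g₀ x|) (refMeasure 𝒜) := fun v =>
    (((measurable_rootField v g₁).sub (measurable_rootField v g₀)).abs).aestronglyMeasurable
  calc eLpNorm (fun x => coefM 𝒜 (field (g₁ - g₀)) x i j) 2 (refMeasure 𝒜)
      ≤ eLpNorm (fun x => K₁ * ∑ l, |rootField 𝒜 (testVec i j l) g₁ x -
          rootField 𝒜 (testVec i j l) g₀ x|) 2 (refMeasure 𝒜) :=
        eLpNorm_mono_real fun x => hK₁' _ _ (hreg g₁ h₁ x) (hreg g₀ h₀ x) i j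
    _ = ENNReal.ofReal K₁ * eLpNorm (fun x => ∑ l, |rootField 𝒜 (testVec i j l) g₁ x -
          rootField 𝒜 (testVec i j l) g₀ x|) 2 (refMeasure 𝒜) := by
        rw [← Real.enorm_of_nonneg hK₁.le]
        exact eLpNorm_const_smul K₁ _ 2 _
    _ ≤ ENNReal.ofReal K₁ * ∑ _l : Fin 4, ENNReal.ofReal ((n + 1) * riemDist 𝒜 g₀ g₁) := by
        gcongr
        have e : (fun x => ∑ l, |rootField 𝒜 (testVec i j l) g₁ x -
            rootField 𝒜 (testVec i j l) g₀ x|) = ∑ l, fun x =>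
            |rootField 𝒜 (testVec i j l) g₁ x - rootField 𝒜 (testVec i j l) g₀ x| := by
          funext x; simp
        rw [e]
        refine (eLpNorm_sum_le (fun l _ => hm _) (by norm_num)).trans ?_
        exact Finset.sum_le_sum fun l _ => hF _
    _ = ENNReal.ofReal (K₁ * (4 * (n + 1)) * riemDist 𝒜 g₀ g₁) := by
        rw [Finset.sum_const, Finset.card_univ, Fintype.card_fin, nsmul_eq_mul, mul_assoc K₁,
          ENNReal.ofReal_mul hK₁.le, mul_assoc (4 : ℝ), ENNReal.ofReal_mul (by norm_num : (0:ℝ) ≤ 4)]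
        norm_num

end Lower

end Distance

/-! ### Completeness of `𝒰⁰` -/

section Completeness

open Matrix

variable {n : ℕ} {M : Type*} [TopologicalSpace M] [ChartedSpace (EuclideanSpace ℝ (Fin n)) M]

/-- A limit of Gram matrices is a Gram matrix: the Gram matrices form a subspace of a finite
dimensional space, hence a closed set. -/
lemma exists_gram_eq_of_tendsto {x : M} {b : ℕ → BilinFibre n M x}
    {L : Matrix (Fin n) (Fin n) ℝ} (h : Tendsto (fun k => gram (b k)) atTop (𝓝 L)) :
    ∃ c : BilinFibre n M x, gram c = L := by
  let f : BilinFibre n M x →ₗ[ℝ] Matrix (Fin n) (Fin n) ℝ :=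
    { toFun := gram
      map_add' := fun _ _ => rfl
      map_smul' := fun _ _ => rfl }
  have : FiniteDimensional ℝ (LinearMap.range f) := FiniteDimensional.finiteDimensional_submodule _
  have hc : IsClosed (LinearMap.range f : Set (Matrix (Fin n) (Fin n) ℝ)) :=
    Submodule.closed_of_finiteDimensional _
  obtain ⟨c, hc⟩ := hc.mem_of_tendsto h (Eventually.of_forall fun k => ⟨b k, rfl⟩)
  exact ⟨c, hc⟩

lemma apply_symm_of_gram_transpose_eq {x : M} {b : BilinFibre n M x} (hb : (gram b)ᵀ = gram b) :
    ∀ u v, b u v = b v u := fun u v => by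
  rw [bilin_apply_eq_gram b u v, bilin_apply_eq_gram b v u, Matrix.dotProduct_mulVec,
    ← Matrix.mulVec_transpose, hb, dotProduct_comm]

lemma exists_tendsto_gram_of_tendsto_coeff {φ : OpenPartialHomeomorph M (EuclideanSpace ℝ (Fin n))}
    (hφ : φ ∈ IsManifold.maximalAtlas (𝓡 n) ∞ M) {x : M} (hx : x ∈ φ.source)
    (u : ℕ → TensorField n M) (L : Matrix (Fin n) (Fin n) ℝ) :
    Tendsto (fun k => coeff φ (u k) (φ x)) atTop (𝓝 L) →
      ∃ G, Tendsto (fun k => gram (u k x)) atTop (𝓝 G) := by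
  obtain ⟨P, hP, e⟩ := exists_coeff_eq_gram hφ hx
  have hPt : IsUnit Pᵀ.det := by rwa [Matrix.det_transpose]
  intro h
  refine ⟨(Pᵀ)⁻¹ * L * P⁻¹, ?_⟩
  have e' : ∀ k, gram (u k x) = (Pᵀ)⁻¹ * coeff φ (u k) (φ x) * P⁻¹ := fun k => by
    rw [e, Matrix.mul_assoc, Matrix.mul_assoc, Matrix.mul_assoc, Matrix.mul_nonsing_inv _ hP,
      Matrix.mul_one, ← Matrix.mul_assoc, Matrix.nonsing_inv_mul _ hPt, Matrix.one_mul]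
  simp only [e']
  exact (tendsto_const_nhds.mul h).mul tendsto_const_nhds

lemma tendsto_coeff_of_tendsto_gram {φ : OpenPartialHomeomorph M (EuclideanSpace ℝ (Fin n))}
    (hφ : φ ∈ IsManifold.maximalAtlas (𝓡 n) ∞ M) {x : M} (hx : x ∈ φ.source)
    {u : ℕ → TensorField n M} {h : TensorField n M}
    (hu : Tendsto (fun k => gram (u k x)) atTop (𝓝 (gram (h x)))) :
    Tendsto (fun k => coeff φ (u k) (φ x)) atTop (𝓝 (coeff φ h (φ x))) := by
  obtain ⟨P, hP, e⟩ := exists_coeff_eq_gram hφ hx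
  simp only [e]
  exact (tendsto_const_nhds.mul hu).mul tendsto_const_nhds

open Classical in
/-- The pointwise limit of a sequence of tensor fields, and `0` where it does not exist. -/
def limField (u : ℕ → TensorField n M) : TensorField n M := fun x =>
  if h : ∃ b : BilinFibre n M x, Tendsto (fun k => gram (u k x)) atTop (𝓝 (gram b))
  then h.choose else 0

lemma limField_symm {u : ℕ → TensorField n M}
    (hu : ∀ k (x : M) (v w : TangentSpace (𝓡 n) x), u k x v w = u k x w v) (x : M)
    (v w : TangentSpace (𝓡 n) x) : limField u x v w = limField u x w v := by
  by_cases h : ∃ b : BilinFibre n M x, Tendsto (fun k => gram (u k x)) atTop (𝓝 (gram b))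
  · have e : limField u x = h.choose := dif_pos h
    rw [e]
    refine apply_symm_of_gram_transpose_eq (tendsto_nhds_unique ?_ h.choose_spec) v w
    have h1 : Tendsto (fun k => (gram (u k x))ᵀ) atTop (𝓝 (gram h.choose)ᵀ) :=
      (continuous_id.matrix_transpose.tendsto _).comp h.choose_spec
    exact h1.congr fun k => gram_transpose (hu k x)
  · have e : limField u x = 0 := dif_neg h
    rw [e]; rfl

lemma tendsto_gram_limField {u : ℕ → TensorField n M} {x : M} {L : Matrix (Fin n) (Fin n) ℝ}
    (h : Tendsto (fun k => gram (u k x)) atTop (𝓝 L)) :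
    Tendsto (fun k => gram (u k x)) atTop (𝓝 (gram (limField u x))) := by
  obtain ⟨c, hc⟩ := exists_gram_eq_of_tendsto h
  have hex : ∃ b : BilinFibre n M x, Tendsto (fun k => gram (u k x)) atTop (𝓝 (gram b)) :=
    ⟨c, hc ▸ h⟩
  have e : limField u x = hex.choose := dif_pos hex
  rw [e]
  exact hex.choose_spec

variable [IsManifold (𝓡 n) ∞ M] [MeasurableSpace M] [BorelSpace M] {𝒜 : AmenableAtlas n M}
  {g : SymTensor n M} {𝒰 : Set (SymTensor n M)}

omit [BorelSpace M] in
lemma l2Norm_zero : l2Norm 𝒜 (field g) 0 = 0 := by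
  have h : ∀ x, trPair (field g x) (0 : BilinFibre n M x) 0 = 0 := fun x => by
    have h0 : gram (0 : BilinFibre n M x) = 0 := rfl
    rw [trPair, raise, h0, Matrix.mul_zero, Matrix.mul_zero, Matrix.trace_zero]
  change √(∫ x, trPair (field g x) (0 : BilinFibre n M x) 0 ∂_) = 0
  simp only [h, integral_zero, Real.sqrt_zero]

/-- A sequence in an amenable set that is Cauchy at a geometric rate converges in `L²` to an
element of `𝒰⁰`. The determinant bound on `𝒰` keeps the limit positive definite. -/
lemma IsAmenable.exists_l2_limit (h𝒰 : IsAmenable 𝒜 g 𝒰) (hg : g ∈ riemMetrics n M)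
    {v : ℕ → SymTensor n M} (hv : ∀ k, v k ∈ 𝒰)
    (hc : ∀ N k l : ℕ, N ≤ k → N ≤ l →
      l2Norm 𝒜 (field g) (field (v k - v l)) < 3 * (1 / 2) ^ N) :
    ∃ p ∈ l2Closure 𝒜 (field g) 𝒰, L2Tendsto 𝒜 (field g) v p := by
  obtain ⟨C, c, hc0, hreg⟩ := h𝒰.exists_inRegion hg
  obtain ⟨C', c', hc', hreg'⟩ := MetricManifold.exists_inRegion 𝒜 hg
  obtain ⟨K, hK, hK'⟩ := exists_eLpNorm_coefM_le hg 𝒜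
  obtain ⟨K₂, hK₂, hK₂'⟩ := MetricManifold.exists_l2Norm_le 𝒜 C' hc'
  set B : ℕ → ENNReal := fun N => ENNReal.ofReal (K * (3 * (1 / 2) ^ N)) with hB
  have hBsum : ∑' N, B N ≠ ⊤ := by
    have hs : Summable fun N : ℕ => K * (3 * (1 / 2 : ℝ) ^ N) :=
      (summable_geometric_two.mul_left 3).mul_left K
    exact hs.tsum_ofReal_ne_top
  let f : Fin n → Fin n → ℕ → M → ℝ := fun i j k x => coefM 𝒜 (field (v k)) x i j
  have hfm : ∀ i j k, AEStronglyMeasurable (f i j k) (refMeasure 𝒜) := fun i j k =>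
    (measurable_coefM 𝒜 (v k) i j).aestronglyMeasurable
  have hfc : ∀ i j, ∀ N k l : ℕ, N ≤ k → N ≤ l →
      eLpNorm (f i j k - f i j l) 2 (refMeasure 𝒜) < B N := fun i j N k l hk hl => by
    refine (hK' _ (sqInt_field (v k - v l)) i j).trans_lt ?_
    exact (ENNReal.ofReal_lt_ofReal_iff (by positivity)).mpr
      (mul_lt_mul_of_pos_left (hc N k l hk hl) hK)
  -- the coefficients converge almost everywhere, hence so do the tensors themselves
  have hae : ∀ᵐ x ∂(refMeasure 𝒜), ∃ G, Tendsto (fun k => gram (field (v k) x)) atTop (𝓝 G) := by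
    have h1 : ∀ i j, ∀ᵐ x ∂(refMeasure 𝒜), ∃ l, Tendsto (fun k => f i j k x) atTop (𝓝 l) :=
      fun i j => Lp.ae_tendsto_of_cauchy_eLpNorm (hfm i j) (by norm_num) hBsum (hfc i j)
    filter_upwards [ae_all_iff.mpr fun i => ae_all_iff.mpr fun j => h1 i j] with x hx
    choose L hL using hx
    refine exists_tendsto_gram_of_tendsto_coeff (𝒜.chart_mem _) (𝒜.mem_source_idx x) (fun k => field (v k))
      (Matrix.of L) ?_
    exact tendsto_pi_nhds.mpr fun i => tendsto_pi_nhds.mpr fun j => hL i j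
  set h : TensorField n M := limField fun k => field (v k) with hh
  have hlim : ∀ᵐ x ∂(refMeasure 𝒜),
      Tendsto (fun k => gram (field (v k) x)) atTop (𝓝 (gram (h x))) := by
    filter_upwards [hae] with x hx
    obtain ⟨G, hG⟩ := hx
    exact tendsto_gram_limField hG
  have hsymm : ∀ (x : M) (u w : TangentSpace (𝓡 n) x), h x u w = h x w u :=
    limField_symm fun k => field_symm (v k)
  have hcoef : ∀ᵐ x ∂(refMeasure 𝒜),
      Tendsto (fun k => coefM 𝒜 (field (v k)) x) atTop (𝓝 (coefM 𝒜 h x)) := by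
    filter_upwards [hlim] with x hx
    exact tendsto_coeff_of_tendsto_gram (𝒜.chart_mem _) (𝒜.mem_source_idx x)
      (u := fun k => field (v k)) hx
  have hcoef' : ∀ i j, ∀ᵐ x ∂(refMeasure 𝒜),
      Tendsto (fun k => f i j k x) atTop (𝓝 (coefM 𝒜 h x i j)) := fun i j => by
    filter_upwards [hcoef] with x hx
    exact tendsto_pi_nhds.mp (tendsto_pi_nhds.mp hx i) j
  have hconv : ∀ i j, Tendsto (fun k => eLpNorm (f i j k - fun x => coefM 𝒜 h x i j) 2
      (refMeasure 𝒜)) atTop (𝓝 0) := fun i j =>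
    Lp.cauchy_tendsto_of_tendsto (hfm i j) _ hBsum (hfc i j) (hcoef' i j)
  have hmeas : ∀ i j, AEStronglyMeasurable (fun x => coefM 𝒜 h x i j) (refMeasure 𝒜) :=
    fun i j => aestronglyMeasurable_of_tendsto_ae atTop (hfm i j) (hcoef' i j)
  have hsq : SqInt 𝒜 h := by
    refine ⟨hsymm, fun i j => ?_⟩
    obtain ⟨k, hk⟩ := ((hconv i j).eventually (gt_mem_nhds (zero_lt_one))).exists
    have h1 : MemLp (f i j k - fun x => coefM 𝒜 h x i j) 2 (refMeasure 𝒜) :=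
      ⟨(hfm i j k).sub (hmeas i j), hk.trans ENNReal.one_lt_top⟩
    have h2 := ((sqInt_field (𝒜 := 𝒜) (v k)).memLp i j).sub h1
    refine h2.ae_eq (Eventually.of_forall fun x => ?_)
    simp [f]
  have hL2 : IsL2Tensor 𝒜 (field g) h := by
    refine ⟨hsymm, fun a i j => ?_, hsq.integrable_trPair hg⟩
    refine aemeasurable_of_tendsto_metrizable_ae atTop
      (f := fun k x => coeff (𝒜.chart a) (field (v k)) (𝒜.chart a x) i j) (fun k => ?_) ?_
    · exact (continuousOn_pi.mp (continuousOn_pi.mp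
        (continuousOn_coeff_comp_chart 𝒜 (v k) a) i) j).aemeasurable
        (𝒜.chart a).open_source.measurableSet
    · filter_upwards [ae_restrict_mem (𝒜.chart a).open_source.measurableSet,
        ae_restrict_of_ae ((vol_absolutelyContinuous g).ae_le hlim)] with x hx hx'
      exact tendsto_pi_nhds.mp (tendsto_pi_nhds.mp (tendsto_coeff_of_tendsto_gram
        (𝒜.chart_mem a) hx (u := fun k => field (v k)) hx') i) j
  have hpos : ∀ᵐ x ∂(vol 𝒜 (field g)), ∀ w : TangentSpace (𝓡 n) x, w ≠ 0 → 0 < h x w w := by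
    refine (vol_absolutelyContinuous g).ae_le ?_
    filter_upwards [hcoef] with x hx
    rw [← coefM_posDef_iff 𝒜 (hsymm x)]
    have hdet : c ≤ (coefM 𝒜 h x).det :=
      ge_of_tendsto (((Continuous.matrix_det (A := fun M : Matrix (Fin n) (Fin n) ℝ => M)
        continuous_id).tendsto _).comp hx)
        (Eventually.of_forall fun k => (hreg (v k) (hv k) x).le_det)
    have hpsd : (coefM 𝒜 h x).PosSemidef := by
      refine .of_dotProduct_mulVec_nonneg ?_ fun w => ?_
      · rw [Matrix.IsHermitian, conjTranspose_eq_transpose_of_trivial, hsq.coefM_symm]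
      · rw [star_trivial]
        exact ge_of_tendsto' (((continuous_quadForm w).tendsto _).comp hx)
          fun k => quadForm_nonneg (hreg (v k) (hv k) x).posDef w
    exact hpsd.posDef_iff_det_ne_zero.mpr (hc0.trans_le hdet).ne'
  have htend : L2Tendsto 𝒜 (field g) v (toClass 𝒜 (field g) h) := by
    let R : ℕ → ℝ := fun k => ∑ i, ∑ j,
      (eLpNorm (f i j k - fun x => coefM 𝒜 h x i j) 2 (refMeasure 𝒜)).toReal
    have hR : Tendsto R atTop (𝓝 0) := by
      have : Tendsto R atTop (𝓝 (∑ _i : Fin n, ∑ _j : Fin n, (0 : ENNReal).toReal)) :=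
        tendsto_finsetSum _ fun i _ => tendsto_finsetSum _ fun j _ =>
          (ENNReal.tendsto_toReal ENNReal.zero_ne_top).comp (hconv i j)
      simpa using this
    have hle : ∀ k, l2Norm 𝒜 (field g) (field (v k) - h) ≤ K₂ * R k := fun k => by
      have hs := (sqInt_field (𝒜 := 𝒜) (v k)).sub hsq
      refine hK₂' g hreg' _ hs _ (Finset.sum_nonneg fun i _ => Finset.sum_nonneg fun j _ =>
        ENNReal.toReal_nonneg) fun i j => ?_
      have hfin : eLpNorm (f i j k - fun x => coefM 𝒜 h x i j) 2 (refMeasure 𝒜) ≠ ⊤ :=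
        (hs.memLp i j).2.ne
      change eLpNorm (f i j k - fun x => coefM 𝒜 h x i j) 2 (refMeasure 𝒜) ≤ _
      rw [← ENNReal.ofReal_toReal hfin]
      refine ENNReal.ofReal_le_ofReal ?_
      refine (Finset.single_le_sum (f := fun j => (eLpNorm (f i j k - fun x => coefM 𝒜 h x i j) 2
        (refMeasure 𝒜)).toReal) (fun j _ => ENNReal.toReal_nonneg) (Finset.mem_univ j)).trans ?_
      exact Finset.single_le_sum (f := fun i => ∑ j, (eLpNorm (f i j k - fun x =>
        coefM 𝒜 h x i j) 2 (refMeasure 𝒜)).toReal)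
        (fun i _ => Finset.sum_nonneg fun j _ => ENNReal.toReal_nonneg) (Finset.mem_univ i)
    refine squeeze_zero (fun k => l2Norm_nonneg _ _) hle ?_
    simpa using hR.const_mul K₂
  exact ⟨toClass 𝒜 (field g) h, ⟨⟨h, rfl, hL2, hpos⟩, v, hv, htend⟩, htend⟩

/-! ### The metric spaces `(𝒰, d)`, `(𝒰, ‖·‖_g)` and `𝒰⁰` -/

lemma exists_metricSpace {X : Type*} (d : X → X → ℝ) (h0 : ∀ x, d x x = 0)
    (hs : ∀ x y, d x y = d y x) (ht : ∀ x y z, d x z ≤ d x y + d y z)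
    (he : ∀ x y, d x y = 0 → x = y) :
    ∃ m : MetricSpace X, ∀ x y, m.dist x y = d x y :=
  ⟨{ dist := d
     dist_self := h0
     dist_comm := hs
     dist_triangle := ht
     eq_of_dist_eq_zero := fun {x y} => he x y }, fun _ _ => rfl⟩

omit [BorelSpace M] in
lemma l2Norm_sub_comm (h k : TensorField n M) :
    l2Norm 𝒜 (field g) (h - k) = l2Norm 𝒜 (field g) (k - h) := by
  rw [← neg_sub, l2Norm_neg]

lemma exists_rep (hg : g ∈ riemMetrics n M) (p : l2Closure 𝒜 (field g) 𝒰) :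
    ∃ h, toClass 𝒜 (field g) h = p.1 ∧ SqInt 𝒜 h := by
  obtain ⟨⟨h, hp, hL, -⟩, -⟩ := p.2
  exact ⟨h, hp, hL.sqInt hg⟩

lemma exists_metricSpace_l2Closure (hg : g ∈ riemMetrics n M) :
    ∃ m : MetricSpace (l2Closure 𝒜 (field g) 𝒰),
      ∀ p q : l2Closure 𝒜 (field g) 𝒰, m.dist p q = l2Dist 𝒜 (field g) p.1 q.1 := by
  refine exists_metricSpace (fun p q : l2Closure 𝒜 (field g) 𝒰 =>
    l2Dist 𝒜 (field g) p.1 q.1) (fun p => ?_) (fun p q => ?_)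
    (fun p q r => ?_) fun p q hpq => ?_
  · obtain ⟨h, hp, -⟩ := exists_rep hg p
    rw [← hp]
    change l2Norm 𝒜 (field g) (h - h) = 0
    rw [sub_self, l2Norm_zero]
  · obtain ⟨h, hp, -⟩ := exists_rep hg p
    obtain ⟨k, hq, -⟩ := exists_rep hg q
    rw [← hp, ← hq]
    exact l2Norm_sub_comm h k
  · obtain ⟨h, hp, hh⟩ := exists_rep hg p
    obtain ⟨k, hq, hk⟩ := exists_rep hg q
    obtain ⟨m, hr, hm⟩ := exists_rep hg r
    rw [← hp, ← hq, ← hr]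
    exact hh.l2Norm_sub_le hg hk hm
  · obtain ⟨h, hp, hh⟩ := exists_rep hg p
    obtain ⟨k, hq, hk⟩ := exists_rep hg q
    refine Subtype.ext ?_
    rw [← hp, ← hq] at hpq ⊢
    exact Quotient.sound (s := aeSetoid 𝒜 (field g)) (hh.ae_eq_of_l2Norm_sub hg hk hpq)

lemma exists_metricSpace_l2Norm (hg : g ∈ riemMetrics n M) :
    ∃ m : MetricSpace 𝒰,
      ∀ g₀ g₁ : 𝒰, m.dist g₀ g₁ = l2Norm 𝒜 (field g) (field (g₁.1 - g₀.1)) := by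
  refine exists_metricSpace (fun g₀ g₁ : 𝒰 => l2Norm 𝒜 (field g) (field (g₁.1 - g₀.1)))
    (fun p => ?_) (fun p q => ?_) (fun p q r => ?_) fun p q hpq => ?_
  · rw [sub_self]; exact l2Norm_zero
  · exact l2Norm_sub_comm (field q.1) (field p.1)
  · rw [add_comm]
    exact (sqInt_field r.1).l2Norm_sub_le hg (sqInt_field q.1) (sqInt_field p.1)
  · exact Subtype.ext (eq_of_l2Norm_sub_eq_zero hg hpq).symm

lemma IsAmenable.exists_metricSpace_riemDist (h𝒰 : IsAmenable 𝒜 g 𝒰)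
    (hg : g ∈ riemMetrics n M) :
    ∃ m : MetricSpace 𝒰, ∀ g₀ g₁ : 𝒰, m.dist g₀ g₁ = riemDist 𝒜 g₀.1 g₁.1 := by
  refine exists_metricSpace (fun g₀ g₁ : 𝒰 => riemDist 𝒜 g₀.1 g₁.1)
    (fun p => riemDist_self (h𝒰.subset p.2)) (fun p q => riemDist_comm _ _)
    (fun p q r => riemDist_triangle ⟨h𝒰.segment p.2 q.2⟩ ⟨h𝒰.segment q.2 r.2⟩) fun p q hpq => ?_
  obtain ⟨K, hK, hK'⟩ := h𝒰.exists_l2Norm_le hg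
  have := hK' p.1 p.2 q.1 q.2
  rw [hpq, mul_zero] at this
  exact Subtype.ext (eq_of_l2Norm_sub_eq_zero hg (le_antisymm this (l2Norm_nonneg _ _))).symm

end Completeness

/-! ### Bi-Lipschitz maps and completions -/

section Completion

lemma continuous_of_dist_le {X Y : Type*} [PseudoMetricSpace X] [PseudoMetricSpace Y] {f : X → Y}
    {K : ℝ} (hK : 0 < K) (h : ∀ x y, dist (f x) (f y) ≤ K * dist x y) : Continuous f :=
  (LipschitzWith.of_dist_le_mul (K := ⟨K, hK.le⟩) h).continuous

lemma topology_eq_of_dist_le {X : Type*} (m m' : MetricSpace X) {K K' : ℝ} (hK : 0 < K)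
    (hK' : 0 < K') (h : ∀ x y, m.dist x y ≤ K * m'.dist x y)
    (h' : ∀ x y, m'.dist x y ≤ K' * m.dist x y) :
    m.toPseudoMetricSpace.toUniformSpace.toTopologicalSpace =
      m'.toPseudoMetricSpace.toUniformSpace.toTopologicalSpace :=
  le_antisymm
    (continuous_id_iff_le.mp (@continuous_of_dist_le X X m.toPseudoMetricSpace
      m'.toPseudoMetricSpace id K' hK' h'))
    (continuous_id_iff_le.mp (@continuous_of_dist_le X X m'.toPseudoMetricSpace
      m.toPseudoMetricSpace id K hK h))

/-- The completion of `X` is any complete space in which `X` sits as a dense subspace with a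
uniformly equivalent metric, and the metric of the completion is computed there by limits. -/
lemma exists_completion_equiv {X Y : Type*} [MetricSpace X] [MetricSpace Y] [CompleteSpace Y]
    {ι : X → Y} (hι : IsUniformInducing ι) (hd : DenseRange ι) :
    ∃ Φ : UniformSpace.Completion X ≃ᵤ Y,
      (∀ x : X, Φ (x : UniformSpace.Completion X) = ι x) ∧
      ∃ D : Y → Y → ℝ,
        (∀ (p q : Y) (s t : ℕ → X), Tendsto (fun k => ι (s k)) atTop (𝓝 p) →
          Tendsto (fun k => ι (t k)) atTop (𝓝 q) →
          Tendsto (fun k => dist (s k) (t k)) atTop (𝓝 (D p q))) ∧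
        ∀ a b : UniformSpace.Completion X, dist a b = D (Φ a) (Φ b) := by
  let pkg : AbstractCompletion X :=
    { space := Y
      coe := ι
      uniformStruct := inferInstance
      complete := inferInstance
      separation := inferInstance
      isUniformInducing := hι
      dense := hd }
  let Φ : UniformSpace.Completion X ≃ᵤ Y := UniformSpace.Completion.cPkg.compareEquiv pkg
  have hΦ : ∀ x : X, Φ (x : UniformSpace.Completion X) = ι x := fun x =>
    UniformSpace.Completion.cPkg.compare_coe pkg x
  refine ⟨Φ, hΦ, fun p q => dist (Φ.symm p) (Φ.symm q), fun p q s t hs ht => ?_, fun a b => ?_⟩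
  · have key : ∀ (r : Y) (u : ℕ → X), Tendsto (fun k => ι (u k)) atTop (𝓝 r) →
        Tendsto (fun k => (u k : UniformSpace.Completion X)) atTop (𝓝 (Φ.symm r)) :=
      fun r u hu => by
        have h1 := (Φ.symm.continuous.tendsto r).comp hu
        refine h1.congr fun k => ?_
        rw [Function.comp, ← hΦ]
        exact Φ.symm_apply_apply _
    have h1 := (key p s hs).dist (key q t ht)
    exact h1.congr fun k => UniformSpace.Completion.dist_eq _ _
  · simp only [UniformEquiv.symm_apply_apply]

end Completion

/-! ### `𝒰` as a dense subspace of the complete space `𝒰⁰` -/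

section Embedding

variable {n : ℕ} {M : Type*} [TopologicalSpace M] [ChartedSpace (EuclideanSpace ℝ (Fin n)) M]
  [IsManifold (𝓡 n) ∞ M] [MeasurableSpace M] [BorelSpace M] {𝒜 : AmenableAtlas n M}
  {g : SymTensor n M} {𝒰 : Set (SymTensor n M)}

lemma isL2Tensor_field (hg : g ∈ riemMetrics n M) (h : SymTensor n M) :
    IsL2Tensor 𝒜 (field g) (field h) where
  symm := field_symm h
  measurable a i j := (continuousOn_pi.mp (continuousOn_pi.mp
    (continuousOn_coeff_comp_chart 𝒜 h a) i) j).aemeasurable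
      (𝒜.chart a).open_source.measurableSet
  integrable := (sqInt_field h).integrable_trPair hg

lemma IsAmenable.toClass_mem_l2Closure (h𝒰 : IsAmenable 𝒜 g 𝒰) (hg : g ∈ riemMetrics n M)
    {h : SymTensor n M} (hh : h ∈ 𝒰) : toClass 𝒜 (field g) (field h) ∈ l2Closure 𝒜 (field g) 𝒰 := by
  refine ⟨⟨field h, rfl, isL2Tensor_field hg h, Eventually.of_forall (h𝒰.subset hh)⟩,
    fun _ => h, fun _ => hh, tendsto_const_nhds.congr fun _ => ?_⟩
  change 0 = l2Norm 𝒜 (field g) (field h - field h)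
  rw [sub_self, l2Norm_zero]

/-- The inclusion of `𝒰` into `𝒰⁰`. -/
def IsAmenable.incl (h𝒰 : IsAmenable 𝒜 g 𝒰) (hg : g ∈ riemMetrics n M) (u : 𝒰) :
    l2Closure 𝒜 (field g) 𝒰 :=
  ⟨toClass 𝒜 (field g) (field u.1), h𝒰.toClass_mem_l2Closure hg u.2⟩

variable [m₀ : MetricSpace (l2Closure 𝒜 (field g) 𝒰)]
  (hm₀ : ∀ p q : l2Closure 𝒜 (field g) 𝒰, m₀.dist p q = l2Dist 𝒜 (field g) p.1 q.1)
  (h𝒰 : IsAmenable 𝒜 g 𝒰) (hg : g ∈ riemMetrics n M)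
include hm₀ h𝒰 hg

lemma IsAmenable.dist_incl (u v : 𝒰) :
    dist (h𝒰.incl hg u) (h𝒰.incl hg v) = l2Norm 𝒜 (field g) (field (u.1 - v.1)) :=
  hm₀ _ _

lemma IsAmenable.tendsto_incl_iff (s : ℕ → 𝒰) (p : l2Closure 𝒜 (field g) 𝒰) :
    Tendsto (fun k => h𝒰.incl hg (s k)) atTop (𝓝 p) ↔
      L2Tendsto 𝒜 (field g) (fun k => (s k).1) p.1 := by
  rw [tendsto_iff_dist_tendsto_zero]
  exact tendsto_congr fun k => hm₀ _ _

lemma IsAmenable.denseRange_incl : DenseRange (h𝒰.incl hg) := fun p => by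
  obtain ⟨s, hs, hsp⟩ := p.2.2
  exact mem_closure_of_tendsto ((h𝒰.tendsto_incl_iff hm₀ hg (fun k => ⟨s k, hs k⟩) p).mpr hsp)
    (Eventually.of_forall fun k => mem_range_self _)

lemma IsAmenable.completeSpace_l2Closure : CompleteSpace (l2Closure 𝒜 (field g) 𝒰) := by
  refine Metric.complete_of_convergent_controlled_sequences (fun N => (1 / 2) ^ N)
    (fun N => by positivity) fun u hu => ?_
  -- replace the given sequence by a sequence in `𝒰` with the same limits
  have hex : ∀ k, ∃ v : 𝒰, dist (u k) (h𝒰.incl hg v) < (1 / 2) ^ k := fun k => by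
    obtain ⟨_, ⟨v, rfl⟩, hv⟩ := Metric.mem_closure_iff.mp (h𝒰.denseRange_incl hm₀ hg (u k))
      ((1 / 2) ^ k) (by positivity)
    exact ⟨v, hv⟩
  choose v hv using hex
  have hle : ∀ {N k : ℕ}, N ≤ k → (1 / 2 : ℝ) ^ k ≤ (1 / 2) ^ N := fun h =>
    pow_le_pow_of_le_one (by norm_num) (by norm_num) h
  obtain ⟨p, hp, hvp⟩ := h𝒰.exists_l2_limit hg (v := fun k => (v k).1) (fun k => (v k).2)
    fun N k l hk hl => by
      rw [← h𝒰.dist_incl hm₀ hg]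
      have h1 := dist_triangle4 (h𝒰.incl hg (v k)) (u k) (u l) (h𝒰.incl hg (v l))
      have h2 := hu N k l hk hl
      have h3 := hv k
      rw [dist_comm] at h3
      linarith [hv l, hle hk, hle hl]
  refine ⟨⟨p, hp⟩, ?_⟩
  have hlim := (h𝒰.tendsto_incl_iff hm₀ hg v ⟨p, hp⟩).mpr hvp
  rw [tendsto_iff_dist_tendsto_zero] at hlim ⊢
  refine squeeze_zero (fun _ => dist_nonneg)
    (fun k => (dist_triangle _ (h𝒰.incl hg (v k)) _).trans (add_le_add_left (hv k).le _)) ?_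
  simpa using (tendsto_pow_atTop_nhds_zero_of_lt_one (r := (1 / 2 : ℝ)) (by norm_num)
    (by norm_num)).add hlim

end Embedding

end MetricManifold

end

theorem mainTheorem5 {n : ℕ} {M : Type*} [TopologicalSpace M] [T2Space M] [CompactSpace M]
    [ChartedSpace (EuclideanSpace ℝ (Fin n)) M] [IsManifold (𝓡 n) ∞ M]
    [MeasurableSpace M] [BorelSpace M]
    (𝒜 : MetricManifold.AmenableAtlas n M)
    (g : MetricManifold.SymTensor n M) (hg : g ∈ MetricManifold.riemMetrics n M)
    (𝒰 : Set (MetricManifold.SymTensor n M)) (h𝒰 : MetricManifold.IsAmenable 𝒜 g 𝒰) :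
    -- `d` is a metric on `𝒰`
    ∃ m : MetricSpace 𝒰,
      (∀ g₀ g₁ : 𝒰, m.dist g₀ g₁ = MetricManifold.riemDist 𝒜 g₀.1 g₁.1) ∧
      -- the topology of `d` on `𝒰` is the `L²` topology
      (∃ m' : MetricSpace 𝒰,
        (∀ g₀ g₁ : 𝒰, m'.dist g₀ g₁ = MetricManifold.l2Norm 𝒜 (MetricManifold.field g)
          (MetricManifold.field (g₁.1 - g₀.1))) ∧
        m.toPseudoMetricSpace.toUniformSpace.toTopologicalSpace =
          m'.toPseudoMetricSpace.toUniformSpace.toTopologicalSpace) ∧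
      -- `d` is Lipschitz with respect to the `L²` norm
      (∃ K : ℝ, ∀ g₀ ∈ 𝒰, ∀ g₁ ∈ 𝒰, MetricManifold.riemDist 𝒜 g₀ g₁ ≤
        K * MetricManifold.l2Norm 𝒜 (MetricManifold.field g) (MetricManifold.field (g₁ - g₀))) ∧
      -- the `L²` norm is uniformly continuous with respect to `d`
      (∀ ε > (0 : ℝ), ∃ δ > (0 : ℝ), ∀ g₀ ∈ 𝒰, ∀ g₁ ∈ 𝒰, MetricManifold.riemDist 𝒜 g₀ g₁ < δ →
        MetricManifold.l2Norm 𝒜 (MetricManifold.field g)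
          (MetricManifold.field (g₀ - g₁)) < ε) ∧
      -- the completion of `(𝒰, d)` is `𝒰⁰` with the `L²` metric, through the extension `Φ` of the
      -- inclusion, and `Φ` is an isometry for the limit metric `D` on `𝒰⁰`
      ∃ m₀ : MetricSpace (MetricManifold.l2Closure 𝒜 (MetricManifold.field g) 𝒰),
        (∀ p q : MetricManifold.l2Closure 𝒜 (MetricManifold.field g) 𝒰,
          m₀.dist p q = MetricManifold.l2Dist 𝒜 (MetricManifold.field g) p.1 q.1) ∧
        ∃ Φ : UniformSpace.Completion 𝒰 ≃ᵤ MetricManifold.l2Closure 𝒜 (MetricManifold.field g) 𝒰,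
          (∀ u : 𝒰, (Φ (u : UniformSpace.Completion 𝒰)).1 =
            MetricManifold.toClass 𝒜 (MetricManifold.field g) (MetricManifold.field u.1)) ∧
          ∃ D : MetricManifold.l2Closure 𝒜 (MetricManifold.field g) 𝒰 →
              MetricManifold.l2Closure 𝒜 (MetricManifold.field g) 𝒰 → ℝ,
            (∀ (p q : MetricManifold.l2Closure 𝒜 (MetricManifold.field g) 𝒰)
              (s t : ℕ → MetricManifold.SymTensor n M), (∀ k, s k ∈ 𝒰) → (∀ k, t k ∈ 𝒰) →
              MetricManifold.L2Tendsto 𝒜 (MetricManifold.field g) s p.1 →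
              MetricManifold.L2Tendsto 𝒜 (MetricManifold.field g) t q.1 →
              Tendsto (fun k => MetricManifold.riemDist 𝒜 (s k) (t k)) atTop (𝓝 (D p q))) ∧
            ∀ a b : UniformSpace.Completion 𝒰, dist a b = D (Φ a) (Φ b) := by
  obtain ⟨m', hm'⟩ := MetricManifold.exists_metricSpace_l2Norm (𝒜 := 𝒜) (𝒰 := 𝒰) hg
  obtain ⟨m, hm⟩ := h𝒰.exists_metricSpace_riemDist hg
  obtain ⟨m₀, hm₀⟩ := MetricManifold.exists_metricSpace_l2Closure (𝒜 := 𝒜) (𝒰 := 𝒰) hg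
  obtain ⟨K, hK, hdK⟩ := h𝒰.exists_riemDist_le hg
  obtain ⟨K', hK', hlK⟩ := h𝒰.exists_l2Norm_le hg
  refine ⟨m, hm, ⟨m', hm', MetricManifold.topology_eq_of_dist_le m m' hK hK' ?_ ?_⟩, ⟨K, hdK⟩,
    fun ε hε => ⟨ε / K', div_pos hε hK', fun g₀ h₀ g₁ h₁ hd => ?_⟩, m₀, hm₀, ?_⟩
  · intro x y
    rw [hm, hm']
    exact hdK _ x.2 _ y.2
  · intro x y
    rw [hm, hm']
    exact hlK _ x.2 _ y.2
  · rw [lt_div_iff₀' hK'] at hd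
    exact (MetricManifold.l2Norm_sub_comm (MetricManifold.field g₀)
      (MetricManifold.field g₁)).trans_lt ((hlK _ h₀ _ h₁).trans_lt hd)
  · have hcomplete := h𝒰.completeSpace_l2Closure hm₀ hg
    have hle : ∀ u v : 𝒰, dist (h𝒰.incl hg u) (h𝒰.incl hg v) ≤ K' * dist u v := fun u v => by
      rw [h𝒰.dist_incl hm₀ hg, dist_comm u v]
      exact (hlK _ v.2 _ u.2).trans_eq (congrArg (K' * ·) (hm v u).symm)
    have hge : ∀ u v : 𝒰, dist u v ≤ K * dist (h𝒰.incl hg u) (h𝒰.incl hg v) := fun u v => by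
      rw [h𝒰.dist_incl hm₀ hg, dist_comm u v]
      exact (hm v u).le.trans (hdK _ v.2 _ u.2)
    have hind : IsUniformInducing (h𝒰.incl hg) :=
      (AntilipschitzWith.of_le_mul_dist (K := ⟨K, hK.le⟩) hge).isUniformInducing
        (LipschitzWith.of_dist_le_mul (K := ⟨K', hK'.le⟩) hle).uniformContinuous
    obtain ⟨Φ, hΦ, D, hD, hDΦ⟩ :=
      MetricManifold.exists_completion_equiv hind (h𝒰.denseRange_incl hm₀ hg)
    refine ⟨Φ, fun u => congrArg Subtype.val (hΦ u), D, fun p q s t hs ht hsp htq => ?_, hDΦ⟩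
    exact (hD p q (fun k => ⟨s k, hs k⟩) (fun k => ⟨t k, ht k⟩)
      ((h𝒰.tendsto_incl_iff hm₀ hg _ p).mpr hsp)
      ((h𝒰.tendsto_incl_iff hm₀ hg _ q).mpr htq)).congr fun k => hm _ _
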